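/- For every $c \in \mathbb{N}$ there are a randomized one-pass streaming algorithm (a fixed program for a machine with words of $\Theta(\log n)$ bits, the same for all $n$ and $\Delta$) and constants $C, k$ such that the following holds for all $n$ and all $\Delta \ge 1$. Let $G$ be any simple graph on the vertex set $\{0,\dots,n-1\}$ with maximum degree $\Delta$. The algorithm is given $n$ and $\Delta$, and the edges of $G$ arrive one by one in an arbitrary order that is fixed before the algorithm makes its random choices. The algorithm works in a memory of at most $C\, n\sqrt{\Delta}\,(\log n)^k = \widetilde{O}(n\sqrt{\Delta})$ words (besides a constant number of words that hold $n$, $\Delta$ and the temporaries of the current instruction; its working memory while processing an edge and at the end of the stream is included), and it writes its output to a write-only stream that does not count as memory. With probability at least $1 - n^{-c}$ it halts and the output reports every edge of $G$ exactly once, with its color in some proper edge coloring of $G$ with at most $C\Delta$ colors (edges that share an endpoint receive different colors). -/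

import Mathlib

/-!
A randomized word machine for one-pass streaming with streamed output.

A program is a fixed finite text (it does not depend on the number of vertices `n`, the maximum
degree `Δ` or the input). It works on `r` named arrays of `M` cells each, every cell holding one
word of `w` bits. Programs have no procedures or recursion, so besides the `r * M` cells there are
only the two read-only parameters `n` and `Δ`, the position in the program text, and the
temporaries of a single expression, a number of words that depends on the text alone. The input
can only be read edge by edge, once, and the output can only be appended to. The input edges not
yet read and the output already written do not count as memory.
-/

namespace WStream

/-- Word operations (`sub` is truncated, division by zero gives zero, comparisons give 0 or 1). -/
inductive BinOp where
  | add | sub | mul | div | mod | lt | eq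

/-- The value of a word operation, before the check for overflow. -/
def BinOp.apply : BinOp → ℕ → ℕ → ℕ
  | .add, x, y => x + y
  | .sub, x, y => x - y
  | .mul, x, y => x * y
  | .div, x, y => x / y
  | .mod, x, y => x % y
  | .lt, x, y => if x < y then 1 else 0
  | .eq, x, y => if x = y then 1 else 0

/-- Expressions over `r` arrays: literals, the two parameters, array cells, word operations. -/
inductive Expr (r : ℕ) where
  | lit (k : ℕ)
  | numVertices
  | maxDegree
  | load (a : Fin r) (i : Expr r)
  | op (o : BinOp) (x y : Expr r)

/-- Programs over `r` arrays. -/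
inductive Cmd (r : ℕ) where
  /-- Do nothing. -/
  | skip
  /-- `a[i] := x`. -/
  | store (a : Fin r) (i x : Expr r)
  /-- `a[i] :=` a fresh uniformly random element of `{0, …, x - 1}`. -/
  | rand (a : Fin r) (i x : Expr r)
  /-- If the input has a next edge `(u, v)`, consume it, set `a[0] := u` and `b[0] := v`, and
  continue with `onEdge`; if the input is exhausted, continue with `onEnd`. -/
  | next (a b : Fin r) (onEdge onEnd : Cmd r)
  /-- Append the report "edge `uv` has color `c`" to the output. -/
  | report (u v c : Expr r)
  | seq (p q : Cmd r)
  /-- Run `p` if `x` is nonzero, and `q` otherwise. -/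
  | ite (x : Expr r) (p q : Cmd r)
  /-- Run `p` as long as `x` is nonzero. -/
  | loop (x : Expr r) (p : Cmd r)

/-- The resources and parameters of a run: the parameters `n` and `Δ` given to the program, the
number `cells` of cells of each array, and the number `bits` of bits of a word. -/
structure Env where
  n : ℕ
  Δ : ℕ
  cells : ℕ
  bits : ℕ

/-- A state: the memory contents, the unread input and the output written so far. -/
structure State (r : ℕ) where
  mem : Fin r → ℕ → ℕ
  input : List (ℕ × ℕ)
  output : List (ℕ × ℕ × ℕ)

/-- A number as a word: fails on overflow. -/
def Env.word (E : Env) (x : ℕ) : Option ℕ :=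
  if x < 2 ^ E.bits then some x else none

/-- Value of an expression; fails if some intermediate value is not a word, or on an access beyond
the end of an array. -/
def Expr.eval {r : ℕ} (E : Env) (m : Fin r → ℕ → ℕ) : Expr r → Option ℕ
  | .lit k => E.word k
  | .numVertices => E.word E.n
  | .maxDegree => E.word E.Δ
  | .load a i => (i.eval E m).bind fun i => if i < E.cells then some (m a i) else none
  | .op o x y => (x.eval E m).bind fun x => (y.eval E m).bind fun y => E.word (o.apply x y)

/-- Write the value `x` to `a[i]`; fails if `x` is not a word or `a` has no cell `i`. -/
def State.write {r : ℕ} (E : Env) (s : State r) (a : Fin r) (i x : ℕ) : Option (State r) :=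
  if i < E.cells then
    (E.word x).map fun x =>
      { s with mem := Function.update s.mem a (Function.update (s.mem a) i x) }
  else none

/-- Sequencing of random computations that may fail (`none`). -/
noncomputable def andThen {α β : Type} (p : PMF (Option α)) (f : α → PMF (Option β)) :
    PMF (Option β) :=
  p.bind fun o => o.elim (PMF.pure none) f

/-- Uniform distribution on `{0, …, k - 1}`; fails if `k = 0`. -/
noncomputable def uniformBelow : ℕ → PMF (Option ℕ)
  | 0 => PMF.pure none
  | k + 1 => (PMF.uniformOfFintype (Fin (k + 1))).map fun i => some (i : ℕ)

/-- The distribution of the final state of a run of a program that is cut off (with failure) once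
the nesting of calls of `run` exceeds the given fuel. The outcome `none` means that the run was cut
off, or that it crashed: by an overflow of a word, by an access beyond the end of an array, or by a
random choice from the empty set. -/
noncomputable def Cmd.run {r : ℕ} (E : Env) : ℕ → Cmd r → State r → PMF (Option (State r))
  | 0, _, _ => PMF.pure none
  | _ + 1, .skip, s => PMF.pure (some s)
  | _ + 1, .store a i x, s =>
      PMF.pure ((i.eval E s.mem).bind fun i => (x.eval E s.mem).bind fun x => s.write E a i x)
  | _ + 1, .rand a i x, s =>
      andThen (PMF.pure (i.eval E s.mem)) fun i =>
        andThen (PMF.pure (x.eval E s.mem)) fun x =>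
          andThen (uniformBelow x) fun y => PMF.pure (s.write E a i y)
  | fuel + 1, .next a b p q, s =>
      match s.input with
      | [] => q.run E fuel s
      | (u, v) :: rest =>
          andThen (PMF.pure (({ s with input := rest }.write E a 0 u).bind
            fun t => t.write E b 0 v)) fun t => p.run E fuel t
  | _ + 1, .report u v c, s =>
      PMF.pure ((u.eval E s.mem).bind fun u => (v.eval E s.mem).bind fun v =>
        (c.eval E s.mem).map fun c => { s with output := s.output ++ [(u, v, c)] })
  | fuel + 1, .seq p q, s => andThen (p.run E fuel s) fun t => q.run E fuel t
  | fuel + 1, .ite x p q, s =>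
      andThen (PMF.pure (x.eval E s.mem)) fun x =>
        if x = 0 then q.run E fuel s else p.run E fuel s
  | fuel + 1, .loop x p, s =>
      andThen (PMF.pure (x.eval E s.mem)) fun y =>
        if y = 0 then PMF.pure (some s)
        else andThen (p.run E fuel s) fun t => (Cmd.loop x p).run E fuel t

/-- `σ` lists every edge of `G` exactly once (in an arbitrary order, with the two endpoints of each
edge in an arbitrary order). -/
def IsEdgeStream {n : ℕ} (G : SimpleGraph (Fin n)) (σ : List (Fin n × Fin n)) : Prop :=
  (σ.map fun p => s(p.1, p.2)).Nodup ∧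
    ∀ e : Sym2 (Fin n), e ∈ (σ.map fun p => s(p.1, p.2)) ↔ e ∈ G.edgeSet

/-- The state before the first step: memory all zero, input `σ`, empty output. -/
def initial (r : ℕ) {n : ℕ} (σ : List (Fin n × Fin n)) : State r where
  mem := fun _ _ => 0
  input := σ.map fun p => ((p.1 : ℕ), (p.2 : ℕ))
  output := []

/-- The output `out` reports a proper edge coloring of `G` with colors from `{0, …, K - 1}`: for
some proper edge coloring `χ`, it reports every edge exactly once, with its color under `χ`, and
nothing else. -/
def ReportsEdgeColoring {n : ℕ} (G : SimpleGraph (Fin n)) (K : ℕ) (out : List (ℕ × ℕ × ℕ)) : Prop :=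
  ∃ χ : G.lineGraph.Coloring (Fin K),
    (out.map fun t => (s(t.1, t.2.1), t.2.2)).Nodup ∧
    ∀ x : Sym2 ℕ × ℕ, x ∈ (out.map fun t => (s(t.1, t.2.1), t.2.2)) ↔
      ∃ e : G.edgeSet, x = (Sym2.map (fun v : Fin n => (v : ℕ)) e, (χ e : ℕ))

/-- The probability that the program `P`, started on the stream `σ` with the resources `E`, ends
within the given fuel without a crash and reports a proper edge coloring of `G` with `K` colors. -/
noncomputable def successProb {r n : ℕ} (P : Cmd r) (E : Env) (fuel : ℕ) (G : SimpleGraph (Fin n))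
    (K : ℕ) (σ : List (Fin n × Fin n)) : ℝ :=
  ((P.run E fuel (initial r σ)).toOuterMeasure
    {o | ∃ s, o = some s ∧ ReportsEdgeColoring G K s.output}).toReal

end WStream

/-!
A one-pass edge coloring algorithm with `O(Δ)` colors and memory `Õ(n √Δ)`.

*The algorithm.* Let `S` be about `√Δ log n` and `D = 64 * S`. The edges pass through a cascade of
`O(log n)` levels, each of which colors so many edges that the maximum degree of the rest drops by a
constant factor. A level whose input has maximum degree at most `d` has its own `Q = d / S + 1` palettes
of `D` colors. Every vertex chooses a random side, and only edges between the sides are treated, one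
endpoint being their center and the other their leaf. A center uses one palette for its first `S`
edges (its first phase), then the next palette, and so on cyclically from a random start, so that
different phases have different palettes. A leaf uses the colors of each palette cyclically from a
random start. This color is assigned to the edge unless the center has already chosen it in its
current phase. Conflicts at a leaf are thus excluded as long as it has at most `D` edges in each
palette, and conflicts at a center are excluded by construction (`color_ne_of_succeeds`). What remains
uncolored is the input of the next level. Once the degree bound has dropped below
`T = O(√Δ polylog n)`, the remaining edges are colored greedily with `2 * T` further colors. As the
degree bounds decrease geometrically, `O(Δ)` colors are used altogether (`base_add_le`). For every
level and vertex the memory holds `O(D)` words, and for the greedy coloring `2 * T` words per vertex.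

*The analysis.* A level is favorable (`LevelGood`) if no leaf uses up a palette and at most
`7 / 8 * d` edges are left over at each vertex. An edge is left over if its ends are on the same side,
which has probability `1 / 2`, or if its color is taken, which has probability at most
`S / D = 1 / 64`, because only the at most `S` colors of the current phase matter. The random numbers
are independent, and conditionally on the past of a vertex each of its edges sees a fresh random
number, that of its *other* endpoint; at a leaf, it is the failures in *different palettes* that are
governed by different random numbers. This gives exponential moment bounds by redrawing one random
number at a time (`avgs_mul_le`, `avgs_avg_choice`), hence `avgs_not_levelGood_le`, and, conditioning
on the lower levels, `le_avgs_allGood`. The stream is fixed before the random choices are made, so all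
random numbers may be drawn in advance and expectations are plain iterated averages `avgs` over the
cells of a finite table.

*The program.* The specification of the levels is by recursion on the list of the edges that have
arrived so far, newest first. The program `program K` fills the random table and then maintains the
quantities of the specification in its arrays (`Tables`). The rules for `Runs` treat deterministic
parts, and `ProbThenGe.loop_rand` turns the loop that fills the random table into an average, so that
the success probability of the program is at least the average of the indicator of the favorable
tables (`program_probGe`).
-/

namespace WStream

/-! ### Averaging over the cells of a random table -/

section Averaging

variable {ι : Type} [DecidableEq ι]

/-- The average of `F` over a uniformly random value in `{0, …, D - 1}` of the cell `k`, the other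
cells being kept. -/
noncomputable def avg (D : ℕ) (k : ι) (F : (ι → ℕ) → ℝ) (q : ι → ℕ) : ℝ :=
  (∑ y ∈ Finset.range D, F (Function.update q k y)) / D

/-- The average of `F` over independent uniformly random values of the cells in `l`: the
expectation of `F` over a random table, the cells outside `l` being kept. -/
noncomputable def avgs (D : ℕ) (l : List ι) (F : (ι → ℕ) → ℝ) : (ι → ℕ) → ℝ :=
  l.foldr (avg D) F

variable {D : ℕ} {F G : (ι → ℕ) → ℝ}

@[simp] lemma avgs_nil : avgs D ([] : List ι) F = F := rfl

@[simp] lemma avgs_cons (k : ι) (l : List ι) : avgs D (k :: l) F = avg D k (avgs D l F) := rfl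

lemma avgs_append (l l' : List ι) : avgs D (l ++ l') F = avgs D l (avgs D l' F) := by
  simp [avgs]

lemma avg_mono (k : ι) (h : ∀ q, F q ≤ G q) (q : ι → ℕ) : avg D k F q ≤ avg D k G q := by
  unfold avg
  gcongr
  exact h _

lemma avgs_mono (l : List ι) (h : ∀ q, F q ≤ G q) (q : ι → ℕ) :
    avgs D l F q ≤ avgs D l G q := by
  induction l generalizing q with
  | nil => exact h q
  | cons k l ih => exact avg_mono k ih q

lemma avg_const (hD : 0 < D) (k : ι) (a : ℝ) (q : ι → ℕ) : avg D k (fun _ => a) q = a := by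
  have : (D : ℝ) ≠ 0 := by positivity
  simp [avg]
  field_simp

lemma avgs_const (hD : 0 < D) (l : List ι) (a : ℝ) (q : ι → ℕ) :
    avgs D l (fun _ => a) q = a := by
  induction l generalizing q with
  | nil => rfl
  | cons k l ih =>
    have : avgs D l (fun _ => a) = fun _ => a := funext ih
    rw [avgs_cons, this, avg_const hD]

lemma avgs_le_of_le (hD : 0 < D) (l : List ι) {a : ℝ} (h : ∀ q, F q ≤ a) (q : ι → ℕ) :
    avgs D l F q ≤ a :=
  (avgs_mono l h q).trans_eq (avgs_const hD l a q)

lemma avg_add (k : ι) (q : ι → ℕ) :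
    avg D k (fun q => F q + G q) q = avg D k F q + avg D k G q := by
  simp [avg, Finset.sum_add_distrib, add_div]

lemma avgs_add (l : List ι) (q : ι → ℕ) :
    avgs D l (fun q => F q + G q) q = avgs D l F q + avgs D l G q := by
  induction l generalizing q with
  | nil => rfl
  | cons k l ih => rw [avgs_cons, funext ih, avg_add]; rfl

lemma avg_mul_left (k : ι) (a : ℝ) (q : ι → ℕ) :
    avg D k (fun q => a * F q) q = a * avg D k F q := by
  simp [avg, ← Finset.mul_sum, mul_div_assoc]

lemma avgs_mul_left (l : List ι) (a : ℝ) (q : ι → ℕ) :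
    avgs D l (fun q => a * F q) q = a * avgs D l F q := by
  induction l generalizing q with
  | nil => rfl
  | cons k l ih => rw [avgs_cons, funext ih, avg_mul_left]; rfl

lemma avgs_sub (l : List ι) (q : ι → ℕ) :
    avgs D l (fun q => F q - G q) q = avgs D l F q - avgs D l G q := by
  have h := avgs_add (D := D) (F := F) (G := fun q => (-1) * G q) l q
  rw [avgs_mul_left] at h
  simp only [neg_mul, one_mul, ← sub_eq_add_neg] at h
  exact h

lemma avgs_finset_sum {α : Type} (t : Finset α) (l : List ι) (f : α → (ι → ℕ) → ℝ) (hD : 0 < D)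
    (q : ι → ℕ) : avgs D l (fun q => ∑ i ∈ t, f i q) q = ∑ i ∈ t, avgs D l (f i) q := by
  classical
  induction t using Finset.induction_on with
  | empty => simpa using avgs_const hD l 0 q
  | insert a s ha ih =>
    simp only [Finset.sum_insert ha]
    rw [avgs_add, ih]

lemma avg_comm (k k' : ι) : avg D k (avg D k' F) = avg D k' (avg D k F) := by
  by_cases h : k = k'
  · rw [h]
  funext q
  simp only [avg, ← Finset.sum_div]
  rw [Finset.sum_comm]
  simp only [Function.update_comm h]

lemma avg_idem (hD : 0 < D) (k : ι) : avg D k (avg D k F) = avg D k F := by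
  funext q
  have : (D : ℝ) ≠ 0 := by positivity
  simp only [avg, Function.update_idem, Finset.sum_const, Finset.card_range, nsmul_eq_mul]
  field_simp

lemma avgs_avg_comm (l : List ι) (k : ι) : avgs D l (avg D k F) = avg D k (avgs D l F) := by
  induction l with
  | nil => rfl
  | cons k' l ih => rw [avgs_cons, ih, avg_comm, avgs_cons]

lemma avgs_perm {l l' : List ι} (h : l.Perm l') : avgs D l F = avgs D l' F := by
  induction h with
  | nil => rfl
  | cons k _ ih => rw [avgs_cons, ih, avgs_cons]
  | swap k k' l => simp only [avgs_cons]; rw [avg_comm]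
  | trans _ _ h₁ h₂ => rw [h₁, h₂]

/-- Redrawing a single cell does not change an expectation. -/
lemma avgs_avg (hD : 0 < D) {l : List ι} {k : ι} (hk : k ∈ l) :
    avgs D l (avg D k F) = avgs D l F := by
  induction l with
  | nil => simp at hk
  | cons k' l ih =>
    rcases List.mem_cons.1 hk with rfl | hk
    · rw [avgs_cons, avgs_avg_comm, avg_idem hD, avgs_cons]
    · rw [avgs_cons, ih hk, avgs_cons]

/-- Redrawing a cell `κ q` that is chosen depending on the table does not change an expectation,
as long as the choice does not depend on the content of the chosen cell. -/
lemma avgs_avg_choice (hD : 0 < D) {l : List ι} (κ : (ι → ℕ) → ι) (hl : ∀ q, κ q ∈ l)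
    (hκ : ∀ q y, κ (Function.update q (κ q) y) = κ q) (q : ι → ℕ) :
    avgs D l (fun q => avg D (κ q) F q) q = avgs D l F q := by
  have split : ∀ f : (ι → ℕ) → ℝ,
      f = fun q => ∑ k ∈ l.toFinset, if κ q = k then f q else 0 := by
    intro f; funext q
    rw [Finset.sum_ite_eq, if_pos (List.mem_toFinset.2 (hl q))]
  conv_lhs => rw [split (fun q => avg D (κ q) F q)]
  conv_rhs => rw [split F]
  rw [avgs_finset_sum _ _ _ hD, avgs_finset_sum _ _ _ hD]
  refine Finset.sum_congr rfl fun k hk => ?_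
  rw [← avgs_avg hD (List.mem_toFinset.1 hk) (F := fun q => if κ q = k then F q else 0)]
  congr 1
  funext q
  -- the event that the cell `k` is chosen does not depend on the content of `k`
  have key : ∀ y, κ (Function.update q k y) = k ↔ κ q = k := by
    intro y
    constructor
    · intro h
      have := hκ (Function.update q k y) (q k)
      rw [h, Function.update_idem, Function.update_eq_self] at this
      exact this
    · rintro rfl
      exact hκ q y
  by_cases h : κ q = k
  · simp [avg, key, h]
  · simp [avg, key, h]

/-- Averages over `l` only see tables that agree outside `l`. -/
lemma avgs_congr (l : List ι) (q : ι → ℕ)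
    (h : ∀ q', (∀ k, k ∉ l → q' k = q k) → F q' = G q') : avgs D l F q = avgs D l G q := by
  induction l generalizing q with
  | nil => exact h q fun _ _ => rfl
  | cons k l ih =>
    simp only [avgs_cons, avg]
    congr 1
    refine Finset.sum_congr rfl fun y _ => ih _ fun q' hq' => h q' fun k' hk' => ?_
    simp only [List.mem_cons, not_or] at hk'
    rw [hq' k' hk'.2, Function.update_of_ne hk'.1]

/-- One step of an exponential moment bound: a factor whose conditional average is at most `1` may
be dropped. -/
lemma avgs_mul_le (hD : 0 < D) {l : List ι} (κ : (ι → ℕ) → ι) (hl : ∀ q, κ q ∈ l)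
    (hκ : ∀ q y, κ (Function.update q (κ q) y) = κ q) (hG : ∀ q y, G (Function.update q (κ q) y) = G q)
    (hG0 : ∀ q, 0 ≤ G q) (hF : ∀ q, avg D (κ q) F q ≤ 1) (q : ι → ℕ) :
    avgs D l (fun q => G q * F q) q ≤ avgs D l G q := by
  rw [← avgs_avg_choice hD κ hl hκ]
  refine avgs_mono l (fun q => ?_) q
  have : avg D (κ q) (fun q => G q * F q) q = G q * avg D (κ q) F q := by
    simp only [avg, hG, ← Finset.mul_sum, mul_div_assoc]
  rw [this]
  exact mul_le_of_le_one_right (hG0 q) (hF q)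

/-- On `[0, 1]` the exponential lies below its chord, whose slope `exp 1 - 1` is less than `2`. -/
lemma exp_le_one_add_two_mul {t : ℝ} (h0 : 0 ≤ t) (h1 : t ≤ 1) : Real.exp t ≤ 1 + 2 * t := by
  have h := convexOn_exp.2 (Set.mem_univ (0 : ℝ)) (Set.mem_univ (1 : ℝ)) (sub_nonneg.2 h1) h0
    (by ring)
  simp only [smul_eq_mul, mul_zero, mul_one, zero_add, Real.exp_zero] at h
  have := Real.exp_one_lt_d9
  nlinarith

/-- A moment bound for a single redrawn cell: if `f` takes values in `[0, 1]` and has average at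
most `a`, then `exp (f - 2 a)` has average at most `1`. -/
lemma avg_exp_le_one (hD : 0 < D) (k : ι) {f : (ι → ℕ) → ℝ} {a : ℝ} (q : ι → ℕ)
    (h0 : ∀ y, 0 ≤ f (Function.update q k y)) (h1 : ∀ y, f (Function.update q k y) ≤ 1)
    (ha : ∑ y ∈ Finset.range D, f (Function.update q k y) ≤ a * D) :
    avg D k (fun q => Real.exp (f q - 2 * a)) q ≤ 1 := by
  have hD' : (0 : ℝ) < D := by positivity
  unfold avg
  rw [div_le_one hD']
  calc ∑ y ∈ Finset.range D, Real.exp (f (Function.update q k y) - 2 * a)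
      ≤ ∑ y ∈ Finset.range D, Real.exp (-(2 * a)) * (1 + 2 * f (Function.update q k y)) := by
        refine Finset.sum_le_sum fun y _ => ?_
        rw [sub_eq_neg_add, Real.exp_add]
        gcongr
        exact exp_le_one_add_two_mul (h0 y) (h1 y)
    _ = Real.exp (-(2 * a)) * (D + 2 * ∑ y ∈ Finset.range D, f (Function.update q k y)) := by
        rw [← Finset.mul_sum, Finset.sum_add_distrib, ← Finset.mul_sum]; simp
    _ ≤ Real.exp (-(2 * a)) * (D * Real.exp (2 * a)) := by
        gcongr
        have := Real.add_one_le_exp (2 * a)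
        nlinarith
    _ = D := by rw [mul_left_comm, ← Real.exp_add]; simp

/-- Markov's inequality for an exponential moment: an event on which `X` is at least `t` has
probability at most `exp (-t)` times the exponential moment of `X`. -/
lemma avgs_indicator_le {l : List ι} {B : (ι → ℕ) → Prop} [DecidablePred B]
    {X : (ι → ℕ) → ℝ} {t : ℝ} (hX : ∀ q, B q → t ≤ X q) (q : ι → ℕ)
    (hm : avgs D l (fun q => Real.exp (X q)) q ≤ 1) :
    avgs D l (fun q => if B q then 1 else 0) q ≤ Real.exp (-t) := by
  calc avgs D l (fun q => if B q then 1 else 0) q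
      ≤ avgs D l (fun q => Real.exp (-t) * Real.exp (X q)) q := by
        refine avgs_mono l (fun q => ?_) q
        split_ifs with h
        · rw [← Real.exp_add]; exact Real.one_le_exp (by linarith [hX q h])
        · positivity
    _ ≤ Real.exp (-t) := by
        rw [avgs_mul_left]
        exact mul_le_of_le_one_right (Real.exp_pos _).le hm

/-- Cells of a table of tables: averaging over cells of the `i`-th table. -/
lemma avgs_map_prod {α : Type} [DecidableEq α] (i : α) (l : List ι) (s : α × ι → ℕ) :
    avgs D (l.map (Prod.mk i)) (fun s => F fun k => s (i, k)) s = avgs D l F fun k => s (i, k) := by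
  induction l generalizing s with
  | nil => rfl
  | cons k l ih =>
    simp only [List.map_cons, avgs_cons, avg]
    congr 1
    refine Finset.sum_congr rfl fun y _ => ?_
    rw [ih]
    congr 1
    funext k'
    simp [Function.update_apply]

end Averaging

/-! ### One level of the algorithm -/

/-- Histories (lists of edges, the newest edge first) of a simple graph on `{0, …, n - 1}`. -/
def SimpleHist (n : ℕ) (h : List (ℕ × ℕ)) : Prop :=
  (h.map fun e => s(e.1, e.2)).Nodup ∧ ∀ e ∈ h, e.1 < n ∧ e.2 < n ∧ e.1 ≠ e.2

/-- The degree of the vertex `w` in the graph with the edges `h`. -/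
def hdeg (h : List (ℕ × ℕ)) (w : ℕ) : ℕ := h.countP fun e => e.1 = w ∨ e.2 = w

section Level

variable (D S Q : ℕ) (q : ℕ × ℕ → ℕ)

/-- The random side of a vertex: leaves are on side `0`, centers on side `1`. -/
def side (v : ℕ) : ℕ := q (v, 0) % 2

/-- The endpoints of `e` are on different sides. -/
def Cross (e : ℕ × ℕ) : Prop := side q e.1 ≠ side q e.2

instance (e : ℕ × ℕ) : Decidable (Cross q e) := inferInstanceAs (Decidable (_ ≠ _))

/-- The center of an edge between the two sides. -/
def center (e : ℕ × ℕ) : ℕ := if side q e.1 = 1 then e.1 else e.2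

/-- The leaf of an edge between the two sides. -/
def leaf (e : ℕ × ℕ) : ℕ := if side q e.1 = 1 then e.2 else e.1

/-- The number of edges of `h` with center `v`. The *phase* of `v` is this number divided by
`S`. -/
def centerCount : List (ℕ × ℕ) → ℕ → ℕ
  | [], _ => 0
  | e :: h, v => centerCount h v + if Cross q e ∧ center q e = v then 1 else 0

/-- The palette of an edge `e` that arrives after `h`: in its `j`-th phase a center `v` uses the
palette `j + q (v, 1)` modulo the number `Q` of palettes. -/
def palette (h : List (ℕ × ℕ)) (e : ℕ × ℕ) : ℕ :=
  (q (center q e, 1) + centerCount q h (center q e) / S) % Q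

/-- The number of edges of `h` with leaf `u` and palette `x`. -/
def leafCount : List (ℕ × ℕ) → ℕ → ℕ → ℕ
  | [], _, _ => 0
  | e :: h, u, x =>
      leafCount h u x + if Cross q e ∧ leaf q e = u ∧ palette S Q q h e = x then 1 else 0

/-- The color of `e` within its palette: the leaf runs through the colors of the palette cyclically
from a random start. -/
def slot (h : List (ℕ × ℕ)) (e : ℕ × ℕ) : ℕ :=
  (q (leaf q e, 2 + palette S Q q h e) + leafCount S Q q h (leaf q e) (palette S Q q h e)) % D

/-- One plus the last phase in which the slot `y` was chosen by an edge with center `v`, and `0` if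
there was none. -/
def mark : List (ℕ × ℕ) → ℕ → ℕ → ℕ
  | [], _, _ => 0
  | e :: h, v, y =>
      if Cross q e ∧ center q e = v ∧ slot D S Q q h e = y then centerCount q h v / S + 1
      else mark h v y

/-- The slot of `e` was already chosen in the current phase of the center of `e`. -/
def Taken (h : List (ℕ × ℕ)) (e : ℕ × ℕ) : Prop :=
  mark D S Q q h (center q e) (slot D S Q q h e) = centerCount q h (center q e) / S + 1

instance (h : List (ℕ × ℕ)) (e : ℕ × ℕ) : Decidable (Taken D S Q q h e) :=
  inferInstanceAs (Decidable (_ = _))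

/-- The edge `e`, arriving after `h`, is colored on this level. -/
def Succeeds (h : List (ℕ × ℕ)) (e : ℕ × ℕ) : Prop := Cross q e ∧ ¬ Taken D S Q q h e

instance (h : List (ℕ × ℕ)) (e : ℕ × ℕ) : Decidable (Succeeds D S Q q h e) :=
  inferInstanceAs (Decidable (_ ∧ _))

/-- The edges of `h` that are not colored on this level. -/
def leftover : List (ℕ × ℕ) → List (ℕ × ℕ)
  | [] => []
  | e :: h => if Succeeds D S Q q h e then leftover h else e :: leftover h

/-- The number of edges at `w` with both ends on the same side. -/
def sameCount : List (ℕ × ℕ) → ℕ → ℕ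
  | [], _ => 0
  | e :: h, w => sameCount h w + if (e.1 = w ∨ e.2 = w) ∧ ¬ Cross q e then 1 else 0

/-- The number of edges with center `v` that found their slot taken. -/
def centerFails : List (ℕ × ℕ) → ℕ → ℕ
  | [], _ => 0
  | e :: h, v =>
      centerFails h v + if Cross q e ∧ center q e = v ∧ Taken D S Q q h e then 1 else 0

/-- The number of edges with leaf `u` and palette `x` that found their slot taken. -/
def leafFails : List (ℕ × ℕ) → ℕ → ℕ → ℕ
  | [], _, _ => 0
  | e :: h, u, x => leafFails h u x +
      if Cross q e ∧ leaf q e = u ∧ palette S Q q h e = x ∧ Taken D S Q q h e then 1 else 0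

end Level

section LevelFacts

variable {n D S Q : ℕ} {q : ℕ × ℕ → ℕ} {h h₁ : List (ℕ × ℕ)} {e e' : ℕ × ℕ}

lemma SimpleHist.tail (hs : SimpleHist n (e :: h)) : SimpleHist n h :=
  ⟨(List.nodup_cons.1 hs.1).2, fun _ he => hs.2 _ (List.mem_cons_of_mem _ he)⟩

lemma SimpleHist.notMem (hs : SimpleHist n (e :: h)) : ∀ e' ∈ h, s(e'.1, e'.2) ≠ s(e.1, e.2) :=
  fun e' he' heq => (List.nodup_cons.1 hs.1).1 (List.mem_map.2 ⟨e', he', heq⟩)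

lemma SimpleHist.sublist (hs : SimpleHist n h) (hl : h₁.Sublist h) : SimpleHist n h₁ :=
  ⟨hs.1.sublist (hl.map _), fun e he => hs.2 e (hl.subset he)⟩

lemma hdeg_cons (e : ℕ × ℕ) (h : List (ℕ × ℕ)) (w : ℕ) :
    hdeg (e :: h) w = hdeg h w + if e.1 = w ∨ e.2 = w then 1 else 0 := by
  simp [hdeg, List.countP_cons]

lemma hdeg_mono (hl : h₁.Sublist h) (w : ℕ) : hdeg h₁ w ≤ hdeg h w := hl.countP_le

lemma leftover_sublist : (leftover D S Q q h).Sublist h := by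
  induction h with
  | nil => exact List.Sublist.slnil
  | cons e h ih =>
    unfold leftover
    split_ifs
    · exact ih.cons _
    · exact ih.cons_cons _

lemma leftover_suffix (hl : h₁ <:+ h) : leftover D S Q q h₁ <:+ leftover D S Q q h := by
  induction h with
  | nil => rw [List.suffix_nil.1 hl]
  | cons e h ih =>
    rcases List.suffix_cons_iff.1 hl with rfl | hl
    · exact List.suffix_refl _
    · conv_rhs => unfold leftover
      split_ifs
      · exact ih hl
      · exact (ih hl).trans (List.suffix_cons _ _)

lemma leftover_cons_suffix (hl : e :: h₁ <:+ h) (hf : ¬ Succeeds D S Q q h₁ e) :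
    e :: leftover D S Q q h₁ <:+ leftover D S Q q h := by
  have := leftover_suffix (D := D) (S := S) (Q := Q) (q := q) hl
  rwa [leftover, if_neg hf] at this

lemma side_lt (v : ℕ) : side q v < 2 := Nat.mod_lt _ two_pos

lemma center_leaf (e : ℕ × ℕ) :
    (center q e = e.1 ∧ leaf q e = e.2) ∨ (center q e = e.2 ∧ leaf q e = e.1) := by
  unfold center leaf; split_ifs <;> simp

lemma side_center (hc : Cross q e) : side q (center q e) = 1 := by
  have h1 := side_lt (q := q) e.1
  have h2 := side_lt (q := q) e.2
  unfold Cross at hc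
  unfold center
  split_ifs <;> omega

lemma side_leaf (hc : Cross q e) : side q (leaf q e) = 0 := by
  have h1 := side_lt (q := q) e.1
  have h2 := side_lt (q := q) e.2
  unfold Cross at hc
  unfold leaf
  split_ifs <;> omega

lemma eq_center_of_side (hc : Cross q e) {w : ℕ} (hw : e.1 = w ∨ e.2 = w) (h1 : side q w = 1) :
    center q e = w := by
  have := side_leaf hc
  rcases center_leaf (q := q) e with ⟨h2, h3⟩ | ⟨h2, h3⟩ <;> rcases hw with rfl | rfl <;>
    simp_all

lemma eq_leaf_of_side (hc : Cross q e) {w : ℕ} (hw : e.1 = w ∨ e.2 = w) (h1 : side q w ≠ 1) :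
    leaf q e = w := by
  have := side_center hc
  rcases center_leaf (q := q) e with ⟨h2, h3⟩ | ⟨h2, h3⟩ <;> rcases hw with rfl | rfl <;>
    simp_all

lemma center_mem (e : ℕ × ℕ) : e.1 = center q e ∨ e.2 = center q e := by
  rcases center_leaf (q := q) e with h | h <;> simp [h.1]

lemma leaf_mem (e : ℕ × ℕ) : e.1 = leaf q e ∨ e.2 = leaf q e := by
  rcases center_leaf (q := q) e with h | h <;> simp [h.2]

lemma centerCount_le_hdeg (v : ℕ) : centerCount q h v ≤ hdeg h v := by
  induction h with
  | nil => exact le_rfl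
  | cons e h ih =>
    rw [centerCount, hdeg_cons]
    refine Nat.add_le_add ih ?_
    split_ifs with h1 h2 <;> try omega
    exact absurd (h1.2 ▸ center_mem e) h2

lemma sum_leafCount_le (u : ℕ) : ∑ x ∈ Finset.range Q, leafCount S Q q h u x ≤ hdeg h u := by
  induction h with
  | nil => simp [leafCount]
  | cons e h ih =>
    simp only [leafCount, Finset.sum_add_distrib, hdeg_cons]
    refine Nat.add_le_add ih ?_
    split_ifs with h2
    · calc _ ≤ ∑ x ∈ Finset.range Q, if palette S Q q h e = x then 1 else 0 := by
            refine Finset.sum_le_sum fun x _ => ?_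
            split_ifs <;> omega
        _ ≤ 1 := by rw [Finset.sum_ite_eq]; split_ifs <;> omega
    · refine (Finset.sum_eq_zero fun x _ => if_neg ?_).le
      rintro ⟨-, rfl, -⟩
      exact h2 (leaf_mem e)

lemma centerCount_mono (hl : h₁ <:+ h) (v : ℕ) : centerCount q h₁ v ≤ centerCount q h v := by
  induction h with
  | nil => rw [List.suffix_nil.1 hl]
  | cons e h ih =>
    rcases List.suffix_cons_iff.1 hl with rfl | hl
    · exact le_rfl
    · exact (ih hl).trans (Nat.le_add_right _ _)

lemma leafCount_mono (hl : h₁ <:+ h) (u x : ℕ) :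
    leafCount S Q q h₁ u x ≤ leafCount S Q q h u x := by
  induction h with
  | nil => rw [List.suffix_nil.1 hl]
  | cons e h ih =>
    rcases List.suffix_cons_iff.1 hl with rfl | hl
    · exact le_rfl
    · exact (ih hl).trans (Nat.le_add_right _ _)

lemma mark_le (v y : ℕ) : mark D S Q q h v y ≤ centerCount q h v / S + 1 := by
  induction h with
  | nil => exact Nat.zero_le _
  | cons e h ih =>
    have h1 : centerCount q h v / S ≤ centerCount q (e :: h) v / S :=
      Nat.div_le_div_right (Nat.le_add_right _ _)
    rw [mark]
    split_ifs <;> omega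

lemma mark_mono (hl : h₁ <:+ h) (v y : ℕ) : mark D S Q q h₁ v y ≤ mark D S Q q h v y := by
  induction h with
  | nil => rw [List.suffix_nil.1 hl]
  | cons e h ih =>
    rcases List.suffix_cons_iff.1 hl with rfl | hl
    · exact le_rfl
    · rw [mark]
      split_ifs
      · exact (ih hl).trans (mark_le v y)
      · exact ih hl

/-- At most `S` slots of a center are taken in a phase. -/
lemma card_taken_le (v : ℕ) :
    ((Finset.range D).filter fun y => mark D S Q q h v y = centerCount q h v / S + 1).card ≤
      centerCount q h v % S := by
  induction h with
  | nil => simp [mark]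
  | cons e h ih =>
    by_cases hc : Cross q e ∧ center q e = v
    · have hcount : centerCount q (e :: h) v = centerCount q h v + 1 := by
        rw [centerCount, if_pos hc]
      rw [hcount]
      by_cases hdvd : (centerCount q h v + 1) % S = 0
      · -- a new phase begins, in which nothing is taken yet
        rw [hdvd]
        have hdiv : (centerCount q h v + 1) / S = centerCount q h v / S + 1 :=
          Nat.succ_div_of_mod_eq_zero hdvd
        rw [hdiv, Nat.le_zero, Finset.card_eq_zero, Finset.filter_eq_empty_iff]
        intro y _ hy
        have h1 := mark_le (D := D) (S := S) (Q := Q) (q := q) (h := h) v y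
        rw [mark] at hy
        split_ifs at hy <;> omega
      · have hdiv : (centerCount q h v + 1) / S = centerCount q h v / S :=
          Nat.succ_div_of_mod_ne_zero hdvd
        have hmod : (centerCount q h v + 1) % S = centerCount q h v % S + 1 := by
          have h1 := Nat.div_add_mod (centerCount q h v + 1) S
          have h2 := Nat.div_add_mod (centerCount q h v) S
          rw [hdiv] at h1
          omega
        rw [hdiv, hmod]
        refine le_trans (Finset.card_le_card (t := insert (slot D S Q q h e) ((Finset.range D).filter
          fun y => mark D S Q q h v y = centerCount q h v / S + 1)) ?_)
          ((Finset.card_insert_le _ _).trans (Nat.add_le_add_right ih 1))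
        intro y hy
        rw [Finset.mem_filter, mark] at hy
        rw [Finset.mem_insert, Finset.mem_filter]
        by_cases hy' : slot D S Q q h e = y
        · exact Or.inl hy'.symm
        · rw [if_neg (by tauto)] at hy
          exact Or.inr hy
    · have hcount : centerCount q (e :: h) v = centerCount q h v := by
        rw [centerCount, if_neg hc, add_zero]
      rw [hcount]
      convert ih using 4
      rw [mark, if_neg (by tauto)]

/-- The edges left over at `w` are of three kinds. -/
lemma hdeg_leftover_le (hQ : 0 < Q) (w : ℕ) : hdeg (leftover D S Q q h) w ≤
    sameCount q h w + centerFails D S Q q h w +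
      ∑ x ∈ Finset.range Q, leafFails D S Q q h w x := by
  induction h with
  | nil => simp [leftover, hdeg]
  | cons e h ih =>
    simp only [leftover, sameCount, centerFails, leafFails, Finset.sum_add_distrib]
    by_cases hok : Succeeds D S Q q h e
    · rw [if_pos hok]
      omega
    · rw [if_neg hok, hdeg_cons]
      by_cases hw : e.1 = w ∨ e.2 = w
      · rw [if_pos hw]
        by_cases hc : Cross q e
        · have ht : Taken D S Q q h e := by
            by_contra ht; exact hok ⟨hc, ht⟩
          by_cases h1 : side q w = 1
          · rw [if_pos (c := Cross q e ∧ _) ⟨hc, eq_center_of_side hc hw h1, ht⟩]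
            omega
          · have h2 := eq_leaf_of_side hc hw h1
            have h3 : 1 ≤ ∑ x ∈ Finset.range Q, if Cross q e ∧ leaf q e = w ∧
                palette S Q q h e = x ∧ Taken D S Q q h e then 1 else 0 := by
              have hm : palette S Q q h e ∈ Finset.range Q := Finset.mem_range.2 (Nat.mod_lt _ hQ)
              refine le_trans ?_ (Finset.single_le_sum (fun _ _ => Nat.zero_le _) hm)
              rw [if_pos ⟨hc, h2, rfl, ht⟩]
            omega
        · rw [if_pos (c := _ ∧ ¬ Cross q e) ⟨hw, hc⟩]
          omega
      · rw [if_neg hw]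
        omega

/-- On a level without overflow, two edges with a common endpoint that are colored on this level
receive different colors. -/
lemma color_ne_of_succeeds {d : ℕ} {H : List (ℕ × ℕ)}
    (hd : ∀ w, hdeg H w ≤ d) (hQ : d < Q * S) (hlc : ∀ u x, leafCount S Q q H u x ≤ D)
    (hs : e :: h <:+ H) (hs' : e' :: h₁ <:+ h) (hok : Succeeds D S Q q h e)
    (hok' : Succeeds D S Q q h₁ e') {w : ℕ} (hw : e.1 = w ∨ e.2 = w) (hw' : e'.1 = w ∨ e'.2 = w) :
    palette S Q q h e * D + slot D S Q q h e ≠ palette S Q q h₁ e' * D + slot D S Q q h₁ e' := by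
  intro heq
  have hsuf : h₁ <:+ h := (List.suffix_cons _ _).trans hs'
  have hD : 0 < D := by
    refine lt_of_lt_of_le ?_ (hlc (leaf q e) (palette S Q q h e))
    refine lt_of_lt_of_le ?_ (leafCount_mono hs _ _)
    rw [leafCount, if_pos ⟨hok.1, rfl, rfl⟩]; omega
  have hy : slot D S Q q h e < D := Nat.mod_lt _ hD
  have hy' : slot D S Q q h₁ e' < D := Nat.mod_lt _ hD
  have hx : palette S Q q h e = palette S Q q h₁ e' := by
    have h1 := congrArg (· / D) heq
    simp only [Nat.mul_add_div hD, mul_comm _ D, Nat.div_eq_of_lt hy, Nat.div_eq_of_lt hy',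
      add_zero] at h1
    exact h1
  rw [hx, Nat.add_left_cancel_iff] at heq
  by_cases h1 : side q w = 1
  · -- a common center: the edges belong to the same phase
    have hc := eq_center_of_side hok.1 hw h1
    have hc' := eq_center_of_side hok'.1 hw' h1
    have hphase : ∀ h₂, h₂ <:+ H → centerCount q h₂ w / S < Q := fun h₂ hh =>
      Nat.div_lt_of_lt_mul (by
        rw [mul_comm]
        exact ((centerCount_mono hh w).trans ((centerCount_le_hdeg w).trans (hd w))).trans_lt hQ)
    have hph : centerCount q h w / S = centerCount q h₁ w / S := by
      have h2 : (q (w, 1) + centerCount q h w / S) ≡ (q (w, 1) + centerCount q h₁ w / S) [MOD Q] := by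
        have := hx
        unfold palette at this
        rwa [hc, hc'] at this
      have h3 := Nat.ModEq.add_left_cancel' _ h2
      have hsH : h <:+ H := (List.suffix_cons _ _).trans hs
      exact Nat.ModEq.eq_of_lt_of_lt h3 (hphase _ hsH) (hphase _ (hsuf.trans hsH))
    refine hok.2 ?_
    unfold Taken
    rw [hc]
    refine le_antisymm (mark_le _ _) ?_
    refine le_trans ?_ (mark_mono hs' _ _)
    rw [mark, if_pos ⟨hok'.1, hc', heq.symm⟩, hph]
  · -- a common leaf: the positions of the edges within the palette differ
    have hl := eq_leaf_of_side hok.1 hw h1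
    have hl' := eq_leaf_of_side hok'.1 hw' h1
    set x := palette S Q q h₁ e' with hxdef
    have h2 : leafCount S Q q h₁ w x < leafCount S Q q h w x := by
      refine lt_of_lt_of_le ?_ (leafCount_mono hs' _ _)
      rw [leafCount, if_pos ⟨hok'.1, hl', rfl⟩]; omega
    have h3 : leafCount S Q q h w x < D := by
      refine lt_of_lt_of_le ?_ ((leafCount_mono hs w x).trans (hlc w x))
      rw [leafCount, if_pos ⟨hok.1, hl, hx⟩]; omega
    unfold slot at heq
    rw [hl, hl', hx, ← hxdef] at heq
    have h4 : _ ≡ _ [MOD D] := heq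
    exact h2.ne' (Nat.ModEq.eq_of_lt_of_lt (Nat.ModEq.add_left_cancel' _ h4) h3 (h2.trans h3))

end LevelFacts

/-! ### Dependence of a level on its random cells -/

section Dependence

variable {n D S Q : ℕ} {q q' : ℕ × ℕ → ℕ} {h h₁ : List (ℕ × ℕ)} {e e' : ℕ × ℕ}

lemma side_congr (hq : ∀ v, q' (v, 0) = q (v, 0)) (v : ℕ) : side q' v = side q v := by
  rw [side, hq, side]

lemma cross_congr (hq : ∀ v, q' (v, 0) = q (v, 0)) (e : ℕ × ℕ) : Cross q' e ↔ Cross q e := by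
  simp [Cross, side, hq]

lemma center_congr (hq : ∀ v, q' (v, 0) = q (v, 0)) (e : ℕ × ℕ) : center q' e = center q e := by
  simp only [center, side_congr hq]

lemma leaf_congr (hq : ∀ v, q' (v, 0) = q (v, 0)) (e : ℕ × ℕ) : leaf q' e = leaf q e := by
  simp only [leaf, side_congr hq]

lemma centerCount_congr (hq : ∀ v, q' (v, 0) = q (v, 0)) (h : List (ℕ × ℕ)) (v : ℕ) :
    centerCount q' h v = centerCount q h v := by
  induction h with
  | nil => rfl
  | cons e h ih => simp only [centerCount, ih, cross_congr hq, center_congr hq]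

lemma palette_congr (hq : ∀ v, q' (v, 0) = q (v, 0)) (e : ℕ × ℕ)
    (hq' : q' (center q e, 1) = q (center q e, 1)) (h : List (ℕ × ℕ)) :
    palette S Q q' h e = palette S Q q h e := by
  simp only [palette, center_congr hq, centerCount_congr hq, hq']

lemma leafCount_congr (hq : ∀ v, q' (v, 0) = q (v, 0)) (u x : ℕ) (h : List (ℕ × ℕ))
    (hq' : ∀ e ∈ h, Cross q e → leaf q e = u → q' (center q e, 1) = q (center q e, 1)) :
    leafCount S Q q' h u x = leafCount S Q q h u x := by
  induction h with
  | nil => rfl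
  | cons e h ih =>
    simp only [leafCount, cross_congr hq, leaf_congr hq]
    rw [ih fun e' he' => hq' e' (List.mem_cons_of_mem _ he')]
    congr 1
    refine if_congr ?_ rfl rfl
    constructor <;> rintro ⟨h1, h2, h3⟩ <;> refine ⟨h1, h2, ?_⟩
    · rw [← h3, palette_congr hq e (hq' e List.mem_cons_self h1 h2)]
    · rw [← h3, palette_congr hq e (hq' e List.mem_cons_self h1 h2)]

/-- The tables `q` and `q'` agree in the cells that determine the sides and the start palettes; then
they give every edge the same palette. -/
def SameLayout (q q' : ℕ × ℕ → ℕ) : Prop :=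
  (∀ v, q' (v, 0) = q (v, 0)) ∧ ∀ v, q' (v, 1) = q (v, 1)

lemma SameLayout.update (q : ℕ × ℕ → ℕ) (u z y : ℕ) :
    SameLayout q (Function.update q (u, 2 + z) y) :=
  ⟨fun v => Function.update_of_ne (by simp only [ne_eq, Prod.mk.injEq]; omega) _ _,
    fun v => Function.update_of_ne (by simp only [ne_eq, Prod.mk.injEq]; omega) _ _⟩

lemma SameLayout.palette (hq : SameLayout q q') (h : List (ℕ × ℕ)) (e : ℕ × ℕ) :
    palette S Q q' h e = palette S Q q h e := palette_congr hq.1 e (hq.2 _) h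

lemma SameLayout.leafCount (hq : SameLayout q q') (u x : ℕ) (h : List (ℕ × ℕ)) :
    leafCount S Q q' h u x = leafCount S Q q h u x :=
  leafCount_congr hq.1 u x h fun _ _ _ _ => hq.2 _

/-- The marks at a center `v` depend on the start cells of its neighbors only. -/
lemma mark_congr (hq : SameLayout q q') (v y : ℕ) (h : List (ℕ × ℕ))
    (hq' : ∀ e ∈ h, Cross q e → center q e = v → ∀ z, q' (leaf q e, 2 + z) = q (leaf q e, 2 + z)) :
    mark D S Q q' h v y = mark D S Q q h v y := by
  induction h with
  | nil => rfl
  | cons e h ih =>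
    simp only [mark, cross_congr hq.1, center_congr hq.1, centerCount_congr hq.1]
    rw [ih fun e' he' => hq' e' (List.mem_cons_of_mem _ he')]
    refine if_congr ?_ rfl rfl
    constructor <;> rintro ⟨h1, h2, h3⟩ <;> refine ⟨h1, h2, ?_⟩
    · rw [← h3]
      simp only [slot, hq.palette, hq.leafCount, leaf_congr hq.1,
        hq' e List.mem_cons_self h1 h2]
    · rw [← h3]
      simp only [slot, hq.palette, hq.leafCount, leaf_congr hq.1,
        hq' e List.mem_cons_self h1 h2]

lemma leaf_ne_of_edge_notMem {u v : ℕ} (hne : ∀ e ∈ h, s(e.1, e.2) ≠ s(u, v)) (he : e ∈ h)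
    (hc : center q e = v) : leaf q e ≠ u := by
  rintro rfl
  subst hc
  refine hne e he ?_
  rcases center_leaf (q := q) e with h | h <;> rw [h.1, h.2]
  exact Sym2.eq_swap

/-- The marks at `v` do not depend on the start cells of a vertex `u` that is not adjacent to `v`
so far. -/
lemma mark_update {u v : ℕ} (hne : ∀ e ∈ h, s(e.1, e.2) ≠ s(u, v)) (z a y : ℕ) :
    mark D S Q (Function.update q (u, 2 + z) a) h v y = mark D S Q q h v y :=
  mark_congr (SameLayout.update q u z a) v y h fun e he _ hc z' =>
    Function.update_of_ne (by
      intro h'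
      exact leaf_ne_of_edge_notMem hne he hc (Prod.ext_iff.1 h').1) _ _

lemma taken_congr {u v : ℕ} (hc : center q e = v) (hne : ∀ e ∈ h, s(e.1, e.2) ≠ s(u, v)) (z a : ℕ)
    (hz : leaf q e = u → palette S Q q h e ≠ z) :
    Taken D S Q (Function.update q (u, 2 + z) a) h e ↔ Taken D S Q q h e := by
  have hl := SameLayout.update q u z a
  have : Function.update q (u, 2 + z) a (leaf q e, 2 + palette S Q q h e) =
      q (leaf q e, 2 + palette S Q q h e) := by
    refine Function.update_of_ne (fun h' => ?_) _ _
    simp only [Prod.mk.injEq] at h'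
    exact hz h'.1 (by omega)
  unfold Taken
  rw [center_congr hl.1, hc, mark_update hne, centerCount_congr hl.1]
  simp only [slot, hl.palette, hl.leafCount, leaf_congr hl.1, this]

/-- A rotation of `{0, …, D - 1}` is injective. -/
lemma sum_rotate_le (P : ℕ → Prop) [DecidablePred P] (c : ℕ) :
    ∑ y ∈ Finset.range D, (if P ((y + c) % D) then 1 else 0) ≤
      ((Finset.range D).filter P).card := by
  rw [← Finset.sum_filter, Finset.sum_const, smul_eq_mul, mul_one]
  refine Finset.card_le_card_of_injOn (fun y => (y + c) % D) ?_ ?_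
  · intro y hy
    simp only [Finset.coe_filter, Finset.mem_range, Set.mem_ofPred_eq] at hy ⊢
    exact ⟨Nat.mod_lt _ (by omega), hy.2⟩
  · intro y hy y' hy' heq
    simp only [Finset.coe_filter, Finset.mem_range, Set.mem_ofPred_eq] at hy hy'
    have h1 : y + c ≡ y' + c [MOD D] := heq
    exact Nat.ModEq.eq_of_lt_of_lt (Nat.ModEq.add_right_cancel' _ h1) hy.1 hy'.1

/-- For at most `S` of the values of its start cell does an edge find its slot taken. -/
lemma sum_taken_le (hS : 0 < S) (hs : SimpleHist n (e :: h)) {u v z : ℕ}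
    (hc : center q e = v) (hl : leaf q e = u) (hz : palette S Q q h e = z) :
    ∑ y ∈ Finset.range D, (if Taken D S Q (Function.update q (u, 2 + z) y) h e then 1 else 0) ≤
      S := by
  have hne : ∀ e ∈ h, s(e.1, e.2) ≠ s(u, v) := by
    intro e' he'
    convert hs.notMem e' he' using 1
    subst hc hl
    rcases center_leaf (q := q) e with h | h <;> rw [h.1, h.2]
    exact Sym2.eq_swap
  refine le_trans ?_ ((card_taken_le (D := D) (Q := Q) (q := q) (h := h) v).trans
    (Nat.mod_lt _ hS).le)
  refine le_trans (Finset.sum_le_sum fun y _ => ?_) (sum_rotate_le _ (leafCount S Q q h u z))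
  have hlay := SameLayout.update q u z y
  have : Taken D S Q (Function.update q (u, 2 + z) y) h e ↔
      mark D S Q q h v ((y + leafCount S Q q h u z) % D) = centerCount q h v / S + 1 := by
    unfold Taken
    rw [center_congr hlay.1, hc, mark_update hne, centerCount_congr hlay.1]
    simp only [slot, hlay.palette, hlay.leafCount, leaf_congr hlay.1, hl, hz,
      Function.update_self]
  rw [if_congr this rfl rfl]

lemma centerFails_update {u v : ℕ} (hne : ∀ e ∈ h, s(e.1, e.2) ≠ s(u, v)) (z a : ℕ) :
    centerFails D S Q (Function.update q (u, 2 + z) a) h v = centerFails D S Q q h v := by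
  induction h with
  | nil => rfl
  | cons e h ih =>
    have hl := SameLayout.update q u z a
    simp only [centerFails, cross_congr hl.1, center_congr hl.1]
    rw [ih fun e' he' => hne e' (List.mem_cons_of_mem _ he')]
    congr 1
    refine if_congr ?_ rfl rfl
    refine and_congr_right fun _ => and_congr_right fun hc => ?_
    exact taken_congr hc (fun e' he' => hne e' (List.mem_cons_of_mem _ he')) z a
      fun h' => absurd h' (leaf_ne_of_edge_notMem hne List.mem_cons_self hc)

lemma SimpleHist.edge_notMem (hs : SimpleHist n (e :: h)) (q : ℕ × ℕ → ℕ) :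
    ∀ e' ∈ h, s(e'.1, e'.2) ≠ s(leaf q e, center q e) := by
  intro e' he'
  convert hs.notMem e' he' using 1
  rcases center_leaf (q := q) e with h | h <;> rw [h.1, h.2]
  exact Sym2.eq_swap

/-- Failures at a leaf in the palette `x` do not depend on the start cells of the leaf for other
palettes: the neighbors' marks were set by edges to other leaves. -/
lemma leafFails_update (hs : SimpleHist n h) {u x z : ℕ} (hx : x ≠ z) (a : ℕ) :
    leafFails D S Q (Function.update q (u, 2 + z) a) h u x = leafFails D S Q q h u x := by
  induction h with
  | nil => rfl
  | cons e h ih =>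
    have hl := SameLayout.update q u z a
    simp only [leafFails, cross_congr hl.1, leaf_congr hl.1, hl.palette]
    rw [ih hs.tail]
    congr 1
    refine if_congr ?_ rfl rfl
    refine and_congr_right fun _ => and_congr_right fun hu => and_congr_right fun hp => ?_
    subst hu
    exact taken_congr rfl (hs.edge_notMem q) z a fun _ => hp.trans_ne hx

lemma leafFails_le_leafCount (u x : ℕ) : leafFails D S Q q h u x ≤ leafCount S Q q h u x := by
  induction h with
  | nil => exact le_rfl
  | cons e h ih =>
    rw [leafFails, leafCount]
    refine Nat.add_le_add ih ?_
    split_ifs <;> first | omega | tauto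

/-- Averaged over the start cell of the leaf `u` for the palette `x`, at most the fraction `S / D` of
its edges in this palette find their slot taken. -/
lemma sum_leafFails_le (hS : 0 < S) (hs : SimpleHist n h) (u x : ℕ) :
    ∑ y ∈ Finset.range D, leafFails D S Q (Function.update q (u, 2 + x) y) h u x ≤
      leafCount S Q q h u x * S := by
  induction h with
  | nil => simp [leafFails]
  | cons e h ih =>
    simp only [leafFails, leafCount, Finset.sum_add_distrib, add_mul]
    refine Nat.add_le_add (ih hs.tail) ?_
    by_cases hc : Cross q e ∧ leaf q e = u ∧ palette S Q q h e = x
    · rw [if_pos hc, one_mul]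
      refine le_trans (Finset.sum_le_sum fun y _ => ?_) (sum_taken_le hS hs rfl hc.2.1 hc.2.2)
      split_ifs <;> first | omega | tauto
    · rw [if_neg hc, zero_mul]
      refine (Finset.sum_eq_zero fun y _ => if_neg ?_).le
      have hl := SameLayout.update q u x y
      rw [cross_congr hl.1, leaf_congr hl.1, hl.palette]
      tauto

lemma sameCount_update {v w : ℕ} (hvw : v ≠ w) (hne : ∀ e ∈ h, s(e.1, e.2) ≠ s(v, w)) (a : ℕ) :
    sameCount (Function.update q (v, 0) a) h w = sameCount q h w := by
  induction h with
  | nil => rfl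
  | cons e h ih =>
    simp only [sameCount]
    rw [ih fun e' he' => hne e' (List.mem_cons_of_mem _ he')]
    congr 1
    refine if_congr (and_congr_right fun hw => ?_) rfl rfl
    have h1 := hne e List.mem_cons_self
    have h2 : e.1 ≠ v ∧ e.2 ≠ v := by
      constructor <;> rintro rfl <;> rcases hw with rfl | rfl <;> simp_all
    simp [Cross, side, h2.1, h2.2]

lemma leafCount_update {u v : ℕ} (hne : ∀ e ∈ h, s(e.1, e.2) ≠ s(u, v)) (x a : ℕ) :
    leafCount S Q (Function.update q (v, 1) a) h u x = leafCount S Q q h u x := by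
  refine leafCount_congr (fun _ => Function.update_of_ne (by simp) _ _) u x h fun e he _ hl => ?_
  refine Function.update_of_ne (fun h' => ?_) _ _
  exact leaf_ne_of_edge_notMem hne he (Prod.ext_iff.1 h').1 hl

end Dependence

/-! ### Exponential moments on one level -/

section Moments

variable {n D S Q : ℕ} {h : List (ℕ × ℕ)} {e : ℕ × ℕ}

/-- The random cells of a level: `D` cells for each of the `n` vertices. -/
def cells (n D : ℕ) : List (ℕ × ℕ) := List.range n ×ˢ List.range D

lemma mem_cells {v z : ℕ} : (v, z) ∈ cells n D ↔ v < n ∧ z < D := by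
  simp [cells, List.mem_product]

/-- The other endpoint of an edge at `w`. -/
lemma SimpleHist.exists_other (hs : SimpleHist n (e :: h)) {w : ℕ} (hw : e.1 = w ∨ e.2 = w) :
    ∃ v, v < n ∧ v ≠ w ∧ (e = (w, v) ∨ e = (v, w)) ∧
      (∀ e' ∈ h, s(e'.1, e'.2) ≠ s(v, w)) ∧ ∀ e' ∈ h, s(e'.1, e'.2) ≠ s(w, v) := by
  obtain ⟨h1, h2, h3⟩ := hs.2 e List.mem_cons_self
  have h4 := hs.notMem
  rcases hw with rfl | rfl
  · exact ⟨e.2, h2, h3.symm, Or.inl rfl, fun e' he' heq => h4 e' he' (heq.trans Sym2.eq_swap), h4⟩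
  · exact ⟨e.1, h1, h3, Or.inr rfl, h4, fun e' he' heq => h4 e' he' (heq.trans Sym2.eq_swap)⟩

lemma sum_parity (k b : ℕ) (hb : b < 2) :
    ∑ y ∈ Finset.range (2 * k), (if y % 2 = b then (1 : ℝ) else 0) = k := by
  induction k with
  | zero => simp
  | succ k ih =>
    rw [mul_add, mul_one, Finset.sum_range_succ, Finset.sum_range_succ, ih]
    have h1 : 2 * k % 2 = 0 := by omega
    have h2 : (2 * k + 1) % 2 = 1 := by omega
    rw [h1, h2]
    interval_cases b <;> simp

/-- The moments of the number of edges at `w` within a side. Each edge at `w` is within a side with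
probability `1 / 2`, even given the other sides, since the side of its other endpoint is uniform, and
`(1 + exp 1) / 2 ≤ exp (7 / 10)`. -/
lemma avgs_exp_sameCount_le (hS : 0 < S) (hD : D = 64 * S) (hs : SimpleHist n h) (w : ℕ)
    (q : ℕ × ℕ → ℕ) :
    avgs D (cells n D) (fun q => Real.exp (sameCount q h w - 7 / 10 * hdeg h w)) q ≤ 1 := by
  have hD0 : 0 < D := by omega
  induction h with
  | nil => simpa [sameCount, hdeg] using (avgs_const hD0 _ _ _).le
  | cons e h ih =>
    refine le_trans ?_ (ih hs.tail)
    by_cases hw : e.1 = w ∨ e.2 = w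
    · obtain ⟨v, hv, hvw, hev, hne, -⟩ := hs.exists_other hw
      -- the side of the other endpoint `v` is redrawn
      have hsplit : (fun q => Real.exp (sameCount q (e :: h) w - 7 / 10 * hdeg (e :: h) w)) =
          fun q => Real.exp (sameCount q h w - 7 / 10 * hdeg h w) *
            Real.exp ((if ¬ Cross q e then 1 else 0) - 7 / 10) := by
        funext q
        rw [← Real.exp_add, sameCount, hdeg_cons, if_pos hw]
        simp only [hw, true_and]
        push_cast
        congr 1
        ring
      rw [hsplit]
      refine avgs_mul_le hD0 (fun _ => (v, 0)) (fun _ => mem_cells.2 ⟨hv, hD0⟩) (fun _ _ => rfl)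
        (fun q y => ?_) (fun q => (Real.exp_pos _).le) (fun q => ?_) q
      · rw [sameCount_update hvw hne]
      · have hcross : ∀ y, ¬ Cross (Function.update q (v, 0) y) e ↔ y % 2 = side q w := by
          intro y
          rcases hev with rfl | rfl <;> simp [Cross, side, hvw.symm, eq_comm]
        have hval : ∀ t : ℝ, (t = 0 ∨ t = 1) → Real.exp (t - 7 / 10) ≤ Real.exp (-(7 / 10)) *
            (1 + 2 * t) - (3 - Real.exp 1) * t * Real.exp (-(7 / 10)) := by
          rintro t (rfl | rfl)
          · simp
          · rw [sub_eq_add_neg, Real.exp_add]; nlinarith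
        have hD' : (0 : ℝ) < D := by positivity
        unfold avg
        rw [div_le_one hD']
        simp only [hcross]
        have hsum := sum_parity (32 * S) (side q w) (side_lt w)
        rw [← mul_assoc, show 2 * 32 * S = D by omega] at hsum
        calc ∑ y ∈ Finset.range D, Real.exp ((if y % 2 = side q w then 1 else 0) - 7 / 10)
            ≤ ∑ y ∈ Finset.range D, Real.exp (-(7 / 10)) *
                (1 + (Real.exp 1 - 1) * if y % 2 = side q w then (1 : ℝ) else 0) := by
              refine Finset.sum_le_sum fun y _ => ?_
              refine (hval _ (by split_ifs <;> simp)).trans_eq ?_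
              ring
          _ = Real.exp (-(7 / 10)) * (D + (Real.exp 1 - 1) * (32 * S : ℕ)) := by
              rw [← Finset.mul_sum, Finset.sum_add_distrib, ← Finset.mul_sum, hsum]; simp
          _ = Real.exp (-(7 / 10)) * (D * ((1 + Real.exp 1) / 2)) := by
              rw [hD]; push_cast; ring
          _ ≤ Real.exp (-(7 / 10)) * (D * Real.exp (7 / 10)) := by
              gcongr
              have h1 := Real.quadratic_le_exp_of_nonneg (show (0 : ℝ) ≤ 7 / 10 by norm_num)
              have h2 := Real.exp_one_lt_d9
              linarith
          _ = D := by rw [mul_left_comm, ← Real.exp_add]; simp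
    · refine avgs_mono _ (fun q => le_of_eq ?_) q
      rw [sameCount, hdeg_cons, if_neg hw, if_neg (by tauto)]
      simp

lemma sum_mod_le (c x : ℕ) :
    ∑ y ∈ Finset.range D, (if (y + c) % Q = x then 1 else 0) ≤ D / Q + 1 := by
  rw [← Finset.sum_filter, Finset.sum_const, smul_eq_mul, mul_one]
  conv_rhs => rw [← Finset.card_range (D / Q + 1)]
  refine Finset.card_le_card_of_injOn (fun y => y / Q) ?_ ?_
  · intro y hy
    simp only [Finset.coe_filter, Finset.mem_range, Set.mem_ofPred_eq, Finset.coe_range,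
      Set.mem_Iio] at hy ⊢
    exact Nat.lt_succ_of_le (Nat.div_le_div_right hy.1.le)
  · intro y hy y' hy' heq
    simp only [Finset.coe_filter, Finset.mem_range, Set.mem_ofPred_eq] at hy hy'
    have h1 : y + c ≡ y' + c [MOD Q] := hy.2.trans hy'.2.symm
    have h2 : y % Q = y' % Q := Nat.ModEq.add_right_cancel' _ h1
    have h3 : y / Q = y' / Q := heq
    rw [← Nat.div_add_mod y Q, ← Nat.div_add_mod y' Q, h2, h3]

/-- The moments of the number of edges of a leaf in a palette. Since the start palettes of the
centers are uniform, an edge at `u` gets the palette `x` with probability at most `2 / Q`. -/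
lemma avgs_exp_leafCount_le (hQ : 0 < Q) (hQD : 2 + Q ≤ D) (hs : SimpleHist n h) (u x : ℕ)
    (q : ℕ × ℕ → ℕ) :
    avgs D (cells n D) (fun q => Real.exp (leafCount S Q q h u x - 4 / Q * hdeg h u)) q ≤ 1 := by
  have hD0 : 0 < D := by omega
  induction h with
  | nil => simpa [leafCount, hdeg] using (avgs_const hD0 _ _ _).le
  | cons e h ih =>
    refine le_trans ?_ (ih hs.tail)
    by_cases hu : e.1 = u ∨ e.2 = u
    · obtain ⟨v, hv, hvu, hev, -, hne⟩ := hs.exists_other hu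
      -- the start palette of the other endpoint `v` is redrawn
      have hsplit : (fun q => Real.exp (leafCount S Q q (e :: h) u x - 4 / Q * hdeg (e :: h) u)) =
          fun q => Real.exp (leafCount S Q q h u x - 4 / Q * hdeg h u) *
            Real.exp ((if Cross q e ∧ leaf q e = u ∧ palette S Q q h e = x then 1 else 0) -
              2 * (2 / Q)) := by
        funext q
        rw [← Real.exp_add, leafCount, hdeg_cons, if_pos hu]
        push_cast
        congr 1
        ring
      rw [hsplit]
      refine avgs_mul_le hD0 (fun _ => (v, 1)) (fun _ => mem_cells.2 ⟨hv, by omega⟩)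
        (fun _ _ => rfl) (fun q y => ?_) (fun q => (Real.exp_pos _).le) (fun q => ?_) q
      · rw [leafCount_update hne]
      · refine avg_exp_le_one hD0 _ q (fun y => by split_ifs <;> norm_num)
          (fun y => by split_ifs <;> norm_num) ?_
        have hle : ∀ y, (if Cross (Function.update q (v, 1) y) e ∧
            leaf (Function.update q (v, 1) y) e = u ∧
            palette S Q (Function.update q (v, 1) y) h e = x then 1 else 0) ≤
            if (y + centerCount q h v / S) % Q = x then 1 else 0 := by
          intro y
          have h0 : ∀ v', Function.update q (v, 1) y (v', 0) = q (v', 0) :=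
            fun v' => Function.update_of_ne (by simp) _ _
          split_ifs with h1 h2 <;> try omega
          refine absurd ?_ h2
          obtain ⟨-, hl, hp⟩ := h1
          rw [leaf_congr h0] at hl
          have hc : center q e = v := by
            rcases center_leaf (q := q) e with h | h <;> rcases hev with rfl | rfl <;>
              simp_all
          rw [palette, center_congr h0, centerCount_congr h0, hc, Function.update_self] at hp
          exact hp
        have hsum := (Finset.sum_le_sum fun y _ => hle y).trans
          (sum_mod_le (D := D) (centerCount q h v / S) x)
        have hQ' : (0 : ℝ) < Q := by positivity
        have hsum' : (∑ y ∈ Finset.range D, (if Cross (Function.update q (v, 1) y) e ∧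
            leaf (Function.update q (v, 1) y) e = u ∧
            palette S Q (Function.update q (v, 1) y) h e = x then (1 : ℝ) else 0)) ≤
            ((D / Q : ℕ) : ℝ) + 1 := by exact_mod_cast hsum
        refine hsum'.trans ?_
        have h1 : ((D / Q : ℕ) : ℝ) ≤ D / Q := Nat.cast_div_le
        have h2 : (1 : ℝ) ≤ D / Q := by
          rw [le_div_iff₀ hQ', one_mul]; exact_mod_cast (by omega : Q ≤ D)
        calc ((D / Q : ℕ) : ℝ) + 1 ≤ D / Q + D / Q := add_le_add h1 h2
          _ = 2 / Q * D := by ring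
    · refine avgs_mono _ (fun q => le_of_eq ?_) q
      rw [leafCount, hdeg_cons, if_neg hu, if_neg]
      · simp
      · rintro ⟨-, rfl, -⟩
        exact hu (leaf_mem e)

/-- The moments of the number of edges at a center that find their slot taken. As at most `S` of the
`D = 64 * S` slots are taken in a phase, an edge fails with probability at most `1 / 64`. -/
lemma avgs_exp_centerFails_le (hS : 0 < S) (hD : D = 64 * S) (hQ : 0 < Q) (hQD : 2 + Q ≤ D)
    (hs : SimpleHist n h) (v : ℕ) (q : ℕ × ℕ → ℕ) :
    avgs D (cells n D)
      (fun q => Real.exp (centerFails D S Q q h v - 1 / 32 * hdeg h v)) q ≤ 1 := by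
  have hD0 : 0 < D := by omega
  induction h with
  | nil => simpa [centerFails, hdeg] using (avgs_const hD0 _ _ _).le
  | cons e h ih =>
    refine le_trans ?_ (ih hs.tail)
    by_cases hv : e.1 = v ∨ e.2 = v
    · obtain ⟨u, hu, huv, heu, hne, -⟩ := hs.exists_other hv
      -- the cell of the other endpoint `u` for the palette of `e` is redrawn
      have hsplit : (fun q => Real.exp (centerFails D S Q q (e :: h) v -
            1 / 32 * hdeg (e :: h) v)) =
          fun q => Real.exp (centerFails D S Q q h v - 1 / 32 * hdeg h v) *
            Real.exp ((if Cross q e ∧ center q e = v ∧ Taken D S Q q h e then 1 else 0) -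
              2 * (1 / 64)) := by
        funext q
        rw [← Real.exp_add, centerFails, hdeg_cons, if_pos hv]
        push_cast
        congr 1
        ring
      rw [hsplit]
      have hlay := fun q y => SameLayout.update q u (palette S Q q h e) y
      refine avgs_mul_le hD0 (fun q => (u, 2 + palette S Q q h e))
        (fun q => mem_cells.2 ⟨hu, ?_⟩) (fun q y => ?_) (fun q y => ?_)
        (fun q => (Real.exp_pos _).le) (fun q => ?_) q
      · have : palette S Q q h e < Q := Nat.mod_lt _ hQ
        omega
      · rw [(hlay q y).palette]
      · rw [centerFails_update hne]
      · refine avg_exp_le_one hD0 _ q (fun y => by split_ifs <;> norm_num)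
          (fun y => by split_ifs <;> norm_num) ?_
        by_cases hc : Cross q e ∧ center q e = v
        · have hl : leaf q e = u := by
            rcases center_leaf (q := q) e with h | h <;> rcases heu with rfl | rfl <;> simp_all
          have hsum := sum_taken_le (D := D) (Q := Q) hS hs hc.2 hl rfl
          refine le_trans (b := (S : ℝ)) ?_ (by rw [hD]; push_cast; linarith)
          refine le_trans ?_ (Nat.cast_le.2 hsum)
          push_cast
          refine Finset.sum_le_sum fun y _ => ?_
          split_ifs <;> first | (norm_num; done) | tauto
        · rw [Finset.sum_eq_zero fun y _ => if_neg ?_]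
          · positivity
          · rw [cross_congr (hlay q y).1, center_congr (hlay q y).1]
            tauto
    · refine avgs_mono _ (fun q => le_of_eq ?_) q
      rw [centerFails, hdeg_cons, if_neg hv, if_neg]
      · simp
      · rintro ⟨-, rfl, -⟩
        exact hv (center_mem e)

/-- The moments of the number of edges at a leaf that find their slot taken. The failures in different palettes
are governed by different random cells; their numbers are cut off if a palette overflows. -/
lemma avgs_exp_leafFails_le (hS : 0 < S) (hD0 : 0 < D) (hQD : 2 + Q ≤ D) (hs : SimpleHist n h)
    {u : ℕ} (hu : u < n) {m : ℕ} (hm : m ≤ Q) (q : ℕ × ℕ → ℕ) :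
    avgs D (cells n D) (fun q => Real.exp (∑ x ∈ Finset.range m,
      ((if leafCount S Q q h u x ≤ D then (leafFails D S Q q h u x : ℝ) / D else 0) -
        2 * (leafCount S Q q h u x * S / D ^ 2)))) q ≤ 1 := by
  induction m with
  | zero => simpa using (avgs_const hD0 _ _ _).le
  | succ m ih =>
    refine le_trans ?_ (ih (by omega))
    simp only [Finset.sum_range_succ _ m, Real.exp_add]
    have hlay := fun (q : ℕ × ℕ → ℕ) y => SameLayout.update q u m y
    refine avgs_mul_le hD0 (fun q => (u, 2 + m))
        (fun q => mem_cells.2 ⟨hu, by omega⟩) (fun q y => rfl) (fun q y => ?_)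
        (fun q => (Real.exp_pos _).le) (fun q => ?_) q
    · congr 1
      refine Finset.sum_congr rfl fun x hx => ?_
      rw [leafFails_update hs (Finset.mem_range.1 hx).ne]
      simp only [(hlay q y).leafCount]
    · have hcongr : avg D (u, 2 + m) (fun q => Real.exp ((if leafCount S Q q h u m ≤ D then
            (leafFails D S Q q h u m : ℝ) / D else 0) - 2 * (leafCount S Q q h u m * S / D ^ 2))) q =
          avg D (u, 2 + m) (fun q' => Real.exp ((if leafCount S Q q h u m ≤ D then
            (leafFails D S Q q' h u m : ℝ) / D else 0) -
              2 * (leafCount S Q q h u m * S / D ^ 2))) q := by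
        simp only [avg, (hlay q _).leafCount]
      rw [hcongr]
      have hD' : (0 : ℝ) < D := by positivity
      split_ifs with hle
      · refine avg_exp_le_one hD0 _ q (fun y => by positivity) (fun y => ?_) ?_
        · rw [div_le_one hD']
          have := leafFails_le_leafCount (D := D) (S := S) (Q := Q)
            (q := Function.update q (u, 2 + m) y) (h := h) u m
          rw [(hlay q y).leafCount] at this
          exact_mod_cast this.trans hle
        · rw [← Finset.sum_div, div_le_iff₀ hD']
          have := sum_leafFails_le (D := D) (Q := Q) (q := q) hS hs u m
          calc (∑ y ∈ Finset.range D,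
                (leafFails D S Q (Function.update q (u, 2 + m) y) h u m : ℝ))
              ≤ leafCount S Q q h u m * S := by exact_mod_cast this
            _ = leafCount S Q q h u m * S / D ^ 2 * D * D := by field_simp
      · refine avg_exp_le_one hD0 _ q (fun y => le_rfl) (fun y => zero_le_one) ?_
        simp only [Finset.sum_const_zero]
        positivity

/-- The favorable outcome of a level whose input has maximum degree at most `d`: no leaf uses up a
palette, and at most `7 / 8 * d` edges are left over at each vertex. -/
def LevelGood (D S Q : ℕ) (q : ℕ × ℕ → ℕ) (h : List (ℕ × ℕ)) (d : ℕ) : Prop :=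
  (∀ u x, leafCount S Q q h u x ≤ D) ∧ ∀ w, 8 * hdeg (leftover D S Q q h) w ≤ 7 * d

lemma hdeg_eq_zero (hs : SimpleHist n h) {w : ℕ} (hw : n ≤ w) : hdeg h w = 0 := by
  rw [hdeg, List.countP_eq_zero]
  intro e he
  have := hs.2 e he
  simp only [decide_eq_true_eq]
  omega

lemma leafCount_eq_zero (hs : SimpleHist n h) (hQ : 0 < Q) {q : ℕ × ℕ → ℕ} {u x : ℕ}
    (hux : n ≤ u ∨ Q ≤ x) : leafCount S Q q h u x = 0 := by
  induction h with
  | nil => rfl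
  | cons e h ih =>
    rw [leafCount, ih hs.tail, if_neg]
    rintro ⟨-, rfl, rfl⟩
    have h1 : palette S Q q h e < Q := Nat.mod_lt _ hQ
    have h2 := hs.2 e List.mem_cons_self
    rcases leaf_mem (q := q) e with h | h <;> omega

open Classical in
/-- A level has the favorable outcome with high probability. -/
theorem avgs_not_levelGood_le {d : ℕ} {t : ℝ} (hS : 0 < S) (hD : D = 64 * S) (hQ : 0 < Q)
    (hQD : 2 + Q ≤ D) (hdQ : d ≤ Q * S) (hs : SimpleHist n h) (hd : ∀ w, hdeg h w ≤ d)
    (htS : t ≤ S) (htd : 2048 * S * t ≤ d) (q : ℕ × ℕ → ℕ) :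
    avgs D (cells n D) (fun q => if ¬ LevelGood D S Q q h d then (1 : ℝ) else 0) q ≤
      (n * Q + 3 * n) * Real.exp (-t) := by
  have hD0 : 0 < D := by omega
  have hS' : (1 : ℝ) ≤ S := by exact_mod_cast hS
  have hd' : ∀ w, (hdeg h w : ℝ) ≤ d := fun w => by exact_mod_cast hd w
  have hQ' : (0 : ℝ) < Q := by positivity
  -- `t` may be negative, in which case the bounds below still hold
  have htd' : 32 * t ≤ d := by
    rcases le_or_gt 0 t with ht | ht
    · nlinarith
    · have : (0 : ℝ) ≤ d := by positivity
      linarith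
  have hover : ∀ u x, avgs D (cells n D)
      (fun q => if D < leafCount S Q q h u x then (1 : ℝ) else 0) q ≤ Real.exp (-t) := by
    intro u x
    refine avgs_indicator_le (fun q hq => ?_) q (avgs_exp_leafCount_le (S := S) hQ hQD hs u x q)
    have h1 : (D : ℝ) ≤ leafCount S Q q h u x := by exact_mod_cast hq.le
    have h2 : 4 / (Q : ℝ) * hdeg h u ≤ 4 * S := by
      rw [div_mul_eq_mul_div, div_le_iff₀ hQ']
      have : (d : ℝ) ≤ Q * S := by exact_mod_cast hdQ
      nlinarith [hd' u]
    rw [hD] at h1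
    push_cast at h1
    linarith
  have hsame : ∀ w, avgs D (cells n D)
      (fun q => if 3 * d < 4 * sameCount q h w then (1 : ℝ) else 0) q ≤ Real.exp (-t) := by
    intro w
    refine avgs_indicator_le (fun q hq => ?_) q (avgs_exp_sameCount_le hS hD hs w q)
    have h1 : (3 * d : ℝ) ≤ 4 * sameCount q h w := by exact_mod_cast hq.le
    linarith [hd' w]
  have hcenter : ∀ w, avgs D (cells n D)
      (fun q => if d < 16 * centerFails D S Q q h w then (1 : ℝ) else 0) q ≤ Real.exp (-t) := by
    intro w
    refine avgs_indicator_le (fun q hq => ?_) q (avgs_exp_centerFails_le hS hD hQ hQD hs w q)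
    have h1 : (d : ℝ) ≤ 16 * centerFails D S Q q h w := by exact_mod_cast hq.le
    linarith [hd' w]
  have hleaf : ∀ w, w < n → avgs D (cells n D)
      (fun q => if (∀ x, leafCount S Q q h w x ≤ D) ∧
        d < 16 * ∑ x ∈ Finset.range Q, leafFails D S Q q h w x then (1 : ℝ) else 0) q ≤
      Real.exp (-t) := by
    intro w hw
    refine avgs_indicator_le (fun q hq => ?_) q (avgs_exp_leafFails_le hS hD0 hQD hs hw le_rfl q)
    simp only [hq.1, if_true]
    rw [Finset.sum_sub_distrib, ← Finset.sum_div, ← Finset.mul_sum, ← Finset.sum_div,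
      ← Finset.sum_mul]
    have h1 : (d : ℝ) ≤ 16 * ∑ x ∈ Finset.range Q, (leafFails D S Q q h w x : ℝ) := by
      exact_mod_cast hq.2.le
    have h2 : ∑ x ∈ Finset.range Q, (leafCount S Q q h w x : ℝ) ≤ d := by
      exact_mod_cast (sum_leafCount_le w).trans (hd w)
    set A := ∑ x ∈ Finset.range Q, (leafFails D S Q q h w x : ℝ)
    set B := ∑ x ∈ Finset.range Q, (leafCount S Q q h w x : ℝ)
    have hSpos : (0 : ℝ) < S := by positivity
    have hDS : (D : ℝ) = 64 * S := by rw [hD]; push_cast; ring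
    rw [hDS]
    have h3 : (d : ℝ) / 16 / (64 * S) ≤ A / (64 * S) := by
      gcongr; linarith
    have h4 : B * S / (64 * S) ^ 2 ≤ d * S / (64 * S) ^ 2 := by gcongr
    have h5 : t ≤ d / (2048 * S) := by
      rw [le_div_iff₀ (by positivity)]; linarith
    have h6 : (d : ℝ) / 16 / (64 * S) - 2 * (d * S / (64 * S) ^ 2) = d / (2048 * S) := by
      field_simp; ring
    linarith
  have hbad : ∀ q, (if ¬ LevelGood D S Q q h d then (1 : ℝ) else 0) ≤
      (∑ p ∈ Finset.range n ×ˢ Finset.range Q,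
        if D < leafCount S Q q h p.1 p.2 then (1 : ℝ) else 0) +
      ∑ w ∈ Finset.range n, ((if 3 * d < 4 * sameCount q h w then (1 : ℝ) else 0) +
        (if d < 16 * centerFails D S Q q h w then (1 : ℝ) else 0) +
        (if (∀ x, leafCount S Q q h w x ≤ D) ∧
        d < 16 * ∑ x ∈ Finset.range Q, leafFails D S Q q h w x then (1 : ℝ) else 0)) := by
    intro q
    have hp1 : ∀ p ∈ Finset.range n ×ˢ Finset.range Q,
        (0 : ℝ) ≤ if D < leafCount S Q q h p.1 p.2 then (1 : ℝ) else 0 :=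
      fun p _ => by split_ifs <;> norm_num
    have hp2 : ∀ w ∈ Finset.range n,
        (0 : ℝ) ≤ (if 3 * d < 4 * sameCount q h w then (1 : ℝ) else 0) +
        (if d < 16 * centerFails D S Q q h w then (1 : ℝ) else 0) +
        (if (∀ x, leafCount S Q q h w x ≤ D) ∧
        d < 16 * ∑ x ∈ Finset.range Q, leafFails D S Q q h w x then (1 : ℝ) else 0) :=
      fun p _ => by split_ifs <;> norm_num
    split_ifs with hg
    · exact add_nonneg (Finset.sum_nonneg hp1) (Finset.sum_nonneg hp2)
    by_cases hlc : ∃ u x, D < leafCount S Q q h u x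
    · obtain ⟨u, x, hux⟩ := hlc
      have hmem : (u, x) ∈ Finset.range n ×ˢ Finset.range Q := by
        rw [Finset.mem_product, Finset.mem_range, Finset.mem_range]
        by_contra hcon
        rw [leafCount_eq_zero hs hQ (by dsimp only at hcon; omega)] at hux
        omega
      refine le_add_of_le_of_nonneg ?_ (Finset.sum_nonneg hp2)
      refine le_trans ?_ (Finset.single_le_sum hp1 hmem)
      rw [if_pos hux]
    · push Not at hlc
      have : ∃ w, 7 * d < 8 * hdeg (leftover D S Q q h) w := by
        by_contra hcon
        push Not at hcon
        exact hg ⟨hlc, hcon⟩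
      obtain ⟨w, hw⟩ := this
      have hwn : w < n := by
        by_contra hcon
        have := hdeg_eq_zero (hs.sublist (leftover_sublist (D := D) (S := S) (Q := Q) (q := q)))
          (not_lt.1 hcon)
        omega
      refine le_add_of_nonneg_of_le (Finset.sum_nonneg hp1) ?_
      refine le_trans ?_ (Finset.single_le_sum hp2 (Finset.mem_range.2 hwn))
      have h3 := hdeg_leftover_le (D := D) (S := S) (q := q) (h := h) hQ w
      have h4 : 3 * d < 4 * sameCount q h w ∨ d < 16 * centerFails D S Q q h w ∨
          d < 16 * ∑ x ∈ Finset.range Q, leafFails D S Q q h w x := by omega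
      rcases h4 with h4 | h4 | h4
      · rw [if_pos h4]; split_ifs <;> norm_num
      · rw [if_pos h4]; split_ifs <;> norm_num
      · rw [if_pos (c := _ ∧ _) ⟨hlc w, h4⟩]; split_ifs <;> norm_num
  refine (avgs_mono _ hbad q).trans ?_
  rw [avgs_add, avgs_finset_sum _ _ _ hD0, avgs_finset_sum _ _ _ hD0]
  have hA := Finset.sum_le_card_nsmul (Finset.range n ×ˢ Finset.range Q) _ _
    fun p _ => hover p.1 p.2
  have hB := Finset.sum_le_card_nsmul (Finset.range n) (fun w => avgs D (cells n D) (fun q =>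
    (if 3 * d < 4 * sameCount q h w then (1 : ℝ) else 0) +
        (if d < 16 * centerFails D S Q q h w then (1 : ℝ) else 0) +
        (if (∀ x, leafCount S Q q h w x ≤ D) ∧
        d < 16 * ∑ x ∈ Finset.range Q, leafFails D S Q q h w x then (1 : ℝ) else 0)) q)
    (3 * Real.exp (-t)) fun w hw => by
      rw [avgs_add, avgs_add]
      linarith [hsame w, hcenter w, hleaf w (Finset.mem_range.1 hw)]
  rw [Finset.card_product, Finset.card_range, Finset.card_range, nsmul_eq_mul] at hA
  rw [Finset.card_range, nsmul_eq_mul] at hB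
  refine (add_le_add hA hB).trans_eq ?_
  push_cast
  ring

end Moments

/-! ### The cascade of levels -/

section Cascade

variable (D S Δ : ℕ) (s : ℕ × ℕ × ℕ → ℕ)

/-- The bound on the maximum degree of the input of level `ℓ`: every level reduces it by the factor
`7 / 8`. -/
def levelDeg : ℕ → ℕ
  | 0 => Δ
  | ℓ + 1 => levelDeg ℓ * 7 / 8

/-- The number of palettes of level `ℓ`. -/
def palettes (ℓ : ℕ) : ℕ := levelDeg Δ ℓ / S + 1

/-- The first color of level `ℓ`. -/
def base : ℕ → ℕ
  | 0 => 0
  | ℓ + 1 => base ℓ + palettes S Δ ℓ * D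

/-- The edges of `h` that reach level `ℓ`: those that no lower level colors. -/
def hist : ℕ → List (ℕ × ℕ) → List (ℕ × ℕ)
  | 0, h => h
  | ℓ + 1, h => leftover D S (palettes S Δ ℓ) (fun p => s (ℓ, p)) (hist ℓ h)

/-- All levels below `L` have the favorable outcome. -/
def AllGood (L : ℕ) (h : List (ℕ × ℕ)) : Prop :=
  ∀ ℓ < L, LevelGood D S (palettes S Δ ℓ) (fun p => s (ℓ, p)) (hist D S Δ s ℓ h) (levelDeg Δ ℓ)

end Cascade

section CascadeFacts

variable {n D S Δ L : ℕ} {s s' : ℕ × ℕ × ℕ → ℕ} {h H : List (ℕ × ℕ)} {e : ℕ × ℕ}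

lemma hist_sublist (ℓ : ℕ) : (hist D S Δ s ℓ h).Sublist h := by
  induction ℓ with
  | zero => exact List.Sublist.refl _
  | succ ℓ ih => exact leftover_sublist.trans ih

lemma hist_suffix (hl : h <:+ H) (ℓ : ℕ) : hist D S Δ s ℓ h <:+ hist D S Δ s ℓ H := by
  induction ℓ with
  | zero => exact hl
  | succ ℓ ih => exact leftover_suffix ih

lemma hist_congr {ℓ : ℕ} (hs : ∀ j < ℓ, ∀ p, s' (j, p) = s (j, p)) (h : List (ℕ × ℕ)) :
    hist D S Δ s' ℓ h = hist D S Δ s ℓ h := by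
  induction ℓ with
  | zero => rfl
  | succ ℓ ih =>
    simp only [hist, hs ℓ (Nat.lt_succ_self ℓ)]
    rw [ih fun j hj => hs j (hj.trans (Nat.lt_succ_self ℓ))]

lemma hdeg_hist_le (hd : ∀ w, hdeg h w ≤ Δ) {ℓ : ℕ} (hg : AllGood D S Δ s ℓ h) (w : ℕ) :
    hdeg (hist D S Δ s ℓ h) w ≤ levelDeg Δ ℓ := by
  cases ℓ with
  | zero => exact hd w
  | succ ℓ =>
    have := (hg ℓ (Nat.lt_succ_self ℓ)).2 w
    rw [hist, levelDeg]
    omega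

lemma palettes_pos (ℓ : ℕ) : 0 < palettes S Δ ℓ := Nat.succ_pos _

lemma levelDeg_lt (hS : 0 < S) (ℓ : ℕ) : levelDeg Δ ℓ < palettes S Δ ℓ * S := by
  rw [palettes, mul_comm]
  exact Nat.lt_mul_div_succ _ hS

lemma levelDeg_le (ℓ : ℕ) : levelDeg Δ ℓ ≤ Δ := by
  induction ℓ with
  | zero => exact le_rfl
  | succ ℓ ih => rw [levelDeg]; omega

open Classical in
/-- The probability that level `ℓ` has an input of small maximum degree but an unfavorable outcome.
Its input is determined by the random cells of the lower levels, so the bound for a single level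
applies conditionally on all cells of the other levels. -/
lemma avgs_level_bad_le (hS : 0 < S) (hD : D = 64 * S) {l : List (ℕ × ℕ × ℕ)}
    {ℓ : ℕ} (hmem : ∀ v < n, ∀ z < D, (ℓ, v, z) ∈ l) (hQD : 2 + palettes S Δ ℓ ≤ D)
    (hs : SimpleHist n H) {t : ℝ} (htS : t ≤ S) (htd : 2048 * S * t ≤ levelDeg Δ ℓ)
    (s : ℕ × ℕ × ℕ → ℕ) :
    avgs D l (fun s => if (∀ w, hdeg (hist D S Δ s ℓ H) w ≤ levelDeg Δ ℓ) ∧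
      ¬ LevelGood D S (palettes S Δ ℓ) (fun p => s (ℓ, p)) (hist D S Δ s ℓ H) (levelDeg Δ ℓ)
      then (1 : ℝ) else 0) s ≤ (n * palettes S Δ ℓ + 3 * n) * Real.exp (-t) := by
  have hD0 : 0 < D := by omega
  have hsub : (cells n D).map (Prod.mk ℓ) ⊆ l := by
    intro k hk
    obtain ⟨⟨v, z⟩, hp, rfl⟩ := List.mem_map.1 hk
    rw [mem_cells] at hp
    exact hmem v hp.1 z hp.2
  have hnd : ((cells n D).map (Prod.mk ℓ)).Nodup :=
    (List.Nodup.product List.nodup_range List.nodup_range).map (Prod.mk_right_injective ℓ)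
  obtain ⟨l₁, hl₁, hl₁'⟩ := List.subperm_of_subset hnd hsub
  obtain ⟨l', hl'⟩ := hl₁'.exists_perm_append
  rw [avgs_perm ((hl'.trans (hl₁.append_right l')).trans List.perm_append_comm), avgs_append]
  -- conditionally on the other levels, the input of level `ℓ` is fixed
  refine avgs_le_of_le hD0 l' (fun s₀ => ?_) s
  have hfix : ∀ s', (∀ k, k ∉ (cells n D).map (Prod.mk ℓ) → s' k = s₀ k) →
      hist D S Δ s' ℓ H = hist D S Δ s₀ ℓ H := by
    intro s' hs'
    refine hist_congr (fun j hj p => hs' _ fun hk => ?_) H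
    obtain ⟨p', -, hp'⟩ := List.mem_map.1 hk
    exact hj.ne' (Prod.ext_iff.1 hp').1
  by_cases hdeg : ∀ w, hdeg (hist D S Δ s₀ ℓ H) w ≤ levelDeg Δ ℓ
  · rw [avgs_congr (G := fun s' => if ¬ LevelGood D S (palettes S Δ ℓ) (fun p => s' (ℓ, p))
      (hist D S Δ s₀ ℓ H) (levelDeg Δ ℓ) then (1 : ℝ) else 0)]
    · exact (avgs_map_prod (F := fun q => if ¬ LevelGood D S (palettes S Δ ℓ) q
        (hist D S Δ s₀ ℓ H) (levelDeg Δ ℓ) then (1 : ℝ) else 0) ℓ _ s₀).trans_le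
        (avgs_not_levelGood_le hS hD (palettes_pos ℓ) hQD (levelDeg_lt hS ℓ).le
          (hs.sublist (hist_sublist ℓ)) hdeg htS htd _)
    · intro s' hs'
      rw [hfix s' hs']
      simp only [hdeg, implies_true, true_and]
  · rw [avgs_congr (G := fun _ => 0), avgs_const hD0]
    · positivity
    · intro s' hs'
      rw [hfix s' hs', if_neg (by tauto)]

open Classical in
/-- With high probability all levels have the favorable outcome. -/
theorem le_avgs_allGood (hS : 0 < S) (hD : D = 64 * S) {l : List (ℕ × ℕ × ℕ)}
    (hmem : ∀ ℓ < L, ∀ v < n, ∀ z < D, (ℓ, v, z) ∈ l)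
    (hQD : ∀ ℓ < L, 2 + palettes S Δ ℓ ≤ D) (hs : SimpleHist n H) (hd : ∀ w, hdeg H w ≤ Δ)
    {t : ℝ} (htS : t ≤ S) (htd : ∀ ℓ < L, 2048 * S * t ≤ levelDeg Δ ℓ) (s : ℕ × ℕ × ℕ → ℕ) :
    1 - ∑ ℓ ∈ Finset.range L, (n * palettes S Δ ℓ + 3 * n) * Real.exp (-t) ≤
      avgs D l (fun s => if AllGood D S Δ s L H then (1 : ℝ) else 0) s := by
  have hD0 : 0 < D := by omega
  set bad : ℕ → (ℕ × ℕ × ℕ → ℕ) → ℝ := fun ℓ s =>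
    if (∀ w, hdeg (hist D S Δ s ℓ H) w ≤ levelDeg Δ ℓ) ∧
      ¬ LevelGood D S (palettes S Δ ℓ) (fun p => s (ℓ, p)) (hist D S Δ s ℓ H) (levelDeg Δ ℓ)
      then (1 : ℝ) else 0 with hbad
  have hle : ∀ s, 1 - ∑ ℓ ∈ Finset.range L, bad ℓ s ≤
      if AllGood D S Δ s L H then (1 : ℝ) else 0 := by
    intro s
    have hnonneg : ∀ ℓ ∈ Finset.range L, 0 ≤ bad ℓ s := fun ℓ _ => by
      simp only [hbad]; split_ifs <;> norm_num
    split_ifs with hg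
    · linarith [Finset.sum_nonneg hnonneg]
    · -- consider the lowest level with an unfavorable outcome
      have hex : ∃ ℓ, ℓ < L ∧ ¬ LevelGood D S (palettes S Δ ℓ) (fun p => s (ℓ, p))
          (hist D S Δ s ℓ H) (levelDeg Δ ℓ) := by
        by_contra hcon
        push Not at hcon
        exact hg hcon
      have hfind := Nat.find_spec hex
      set ℓ := Nat.find hex
      have hgood : AllGood D S Δ s ℓ H := by
        intro j hj
        by_contra hcon
        exact Nat.find_min hex hj ⟨hj.trans hfind.1, hcon⟩
      have h1 : bad ℓ s = 1 := if_pos ⟨hdeg_hist_le hd hgood, hfind.2⟩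
      have := Finset.single_le_sum hnonneg (Finset.mem_range.2 hfind.1)
      linarith
  refine le_trans ?_ (avgs_mono l hle s)
  rw [avgs_sub, avgs_const hD0, avgs_finset_sum _ _ _ hD0]
  gcongr with ℓ hℓ
  rw [Finset.mem_range] at hℓ
  exact avgs_level_bad_le hS hD (hmem ℓ hℓ) (hQD ℓ hℓ) hs htS (htd ℓ hℓ) s

/-! ### The coloring -/

/-- `greedyUsed h v c = 1` if the edges of `h`, colored greedily in the order of their arrival, use
the color `c` at the vertex `v`, and `0` otherwise. -/
noncomputable def greedyUsed : List (ℕ × ℕ) → ℕ → ℕ → ℕ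
  | [], _, _ => 0
  | e :: h, v, c =>
      if (v = e.1 ∨ v = e.2) ∧ c = sInf {c | greedyUsed h e.1 c = 0 ∧ greedyUsed h e.2 c = 0}
      then 1 else greedyUsed h v c

/-- The greedy color of an edge `e` that arrives after `h`. -/
noncomputable def greedyColor (h : List (ℕ × ℕ)) (e : ℕ × ℕ) : ℕ :=
  sInf {c | greedyUsed h e.1 c = 0 ∧ greedyUsed h e.2 c = 0}

lemma greedyUsed_cons (h : List (ℕ × ℕ)) (e : ℕ × ℕ) (v c : ℕ) : greedyUsed (e :: h) v c =
    if (v = e.1 ∨ v = e.2) ∧ c = greedyColor h e then 1 else greedyUsed h v c := rfl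

lemma greedyUsed_le_one (h : List (ℕ × ℕ)) (v c : ℕ) : greedyUsed h v c ≤ 1 := by
  induction h with
  | nil => exact zero_le_one
  | cons e h ih => rw [greedyUsed_cons]; split_ifs <;> omega

lemma card_greedyUsed_le (h : List (ℕ × ℕ)) (v m : ℕ) :
    ((Finset.range m).filter fun c => greedyUsed h v c ≠ 0).card ≤ hdeg h v := by
  induction h with
  | nil => simp [greedyUsed]
  | cons e h ih =>
    rw [hdeg_cons]
    split_ifs with hv
    · refine le_trans (Finset.card_le_card (t := insert (greedyColor h e)
        ((Finset.range m).filter fun c => greedyUsed h v c ≠ 0)) fun c hc => ?_)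
        ((Finset.card_insert_le _ _).trans (Nat.add_le_add_right ih 1))
      rw [Finset.mem_filter, greedyUsed_cons] at hc
      rw [Finset.mem_insert, Finset.mem_filter]
      by_cases h' : c = greedyColor h e
      · exact Or.inl h'
      · rw [if_neg (by tauto)] at hc
        exact Or.inr hc
    · rw [add_zero]
      convert ih using 4 with c
      rw [greedyUsed_cons, if_neg (by tauto)]

lemma exists_greedy_free {d : ℕ} (hd : ∀ w, hdeg (e :: h) w ≤ d) :
    ∃ c < 2 * d, greedyUsed h e.1 c = 0 ∧ greedyUsed h e.2 c = 0 := by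
  by_contra hcon
  push Not at hcon
  have h1 : (Finset.range (2 * d)) ⊆
      ((Finset.range (2 * d)).filter fun c => greedyUsed h e.1 c ≠ 0) ∪
      ((Finset.range (2 * d)).filter fun c => greedyUsed h e.2 c ≠ 0) := by
    intro c hc
    have := hcon c (Finset.mem_range.1 hc)
    simp only [Finset.mem_union, Finset.mem_filter, hc, true_and]
    tauto
  have h2 := (Finset.card_le_card h1).trans (Finset.card_union_le _ _)
  rw [Finset.card_range] at h2
  have h3 := card_greedyUsed_le h e.1 (2 * d)
  have h4 := card_greedyUsed_le h e.2 (2 * d)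
  have h5 := hd e.1
  have h6 := hd e.2
  rw [hdeg_cons, if_pos (Or.inl rfl)] at h5
  rw [hdeg_cons, if_pos (Or.inr rfl)] at h6
  omega

lemma greedyColor_lt {d : ℕ} (hd : ∀ w, hdeg (e :: h) w ≤ d) : greedyColor h e < 2 * d := by
  obtain ⟨c, hc, hc'⟩ := exists_greedy_free hd
  exact (Nat.sInf_le hc').trans_lt hc

lemma greedyColor_spec {d : ℕ} (hd : ∀ w, hdeg (e :: h) w ≤ d) :
    greedyUsed h e.1 (greedyColor h e) = 0 ∧ greedyUsed h e.2 (greedyColor h e) = 0 := by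
  obtain ⟨c, -, hc'⟩ := exists_greedy_free hd
  exact Nat.sInf_mem (s := {c | greedyUsed h e.1 c = 0 ∧ greedyUsed h e.2 c = 0}) ⟨c, hc'⟩

lemma greedyUsed_of_suffix {e' : ℕ × ℕ} {h₁ : List (ℕ × ℕ)} (hl : e' :: h₁ <:+ h) {w : ℕ}
    (hw : e'.1 = w ∨ e'.2 = w) : greedyUsed h w (greedyColor h₁ e') = 1 := by
  induction h with
  | nil => simp at hl
  | cons e h ih =>
    rw [greedyUsed_cons]
    rcases List.suffix_cons_iff.1 hl with heq | hl
    · obtain ⟨rfl, rfl⟩ := List.cons_eq_cons.1 heq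
      rw [if_pos ⟨by tauto, rfl⟩]
    · rw [ih hl, ite_self]

section Color

variable (D S Δ : ℕ) (s : ℕ × ℕ × ℕ → ℕ)

/-- The color of an edge `e` that reaches level `ℓ` after the edges `h`, if `k` more levels follow:
that of the first level which colors `e`, and a greedy color if there is none. -/
noncomputable def colorFrom : ℕ → ℕ → List (ℕ × ℕ) → ℕ × ℕ → ℕ
  | 0, ℓ, h, e => base D S Δ ℓ + greedyColor h e
  | k + 1, ℓ, h, e =>
      if Succeeds D S (palettes S Δ ℓ) (fun p => s (ℓ, p)) h e then
        base D S Δ ℓ + (palette S (palettes S Δ ℓ) (fun p => s (ℓ, p)) h e * D +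
          slot D S (palettes S Δ ℓ) (fun p => s (ℓ, p)) h e)
      else colorFrom k (ℓ + 1) (leftover D S (palettes S Δ ℓ) (fun p => s (ℓ, p)) h) e

/-- The output after the edges `h` with `L` levels. -/
noncomputable def outputOf (L : ℕ) : List (ℕ × ℕ) → List (ℕ × ℕ × ℕ)
  | [] => []
  | e :: h => outputOf L h ++ [(e.1, e.2, colorFrom D S Δ s L 0 h e)]

end Color

lemma local_color_lt {Q : ℕ} {q : ℕ × ℕ → ℕ} (hD : 0 < D) (hQ : 0 < Q) :
    palette S Q q h e * D + slot D S Q q h e < Q * D := by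
  have h1 : palette S Q q h e < Q := Nat.mod_lt _ hQ
  have h2 : slot D S Q q h e < D := Nat.mod_lt _ hD
  calc palette S Q q h e * D + slot D S Q q h e < (palette S Q q h e + 1) * D := by
        rw [add_mul, one_mul]; omega
    _ ≤ Q * D := Nat.mul_le_mul_right _ h1

lemma base_le_colorFrom (k ℓ : ℕ) : base D S Δ ℓ ≤ colorFrom D S Δ s k ℓ h e := by
  induction k generalizing ℓ h with
  | zero => exact Nat.le_add_right _ _
  | succ k ih =>
    rw [colorFrom]
    split_ifs
    · exact Nat.le_add_right _ _
    · exact (Nat.le_add_right _ _).trans (ih (ℓ + 1))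

/-- The colors of two edges with a common endpoint are different, if all levels have the favorable
outcome for the whole stream `H`. -/
lemma colorFrom_ne (hS : 0 < S) (hD : 0 < D) (hd : ∀ w, hdeg H w ≤ Δ) {k ℓ : ℕ}
    (hg : AllGood D S Δ s (ℓ + k) H) {h₁ : List (ℕ × ℕ)} {e' : ℕ × ℕ}
    (hl : e :: h <:+ hist D S Δ s ℓ H) (hl' : e' :: h₁ <:+ h)
    {w : ℕ} (hw : e.1 = w ∨ e.2 = w) (hw' : e'.1 = w ∨ e'.2 = w) :
    colorFrom D S Δ s k ℓ h e ≠ colorFrom D S Δ s k ℓ h₁ e' := by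
  induction k generalizing ℓ h h₁ with
  | zero =>
    intro heq
    have hd' : ∀ w, hdeg (e :: h) w ≤ levelDeg Δ ℓ := fun w =>
      (hdeg_mono hl.sublist w).trans (hdeg_hist_le hd hg w)
    have h1 := greedyUsed_of_suffix hl' hw'
    have h2 := greedyColor_spec hd'
    rw [← Nat.add_left_cancel heq] at h1
    rcases hw with rfl | rfl <;> omega
  | succ k ih =>
    have hlt := fun h e => local_color_lt (S := S) (h := h) (e := e)
      (q := fun p => s (ℓ, p)) hD (palettes_pos (S := S) (Δ := Δ) ℓ)
    have hnext := fun h e => base_le_colorFrom (D := D) (S := S) (Δ := Δ) (s := s) (h := h)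
      (e := e) k (ℓ + 1)
    simp only [base] at hnext
    have hgℓ := hg ℓ (by omega)
    have hdℓ : ∀ w, hdeg (hist D S Δ s ℓ H) w ≤ levelDeg Δ ℓ :=
      hdeg_hist_le hd fun j hj => hg j (by omega)
    simp only [colorFrom]
    split_ifs with h1 h2 h2
    · exact fun heq => color_ne_of_succeeds hdℓ (levelDeg_lt hS ℓ) hgℓ.1 hl hl' h1 h2 hw hw'
        (Nat.add_left_cancel heq)
    · exact ((Nat.add_lt_add_left (hlt _ _) _).trans_le (hnext _ _)).ne
    · exact ((Nat.add_lt_add_left (hlt _ _) _).trans_le (hnext _ _)).ne'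
    · refine ih (by rwa [add_right_comm]) ?_ (leftover_cons_suffix hl' h2)
      exact leftover_cons_suffix hl h1

lemma colorFrom_lt (hD : 0 < D) (hd : ∀ w, hdeg H w ≤ Δ) {k ℓ : ℕ}
    (hg : AllGood D S Δ s (ℓ + k) H) (hl : e :: h <:+ hist D S Δ s ℓ H) :
    colorFrom D S Δ s k ℓ h e < base D S Δ (ℓ + k) + 2 * levelDeg Δ (ℓ + k) ∨
      colorFrom D S Δ s k ℓ h e < base D S Δ (ℓ + k) := by
  induction k generalizing ℓ h with
  | zero =>
    refine Or.inl (Nat.add_lt_add_left (greedyColor_lt fun w => ?_) _)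
    exact (hdeg_mono hl.sublist w).trans (hdeg_hist_le hd hg w)
  | succ k ih =>
    rw [colorFrom]
    split_ifs with h1
    · refine Or.inr ?_
      have hlt := local_color_lt (S := S) (h := h) (e := e)
        (q := fun p => s (ℓ, p)) hD (palettes_pos (S := S) (Δ := Δ) ℓ)
      have hmono : Monotone (base D S Δ) := monotone_nat_of_le_succ fun _ => Nat.le_add_right _ _
      exact (Nat.add_lt_add_left hlt _).trans_le (hmono (show ℓ + 1 ≤ ℓ + (k + 1) by omega))
    · rw [show ℓ + (k + 1) = ℓ + 1 + k by omega] at hg ⊢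
      exact ih hg (leftover_cons_suffix hl h1)

/-- The palettes of a level have `O(d)` colors in total, where `d` is the degree bound of the level.
As the degree bounds decrease geometrically, the colors of all levels together are `O(Δ)` many. -/
lemma base_add_le (hD : D = 64 * S) {ℓ : ℕ} (hS : ∀ j < ℓ, S ≤ levelDeg Δ j) :
    base D S Δ ℓ + 1024 * levelDeg Δ ℓ ≤ 1024 * Δ := by
  induction ℓ with
  | zero => simp [base, levelDeg]
  | succ ℓ ih =>
    have h1 := ih fun j hj => hS j (by omega)
    have h2 := hS ℓ (Nat.lt_succ_self ℓ)
    have h3 : palettes S Δ ℓ * D ≤ 128 * levelDeg Δ ℓ := by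
      have := Nat.div_mul_le_self (levelDeg Δ ℓ) S
      rw [palettes, hD]
      nlinarith
    rw [base, levelDeg]
    omega

end CascadeFacts

/-! ### Executing programs -/

section Logic

variable {r : ℕ} {E : Env} {s t u : State r} {m : Fin r → ℕ → ℕ}

/-- Write the value `v` to the cell `i` of the array `a`. -/
def upd (m : Fin r → ℕ → ℕ) (a : Fin r) (i v : ℕ) : Fin r → ℕ → ℕ :=
  Function.update m a (Function.update (m a) i v)

lemma upd_apply (m : Fin r → ℕ → ℕ) (a b : Fin r) (i j v : ℕ) :
    upd m a i v b j = if b = a ∧ j = i then v else m b j := by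
  unfold upd
  by_cases h : b = a
  · subst h
    by_cases h' : j = i <;> simp [h']
  · simp [h]

/-- The value of an expression, ignoring overflow. -/
def Expr.val (E : Env) (m : Fin r → ℕ → ℕ) : Expr r → ℕ
  | .lit k => k
  | .numVertices => E.n
  | .maxDegree => E.Δ
  | .load a i => m a (i.val E m)
  | .op o x y => o.apply (x.val E m) (y.val E m)

/-- The evaluation of an expression succeeds. -/
def Expr.Safe (E : Env) (m : Fin r → ℕ → ℕ) : Expr r → Prop
  | .lit k => k < 2 ^ E.bits
  | .numVertices => E.n < 2 ^ E.bits
  | .maxDegree => E.Δ < 2 ^ E.bits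
  | .load _ i => i.Safe E m ∧ i.val E m < E.cells
  | .op o x y => x.Safe E m ∧ y.Safe E m ∧ o.apply (x.val E m) (y.val E m) < 2 ^ E.bits

lemma Expr.Safe.eval {x : Expr r} (h : x.Safe E m) : x.eval E m = some (x.val E m) := by
  induction x with
  | lit k => exact if_pos h
  | numVertices => exact if_pos h
  | maxDegree => exact if_pos h
  | load a i ih => simp only [Expr.eval, ih h.1, Option.bind_some, if_pos h.2, Expr.val]
  | op o x y ihx ihy =>
    simp only [Expr.eval, ihx h.1, ihy h.2.1, Option.bind_some, Expr.val]
    exact if_pos h.2.2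

/-- The deterministic run of `p` from `s` ends in `t`. -/
def Exec (E : Env) (p : Cmd r) (s t : State r) : Prop :=
  ∃ N, ∀ f ≥ N, p.run E f s = PMF.pure (some t)

/-- The run of `p` from `s` is deterministic and ends in a state with the property `A`. -/
def Runs (E : Env) (p : Cmd r) (s : State r) (A : State r → Prop) : Prop :=
  ∃ t, Exec E p s t ∧ A t

lemma andThen_pure_some {α β : Type} (a : α) (f : α → PMF (Option β)) :
    andThen (PMF.pure (some a)) f = f a := by
  simp [andThen, PMF.pure_bind]

variable {A A' : State r → Prop} {p q : Cmd r} {x i y : Expr r} {a b : Fin r}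

lemma exec_of_succ {p : Cmd r} (N : ℕ) (h : ∀ f ≥ N, p.run E (f + 1) s = PMF.pure (some t)) :
    Exec E p s t :=
  ⟨N + 1, fun f hf => by
    obtain ⟨f, rfl⟩ := Nat.exists_eq_add_of_lt hf
    exact h _ (by omega)⟩

lemma Runs.mono (h : Runs E p s A) (hA : ∀ t, A t → A' t) : Runs E p s A' := by
  obtain ⟨t, h1, h2⟩ := h
  exact ⟨t, h1, hA t h2⟩

lemma Runs.skip (h : A s) : Runs E .skip s A := ⟨s, exec_of_succ 0 fun _ _ => rfl, h⟩

lemma Runs.store (hi : i.Safe E s.mem) (hx : x.Safe E s.mem) (hi' : i.val E s.mem < E.cells)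
    (hx' : x.val E s.mem < 2 ^ E.bits)
    (h : A { s with mem := upd s.mem a (i.val E s.mem) (x.val E s.mem) }) :
    Runs E (.store a i x) s A :=
  ⟨_, exec_of_succ 0 fun f _ => by
    simp [Cmd.run, hi.eval, hx.eval, State.write, Env.word, hi', hx', upd], h⟩

lemma Runs.report {v c : Expr r} (hx : x.Safe E s.mem) (hv : v.Safe E s.mem)
    (hc : c.Safe E s.mem)
    (h : A { s with output := s.output ++ [(x.val E s.mem, v.val E s.mem, c.val E s.mem)] }) :
    Runs E (.report x v c) s A :=
  ⟨_, exec_of_succ 0 fun f _ => by simp [Cmd.run, hx.eval, hv.eval, hc.eval], h⟩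

lemma Runs.seq (h : Runs E p s fun t => Runs E q t A) : Runs E (.seq p q) s A := by
  obtain ⟨t, ⟨N, hN⟩, u, ⟨N', hN'⟩, hu⟩ := h
  refine ⟨u, exec_of_succ (N + N') fun f hf => ?_, hu⟩
  rw [Cmd.run, hN f (by omega), andThen_pure_some, hN' f (by omega)]

lemma Runs.ite (hx : x.Safe E s.mem) (hp : x.val E s.mem ≠ 0 → Runs E p s A)
    (hq : x.val E s.mem = 0 → Runs E q s A) : Runs E (.ite x p q) s A := by
  by_cases h0 : x.val E s.mem = 0
  · obtain ⟨t, ⟨N, hN⟩, ht⟩ := hq h0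
    refine ⟨t, exec_of_succ N fun f hf => ?_, ht⟩
    rw [Cmd.run, hx.eval, andThen_pure_some, if_pos h0, hN f hf]
  · obtain ⟨t, ⟨N, hN⟩, ht⟩ := hp h0
    refine ⟨t, exec_of_succ N fun f hf => ?_, ht⟩
    rw [Cmd.run, hx.eval, andThen_pure_some, if_neg h0, hN f hf]

lemma Runs.loop_step (hx : x.Safe E s.mem) (h0 : x.val E s.mem = 0 → A s)
    (hp : x.val E s.mem ≠ 0 → Runs E p s fun t => Runs E (.loop x p) t A) :
    Runs E (.loop x p) s A := by
  by_cases h : x.val E s.mem = 0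
  · refine ⟨s, exec_of_succ 0 fun f hf => ?_, h0 h⟩
    rw [Cmd.run, hx.eval, andThen_pure_some, if_pos h]
  · obtain ⟨t, ⟨N, hN⟩, u, ⟨N', hN'⟩, hu⟩ := hp h
    refine ⟨u, exec_of_succ (N + N') fun f hf => ?_, hu⟩
    rw [Cmd.run, hx.eval, andThen_pure_some, if_neg h, hN f (by omega), andThen_pure_some,
      hN' f (by omega)]

/-- The rule for loops, with an invariant `I` whose first argument decreases. -/
lemma Runs.loop (I : ℕ → State r → Prop) (hsafe : ∀ k s, I k s → x.Safe E s.mem)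
    (h0 : ∀ k s, I k s → x.val E s.mem = 0 → A s)
    (hstep : ∀ k s, I k s → x.val E s.mem ≠ 0 → Runs E p s fun t => ∃ k' < k, I k' t)
    {k : ℕ} (hI : I k s) : Runs E (.loop x p) s A := by
  induction k using Nat.strong_induction_on generalizing s with
  | _ k ih =>
    refine Runs.loop_step (hsafe k s hI) (h0 k s hI) fun hx => ?_
    refine (hstep k s hI hx).mono fun t => ?_
    rintro ⟨k', hk', ht⟩
    exact ih k' hk' ht

lemma Runs.next_nil (hin : s.input = []) (h : Runs E q s A) : Runs E (.next a b p q) s A := by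
  obtain ⟨t, ⟨N, hN⟩, ht⟩ := h
  refine ⟨t, exec_of_succ N fun f hf => ?_, ht⟩
  rw [Cmd.run, hin]
  exact hN f hf

lemma Runs.next_cons {v w : ℕ} {rest : List (ℕ × ℕ)} (hin : s.input = (v, w) :: rest)
    (hcells : 0 < E.cells) (hv : v < 2 ^ E.bits) (hw : w < 2 ^ E.bits)
    (h : Runs E p { s with input := rest, mem := upd (upd s.mem a 0 v) b 0 w } A) :
    Runs E (.next a b p q) s A := by
  obtain ⟨t, ⟨N, hN⟩, ht⟩ := h
  refine ⟨t, exec_of_succ N fun f hf => ?_, ht⟩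
  rw [Cmd.run, hin]
  simp only [State.write, hcells, if_true, Env.word, hv, hw, Option.map_some, Option.bind_some]
  rw [andThen_pure_some]
  exact hN f hf

/-! ### Lower bounds for success probabilities -/

/-- From `s`, the program `p` reaches with probability at least `ρ` a state with the property `A`,
if it has enough fuel. -/
def ProbGe (E : Env) (p : Cmd r) (s : State r) (A : State r → Prop) (ρ : ℝ) : Prop :=
  ∃ N, ∀ f ≥ N, ρ ≤ ((p.run E f s).toOuterMeasure {o | ∃ t, o = some t ∧ A t}).toReal

lemma ProbGe.of_nonpos {ρ : ℝ} (h : ρ ≤ 0) : ProbGe E p s A ρ :=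
  ⟨0, fun _ _ => h.trans ENNReal.toReal_nonneg⟩

lemma Runs.probGe (h : Runs E p s A) : ProbGe E p s A 1 := by
  obtain ⟨t, ⟨N, hN⟩, ht⟩ := h
  refine ⟨N, fun f hf => ?_⟩
  rw [hN f hf, PMF.toOuterMeasure_pure_apply, if_pos ⟨t, rfl, ht⟩]
  simp

lemma ProbGe.seq {ρ : ℝ} (h : Runs E p s fun t => ProbGe E q t A ρ) :
    ProbGe E (.seq p q) s A ρ := by
  obtain ⟨t, ⟨N, hN⟩, N', hN'⟩ := h
  refine ⟨N + N' + 1, fun f hf => ?_⟩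
  obtain ⟨f, rfl⟩ : ∃ g, f = g + 1 := ⟨f - 1, by omega⟩
  rw [Cmd.run, hN f (by omega), andThen_pure_some]
  exact hN' f (by omega)

lemma andThen_assoc {α β γ : Type} (μ : PMF (Option α)) (f : α → PMF (Option β))
    (g : β → PMF (Option γ)) :
    andThen (andThen μ f) g = andThen μ fun a => andThen (f a) g := by
  simp only [andThen, PMF.bind_bind]
  congr 1
  funext o
  cases o <;> simp [PMF.pure_bind]

/-- A uniformly random choice: the probability of success is the average of the probabilities after
the possible choices. -/
lemma toReal_andThen_uniformBelow {β : Type} {D : ℕ} (hD : 0 < D) (f : ℕ → PMF (Option β))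
    (B : Set (Option β)) :
    ((andThen (uniformBelow D) f).toOuterMeasure B).toReal =
      (∑ y ∈ Finset.range D, ((f y).toOuterMeasure B).toReal) / D := by
  obtain ⟨D, rfl⟩ : ∃ g, D = g + 1 := ⟨D - 1, by omega⟩
  have h1 : andThen (uniformBelow (D + 1)) f =
      (PMF.uniformOfFintype (Fin (D + 1))).bind fun i => f i := by
    rw [andThen, uniformBelow, PMF.bind_map]
    change ((PMF.uniformOfFintype (Fin (D + 1))).bind fun a => PMF.pure (a : ℕ)).bind _ = _
    rw [PMF.bind_bind]
    congr 1
    funext i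
    rw [PMF.pure_bind]
    rfl
  rw [h1, PMF.toOuterMeasure_bind_apply, tsum_fintype, ENNReal.toReal_sum, Finset.sum_range,
    Finset.sum_div]
  · refine Finset.sum_congr rfl fun i _ => ?_
    rw [PMF.uniformOfFintype_apply, ENNReal.toReal_mul, Fintype.card_fin]
    rw [ENNReal.toReal_inv, ENNReal.toReal_natCast]
    field_simp
  · intro i _
    refine ENNReal.mul_ne_top (PMF.apply_ne_top _ _) ?_
    refine ne_top_of_le_ne_top ENNReal.one_ne_top ?_
    rw [← ((f i).toOuterMeasure_apply_eq_one_iff Set.univ).2 (Set.subset_univ _)]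
    exact (f i).toOuterMeasure.mono (Set.subset_univ B)

/-- From `s`, running `p` and then `q`, with enough fuel for both, reaches with probability at least
`ρ` a state with the property `A`. -/
def ProbThenGe (E : Env) (p q : Cmd r) (s : State r) (A : State r → Prop) (ρ : ℝ) : Prop :=
  ∃ N, ∀ f ≥ N, ∀ f' ≥ N, ρ ≤ ((andThen (p.run E f s) fun t => q.run E f' t).toOuterMeasure
    {o | ∃ t, o = some t ∧ A t}).toReal

lemma ProbThenGe.seq {ρ : ℝ} (h : ProbThenGe E p q s A ρ) : ProbGe E (.seq p q) s A ρ := by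
  obtain ⟨N, hN⟩ := h
  refine ⟨N + 1, fun f hf => ?_⟩
  obtain ⟨f, rfl⟩ : ∃ g, f = g + 1 := ⟨f - 1, by omega⟩
  exact hN f (by omega) f (by omega)

lemma ProbGe.loop_done {ρ : ℝ} (hx : x.Safe E s.mem) (hx0 : x.val E s.mem = 0)
    (h : ProbGe E q s A ρ) : ProbThenGe E (.loop x p) q s A ρ := by
  obtain ⟨N, hN⟩ := h
  refine ⟨N + 1, fun f hf f' hf' => ?_⟩
  obtain ⟨f, rfl⟩ : ∃ g, f = g + 1 := ⟨f - 1, by omega⟩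
  rw [Cmd.run, hx.eval, andThen_pure_some, if_pos hx0, andThen_pure_some]
  exact hN f' (by omega)

/-- A random choice at the beginning of the body of a loop. -/
lemma ProbThenGe.loop_rand {D j : ℕ} {ρ : ℕ → ℝ} {z : Expr r} (hx : x.Safe E s.mem)
    (hx0 : x.val E s.mem ≠ 0)
    (hi : i.Safe E s.mem) (hiv : i.val E s.mem = j) (hj : j < E.cells)
    (hz : z.Safe E s.mem) (hzv : z.val E s.mem = D) (hD : 0 < D) (hDb : D ≤ 2 ^ E.bits)
    (h : ∀ y < D, Runs E p { s with mem := upd s.mem a j y } fun t =>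
      ProbThenGe E (.loop x (.seq (.rand a i z) p)) q t A (ρ y)) :
    ProbThenGe E (.loop x (.seq (.rand a i z) p)) q s A
      ((∑ y ∈ Finset.range D, ρ y) / D) := by
  choose t hexec hprob using h
  choose N hN using hexec
  choose N' hN' using hprob
  -- enough fuel for all possible choices
  obtain ⟨F, hF⟩ : ∃ F, ∀ y (hy : y < D), N y hy ≤ F ∧ N' y hy ≤ F := by
    refine ⟨∑ y ∈ (Finset.range D).attach, (N y (Finset.mem_range.1 y.2) +
      N' y (Finset.mem_range.1 y.2)), fun y hy => ?_⟩
    have := Finset.single_le_sum (f := fun y : Finset.range D => N y (Finset.mem_range.1 y.2) +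
      N' y (Finset.mem_range.1 y.2)) (fun _ _ => Nat.zero_le _)
      (Finset.mem_attach (Finset.range D) ⟨y, Finset.mem_range.2 hy⟩)
    dsimp only at this
    omega
  refine ⟨F + 3, fun f hf f' hf' => ?_⟩
  obtain ⟨f, rfl⟩ : ∃ g, f = g + 3 := ⟨f - 3, by omega⟩
  have hrun : (andThen ((Cmd.loop x (.seq (.rand a i z) p)).run E (f + 3) s) fun t =>
      q.run E f' t) =
      andThen (uniformBelow D) fun y => andThen (PMF.pure (s.write E a j y)) fun t₁ =>
        andThen (p.run E (f + 1) t₁) fun t₂ =>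
          andThen ((Cmd.loop x (.seq (.rand a i z) p)).run E (f + 2) t₂) fun t₃ =>
            q.run E f' t₃ := by
    rw [Cmd.run, hx.eval, andThen_pure_some, if_neg hx0]
    rw [show (Cmd.seq (.rand a i z) p).run E (f + 2) s =
      andThen ((Cmd.rand a i z).run E (f + 1) s) fun t => p.run E (f + 1) t from rfl]
    rw [show (Cmd.rand a i z).run E (f + 1) s = andThen (uniformBelow D) fun y =>
        PMF.pure (s.write E a j y) by
      rw [Cmd.run, hi.eval, andThen_pure_some, hz.eval, andThen_pure_some, hiv, hzv]]
    simp only [andThen_assoc]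
  rw [hrun, toReal_andThen_uniformBelow hD]
  gcongr with y hy
  rw [Finset.mem_range] at hy
  have hw : s.write E a j y = some { s with mem := upd s.mem a j y } := by
    simp [State.write, Env.word, hj, hy.trans_le hDb, upd]
  rw [hw, andThen_pure_some, hN y hy _ (by linarith [(hF y hy).1]), andThen_pure_some]
  exact hN' y hy _ (by linarith [(hF y hy).2]) _ (by linarith [(hF y hy).2])

end Logic

/-! ### The program -/

section Notation

variable {r : ℕ} {E : Env} {m : Fin r → ℕ → ℕ}

instance : Add (Expr r) := ⟨.op .add⟩
instance : Mul (Expr r) := ⟨.op .mul⟩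
instance : Div (Expr r) := ⟨.op .div⟩
instance : Mod (Expr r) := ⟨.op .mod⟩

/-- The comparison `x < y` as an expression. -/
def Expr.lessThan (x y : Expr r) : Expr r := .op .lt x y

/-- The comparison `x = y` as an expression. -/
def Expr.equals (x y : Expr r) : Expr r := .op .eq x y

@[simp] lemma Expr.val_lit (k : ℕ) : (Expr.lit k : Expr r).val E m = k := rfl
@[simp] lemma Expr.val_numVertices : (Expr.numVertices : Expr r).val E m = E.n := rfl
@[simp] lemma Expr.val_maxDegree : (Expr.maxDegree : Expr r).val E m = E.Δ := rfl
@[simp] lemma Expr.val_load (a : Fin r) (i : Expr r) :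
    (Expr.load a i).val E m = m a (i.val E m) := rfl
@[simp] lemma Expr.val_add (x y : Expr r) : (x + y).val E m = x.val E m + y.val E m := rfl
@[simp] lemma Expr.val_mul (x y : Expr r) : (x * y).val E m = x.val E m * y.val E m := rfl
@[simp] lemma Expr.val_div (x y : Expr r) : (x / y).val E m = x.val E m / y.val E m := rfl
@[simp] lemma Expr.val_mod (x y : Expr r) : (x % y).val E m = x.val E m % y.val E m := rfl
@[simp] lemma Expr.val_lessThan (x y : Expr r) :
    (x.lessThan y).val E m = if x.val E m < y.val E m then 1 else 0 := rfl
@[simp] lemma Expr.val_equals (x y : Expr r) :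
    (x.equals y).val E m = if x.val E m = y.val E m then 1 else 0 := rfl

@[simp] lemma Expr.safe_lit (k : ℕ) : (Expr.lit k : Expr r).Safe E m ↔ k < 2 ^ E.bits := Iff.rfl
@[simp] lemma Expr.safe_numVertices :
    (Expr.numVertices : Expr r).Safe E m ↔ E.n < 2 ^ E.bits := Iff.rfl
@[simp] lemma Expr.safe_maxDegree :
    (Expr.maxDegree : Expr r).Safe E m ↔ E.Δ < 2 ^ E.bits := Iff.rfl
@[simp] lemma Expr.safe_load (a : Fin r) (i : Expr r) :
    (Expr.load a i).Safe E m ↔ i.Safe E m ∧ i.val E m < E.cells := Iff.rfl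
@[simp] lemma Expr.safe_add (x y : Expr r) : (x + y).Safe E m ↔
    x.Safe E m ∧ y.Safe E m ∧ x.val E m + y.val E m < 2 ^ E.bits := Iff.rfl
@[simp] lemma Expr.safe_mul (x y : Expr r) : (x * y).Safe E m ↔
    x.Safe E m ∧ y.Safe E m ∧ x.val E m * y.val E m < 2 ^ E.bits := Iff.rfl
@[simp] lemma Expr.safe_div (x y : Expr r) : (x / y).Safe E m ↔
    x.Safe E m ∧ y.Safe E m ∧ x.val E m / y.val E m < 2 ^ E.bits := Iff.rfl
@[simp] lemma Expr.safe_mod (x y : Expr r) : (x % y).Safe E m ↔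
    x.Safe E m ∧ y.Safe E m ∧ x.val E m % y.val E m < 2 ^ E.bits := Iff.rfl
@[simp] lemma Expr.safe_lessThan (x y : Expr r) : (x.lessThan y).Safe E m ↔
    x.Safe E m ∧ y.Safe E m ∧ (if x.val E m < y.val E m then 1 else 0) < 2 ^ E.bits := Iff.rfl
@[simp] lemma Expr.safe_equals (x y : Expr r) : (x.equals y).Safe E m ↔
    x.Safe E m ∧ y.Safe E m ∧ (if x.val E m = y.val E m then 1 else 0) < 2 ^ E.bits := Iff.rfl

end Notation

/-- The scalar variables are the first cells of the array `2`. -/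
abbrev var (i : ℕ) : Expr 8 := .load 2 (.lit i)

/-- Assignment to a scalar variable. -/
abbrev assign (i : ℕ) (x : Expr 8) : Cmd 8 := .store 2 (.lit i) x

/-- The rounded up logarithm of the number of vertices (set by `computeParams`). -/
abbrev xLog : Expr 8 := var 0
/-- The length `S` of a phase. -/
abbrev xS : Expr 8 := var 2
/-- The threshold `T`: levels are used as long as the degree bound exceeds `T`. -/
abbrev xT : Expr 8 := var 3
/-- The degree bound of the current level. -/
abbrev xDeg : Expr 8 := var 6
/-- The first color of the current level. -/
abbrev xBase : Expr 8 := var 7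
/-- The current level. -/
abbrev xLevel : Expr 8 := var 8
/-- Whether the current edge is colored. -/
abbrev xDone : Expr 8 := var 9
/-- The center of the current edge. -/
abbrev xCenter : Expr 8 := var 10
/-- The leaf of the current edge. -/
abbrev xLeaf : Expr 8 := var 11
/-- The palette of the current edge. -/
abbrev xPalette : Expr 8 := var 13
/-- The slot of the current edge. -/
abbrev xSlot : Expr 8 := var 14
/-- The candidate for the greedy color of the current edge. -/
abbrev xGreedy : Expr 8 := var 15
/-- The row of the center in the tables of the current level. -/
abbrev xCenterRow : Expr 8 := var 16
/-- The row of the leaf in the tables of the current level. -/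
abbrev xLeafRow : Expr 8 := var 17
/-- The size `D` of a palette, also the width of the rows of the tables. -/
abbrev xD : Expr 8 := var 18
/-- The phase of the center. -/
abbrev xPhase : Expr 8 := var 19
/-- The first endpoint of the current edge. -/
abbrev xFst : Expr 8 := .load 0 (.lit 0)
/-- The second endpoint of the current edge. -/
abbrev xSnd : Expr 8 := .load 1 (.lit 0)

/-- The side of a vertex on the current level. -/
abbrev sideOf (w : Expr 8) : Expr 8 :=
  .load 3 ((xLevel * .numVertices + w) * xD + .lit 0) % .lit 2

/-- Proceed to the next level. -/
def advance : Cmd 8 :=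
  .seq (assign 7 (xBase + (xDeg / xS + .lit 1) * xD)) <|
  .seq (assign 6 (xDeg * .lit 7 / .lit 8)) <|
  assign 8 (xLevel + .lit 1)

/-- Determine the center and the leaf of the current edge. -/
def orient : Cmd 8 :=
  .ite ((sideOf xFst).equals (.lit 1))
    (.seq (assign 10 xFst) (assign 11 xSnd))
    (.seq (assign 10 xSnd) (assign 11 xFst))

/-- Treat an edge between the two sides on the current level. The arrays `3` to `6` are the random
table and the tables of `centerCount`, `leafCount` and `mark`. -/
def tryColor : Cmd 8 :=
  .seq (assign 16 (xLevel * .numVertices + xCenter)) <|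
  .seq (assign 17 (xLevel * .numVertices + xLeaf)) <|
  .seq (assign 19 (.load 4 xCenterRow / xS)) <|
  .seq (assign 13 ((.load 3 (xCenterRow * xD + .lit 1) + xPhase) % (xDeg / xS + .lit 1))) <|
  .seq (assign 14 ((.load 3 (xLeafRow * xD + (.lit 2 + xPalette)) +
    .load 5 (xLeafRow * xD + xPalette)) % xD)) <|
  .seq (.store 5 (xLeafRow * xD + xPalette) (.load 5 (xLeafRow * xD + xPalette) + .lit 1)) <|
  .seq (.store 4 xCenterRow (.load 4 xCenterRow + .lit 1)) <|
  .ite ((Expr.load 6 (xCenterRow * xD + xSlot)).equals (xPhase + .lit 1)) advance <|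
  .seq (.store 6 (xCenterRow * xD + xSlot) (xPhase + .lit 1)) <|
  .seq (assign 9 (.lit 1)) <|
  .report xFst xSnd (xBase + (xPalette * xD + xSlot))

/-- Treat the current edge on the current level. -/
def levelBody : Cmd 8 :=
  .seq orient (.ite ((sideOf xFst).equals (sideOf xSnd)) advance tryColor)

/-- A color used at one of the endpoints. The array `7` is the table of `greedyUsed`. -/
abbrev greedyConflict : Expr 8 :=
  .load 7 (xFst * (.lit 2 * xT) + xGreedy) + .load 7 (xSnd * (.lit 2 * xT) + xGreedy)

/-- Color the current edge greedily. -/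
def greedy : Cmd 8 :=
  .seq (assign 15 (.lit 0)) <|
  .seq (.loop greedyConflict (assign 15 (xGreedy + .lit 1))) <|
  .seq (.store 7 (xFst * (.lit 2 * xT) + xGreedy) (.lit 1)) <|
  .seq (.store 7 (xSnd * (.lit 2 * xT) + xGreedy) (.lit 1)) <|
  .report xFst xSnd (xBase + xGreedy)

/-- Treat the current edge. -/
def edgeBody : Cmd 8 :=
  .seq (assign 6 .maxDegree) <|
  .seq (assign 7 (.lit 0)) <|
  .seq (assign 8 (.lit 0)) <|
  .seq (assign 9 (.lit 0)) <|
  .seq (.loop ((xT.lessThan xDeg) * (xDone.equals (.lit 0))) levelBody) <|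
  .ite xDone .skip greedy

/-- Treat the stream. The variable `5` is nonzero until the end of the stream. -/
def mainLoop : Cmd 8 :=
  .seq (assign 5 (.lit 1)) (.loop (var 5) (.next 0 1 edgeBody (assign 5 (.lit 0))))

/-- Compute the parameters: the variable `1` runs through the powers of two until it reaches the
number of vertices, and `S` is increased until `S ^ 2` is at least `(K * log n) ^ 2` times the maximum
degree. -/
def computeParams (K : ℕ) : Cmd 8 :=
  .seq (assign 1 (.lit 1)) <|
  .seq (.loop ((var 1).lessThan .numVertices)
    (.seq (assign 1 (var 1 * .lit 2)) (assign 0 (xLog + .lit 1)))) <|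
  .seq (.loop ((xS * xS).lessThan (.maxDegree * ((.lit K * xLog) * (.lit K * xLog))))
    (assign 2 (xS + .lit 1))) <|
  .seq (assign 18 (.lit 64 * xS)) <|
  assign 3 (.lit 2048 * (.lit K * (xS * xLog)))

/-- Fill the random table. The variable `4` counts the cells that are filled. -/
def fillTable : Cmd 8 :=
  .loop ((var 4).lessThan (.lit 6 * xLog * .numVertices * xD))
    (.seq (.rand 3 (var 4) xD) (assign 4 (var 4 + .lit 1)))

/-- The edge coloring algorithm. -/
def program (K : ℕ) : Cmd 8 := .seq (computeParams K) (.seq fillTable mainLoop)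

/-! ### Correctness of the program -/

/-- The resources suffice for the parameters. -/
structure Fits (E : Env) (lg S D T : ℕ) : Prop where
  S_pos : 0 < S
  D_eq : D = 64 * S
  T_pos : 0 < T
  scalars : 20 ≤ E.cells
  table : 6 * lg * E.n * D ≤ E.cells
  greedy : E.n * (2 * T) ≤ E.cells
  words : 2 * E.cells + 1024 * E.Δ + 20 < 2 ^ E.bits

/-- The parameters and the random table are in memory. -/
structure Params (E : Env) (lg S D T : ℕ) (s : ℕ × ℕ × ℕ → ℕ) (m : Fin 8 → ℕ → ℕ) : Prop where
  log : m 2 0 = lg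
  phase : m 2 2 = S
  threshold : m 2 3 = T
  width : m 2 18 = D
  table : ∀ ℓ < 6 * lg, ∀ v < E.n, ∀ z < D, m 3 ((ℓ * E.n + v) * D + z) = s (ℓ, v, z)

/-- The tables in memory describe the situation after each level `ℓ < L` has received the edges
`hh ℓ` and the edges `g` have been colored greedily. -/
structure Tables (E : Env) (L S D T : ℕ) (s : ℕ × ℕ × ℕ → ℕ) (hh : ℕ → List (ℕ × ℕ))
    (g : List (ℕ × ℕ)) (m : Fin 8 → ℕ → ℕ) : Prop where
  centers : ∀ ℓ < L, ∀ v < E.n,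
    m 4 (ℓ * E.n + v) = centerCount (fun p => s (ℓ, p)) (hh ℓ) v
  leaves : ∀ ℓ < L, ∀ v < E.n, ∀ x < D, m 5 ((ℓ * E.n + v) * D + x) =
    leafCount S (palettes S E.Δ ℓ) (fun p => s (ℓ, p)) (hh ℓ) v x
  marks : ∀ ℓ < L, ∀ v < E.n, ∀ y < D, m 6 ((ℓ * E.n + v) * D + y) =
    mark D S (palettes S E.Δ ℓ) (fun p => s (ℓ, p)) (hh ℓ) v y
  greedy : ∀ v < E.n, ∀ c < 2 * T, m 7 (v * (2 * T) + c) = greedyUsed g v c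

/-- The local variables of the treatment of the edge `e` when it reaches level `ℓ`. -/
structure AtLevel (E : Env) (S D : ℕ) (e : ℕ × ℕ) (ℓ : ℕ) (m : Fin 8 → ℕ → ℕ) : Prop where
  fst : m 0 0 = e.1
  snd : m 1 0 = e.2
  degree : m 2 6 = levelDeg E.Δ ℓ
  offset : m 2 7 = base D S E.Δ ℓ
  level : m 2 8 = ℓ

section Correctness

variable {E : Env} {lg S D T ℓ : ℕ} {s : ℕ × ℕ × ℕ → ℕ} {m : Fin 8 → ℕ → ℕ}
  {e : ℕ × ℕ} {st : State 8} {A : State 8 → Prop}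

lemma row_lt {a b c d e : ℕ} (h1 : a < c) (h2 : b < d) (h : c * d ≤ e) : a * d + b < e :=
  calc a * d + b < (a + 1) * d := by rw [add_mul, one_mul]; omega
    _ ≤ c * d := Nat.mul_le_mul_right _ h1
    _ ≤ e := h

lemma row_inj {a b c d w : ℕ} (hb : b < w) (hd : d < w) : a * w + b = c * w + d ↔ a = c ∧ b = d := by
  refine ⟨fun h => ?_, by rintro ⟨rfl, rfl⟩; rfl⟩
  have h1 := congrArg (· / w) h
  have h2 := congrArg (· % w) h
  have hw : 0 < w := by omega
  simp only [mul_comm _ w, Nat.mul_add_div hw, Nat.mul_add_mod, Nat.div_eq_of_lt hb,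
    Nat.div_eq_of_lt hd, Nat.mod_eq_of_lt hb, Nat.mod_eq_of_lt hd, add_zero] at h1 h2
  exact ⟨h1, h2⟩

/-- Rows of the tables are within bounds. -/
lemma Fits.index (hf : Fits E lg S D T) {ℓ v z : ℕ} (hℓ : ℓ < 6 * lg) (hv : v < E.n) (hz : z < D) :
    (ℓ * E.n + v) * D + z < E.cells ∧ ℓ * E.n + v < E.cells ∧ ℓ * E.n ≤ ℓ * E.n + v ∧
      ℓ * E.n + v ≤ (ℓ * E.n + v) * D ∧ D ≤ E.cells := by
  have h1 : ℓ * E.n + v < 6 * lg * E.n := row_lt hℓ hv le_rfl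
  have h2 := row_lt h1 hz hf.table
  have h3 : ℓ * E.n + v ≤ (ℓ * E.n + v) * D := Nat.le_mul_of_pos_right _ (by omega)
  exact ⟨h2, by omega, by omega, h3,
    (Nat.le_mul_of_pos_left _ (by omega)).trans hf.table⟩

lemma Fits.twenty_le (hf : Fits E lg S D T) : 20 ≤ 2 ^ E.bits := by
  have := hf.words; omega

lemma Fits.n_le (hf : Fits E lg S D T) : E.n ≤ E.cells :=
  (Nat.le_mul_of_pos_right _ (by have := hf.T_pos; omega)).trans hf.greedy

lemma Runs.assign (hf : Fits E lg S D T) {i v : ℕ} {x : Expr 8} (hi : i < 20)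
    (hx : x.Safe E st.mem) (hv : x.val E st.mem = v) (hvb : v < 2 ^ E.bits)
    (hA : A { st with mem := upd st.mem 2 i v }) : Runs E (assign i x) st A := by
  subst hv
  exact Runs.store (hi.trans_le hf.twenty_le) hx (hi.trans_le hf.scalars) hvb hA

lemma Params.upd_scalar (hp : Params E lg S D T s m) {i : ℕ} (v : ℕ)
    (hi : i ≠ 0 ∧ i ≠ 2 ∧ i ≠ 3 ∧ i ≠ 18) : Params E lg S D T s (upd m 2 i v) := by
  obtain ⟨h1, h2, h3, h4, h5⟩ := hp
  obtain ⟨i1, i2, i3, i4⟩ := hi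
  constructor <;> simpa [upd_apply, i1.symm, i2.symm, i3.symm, i4.symm]

lemma Params.upd_array (hp : Params E lg S D T s m) {a : Fin 8} (i v : ℕ)
    (ha : a ≠ 2 ∧ a ≠ 3) : Params E lg S D T s (upd m a i v) := by
  obtain ⟨h1, h2, h3, h4, h5⟩ := hp
  constructor <;> simpa [upd_apply, ha.1.symm, ha.2.symm]

lemma Tables.upd_scalar {hh : ℕ → List (ℕ × ℕ)} {g : List (ℕ × ℕ)}
    {L : ℕ} (ht : Tables E L S D T s hh g m) (i v : ℕ) : Tables E L S D T s hh g (upd m 2 i v) := by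
  obtain ⟨h1, h2, h3, h4⟩ := ht
  constructor <;> simpa [upd_apply]

lemma AtLevel.upd_scalar (ha : AtLevel E S D e ℓ m) {i : ℕ} (v : ℕ)
    (hi : i ≠ 6 ∧ i ≠ 7 ∧ i ≠ 8) : AtLevel E S D e ℓ (upd m 2 i v) := by
  obtain ⟨h1, h2, h3, h4, h5⟩ := ha
  obtain ⟨i1, i2, i3⟩ := hi
  constructor <;> simpa [upd_apply, i1.symm, i2.symm, i3.symm]

lemma AtLevel.upd_array (h : AtLevel E S D e ℓ m) {a : Fin 8} (i v : ℕ)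
    (ha : a ≠ 0 ∧ a ≠ 1 ∧ a ≠ 2) : AtLevel E S D e ℓ (upd m a i v) := by
  obtain ⟨h1, h2, h3, h4, h5⟩ := h
  constructor <;> simpa [upd_apply, ha.1.symm, ha.2.1.symm, ha.2.2.symm]

lemma advance_runs (hf : Fits E lg S D T) (hp : Params E lg S D T s st.mem)
    (ha : AtLevel E S D e ℓ st.mem) (hℓ : ℓ < 6 * lg) (hn : 0 < E.n)
    (hb : base D S E.Δ (ℓ + 1) ≤ 1024 * E.Δ)
    (hA : A { st with mem := upd (upd (upd st.mem 2 7 (base D S E.Δ (ℓ + 1))) 2 6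
        (levelDeg E.Δ (ℓ + 1))) 2 8 (ℓ + 1) }) :
    Runs E advance st A := by
  have hdΔ : levelDeg E.Δ ℓ ≤ E.Δ := levelDeg_le ℓ
  have hdΔ' : levelDeg E.Δ (ℓ + 1) ≤ E.Δ := levelDeg_le _
  have hD' : 6 * lg * E.n ≤ 6 * lg * E.n * D :=
    Nat.le_mul_of_pos_right _ (by have := hf.D_eq; have := hf.S_pos; omega)
  have hn' : 6 * lg ≤ 6 * lg * E.n := Nat.le_mul_of_pos_right _ hn
  have hbase : base D S E.Δ ℓ + (levelDeg E.Δ ℓ / S + 1) * D = base D S E.Δ (ℓ + 1) := rfl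
  have hdeg : levelDeg E.Δ ℓ * 7 / 8 = levelDeg E.Δ (ℓ + 1) := rfl
  have hq : levelDeg E.Δ ℓ / S ≤ levelDeg E.Δ ℓ := Nat.div_le_self _ _
  have htable := hf.table
  have h20 := hf.scalars
  have hB := hf.words
  generalize hBe : 2 ^ E.bits = B at hB
  have hqD : (levelDeg E.Δ ℓ / S + 1) * D < B := by omega
  refine Runs.seq (Runs.assign hf (by norm_num) ?_ ?_ ?_
    (Runs.seq (Runs.assign hf (v := levelDeg E.Δ (ℓ + 1)) (by norm_num) ?_ ?_ ?_
    (Runs.assign hf (by norm_num) ?_ ?_ ?_ hA))))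
  all_goals simp [upd_apply, hp.phase, hp.width, ha.degree, ha.offset, ha.level, hBe, hdeg, hbase]
  all_goals omega

lemma orient_runs (hf : Fits E lg S D T) (hp : Params E lg S D T s st.mem)
    (ha : AtLevel E S D e ℓ st.mem) (hℓ : ℓ < 6 * lg) (he1 : e.1 < E.n) (he2 : e.2 < E.n)
    (hA : A { st with mem := (upd (upd st.mem 2 10 (center (fun p => s (ℓ, p)) e)) 2 11
        (leaf (fun p => s (ℓ, p)) e)) }) :
    Runs E orient st A := by
  have hD : 0 < D := by have := hf.D_eq; have := hf.S_pos; omega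
  have hi1 := hf.index hℓ he1 hD
  have hs1 := hp.table ℓ hℓ e.1 he1 0 hD
  have h20 := hf.scalars
  have hB := hf.words
  have hn := hf.n_le
  have hmod : s (ℓ, e.1, 0) % 2 < 2 := Nat.mod_lt _ two_pos
  rw [add_zero] at hs1
  generalize hBe : 2 ^ E.bits = B at hB
  unfold center leaf side at hA
  refine Runs.ite ?_ (fun hx => ?_) (fun hx => ?_)
  · simp [ha.fst, ha.level, hp.width, hs1, hBe]
    split_ifs <;> omega
  · simp [ha.fst, ha.level, hp.width, hs1] at hx
    rw [if_pos hx, if_pos hx] at hA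
    refine Runs.seq (Runs.assign hf (by norm_num) ?_ ?_ ?_
      (Runs.assign hf (by norm_num) ?_ ?_ ?_ hA))
    all_goals simp [upd_apply, ha.fst, ha.snd, hBe]
    all_goals omega
  · simp [ha.fst, ha.level, hp.width, hs1] at hx
    have hx' : ¬ s (ℓ, e.1, 0) % 2 = 1 := by omega
    rw [if_neg hx', if_neg hx'] at hA
    refine Runs.seq (Runs.assign hf (by norm_num) ?_ ?_ ?_
      (Runs.assign hf (by norm_num) ?_ ?_ ?_ hA))
    all_goals simp [upd_apply, ha.fst, ha.snd, hBe]
    all_goals omega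

end Correctness

/-! ### Trying to color an edge on a level -/

section TryColor

variable {E : Env} {lg L S D T ℓ : ℕ} {s : ℕ × ℕ × ℕ → ℕ} {m : Fin 8 → ℕ → ℕ}
  {e : ℕ × ℕ} {st : State 8} {A : State 8 → Prop} {hh : ℕ → List (ℕ × ℕ)} {g : List (ℕ × ℕ)}

/-- The effect on the tables of an edge between the two sides. -/
lemma Tables.step (ht : Tables E L S D T s hh g m) {c u x y : ℕ}
    (hcross : Cross (fun p => s (ℓ, p)) e) (hc : center (fun p => s (ℓ, p)) e = c)
    (hu : leaf (fun p => s (ℓ, p)) e = u) (hcn : c < E.n) (hun : u < E.n)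
    (hx : palette S (palettes S E.Δ ℓ) (fun p => s (ℓ, p)) (hh ℓ) e = x)
    (hy : slot D S (palettes S E.Δ ℓ) (fun p => s (ℓ, p)) (hh ℓ) e = y) (hxD : x < D)
    (hyD : y < D) :
    Tables E L S D T s (Function.update hh ℓ (e :: hh ℓ)) g
      (upd (upd (upd m 5 ((ℓ * E.n + u) * D + x)
        (leafCount S (palettes S E.Δ ℓ) (fun p => s (ℓ, p)) (hh ℓ) u x + 1)) 4 (ℓ * E.n + c)
        (centerCount (fun p => s (ℓ, p)) (hh ℓ) c + 1)) 6 ((ℓ * E.n + c) * D + y)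
        (centerCount (fun p => s (ℓ, p)) (hh ℓ) c / S + 1)) := by
  obtain ⟨h1, h2, h3, h4⟩ := ht
  constructor
  · intro ℓ' hℓ' v hv
    have hi := row_inj (a := ℓ') (c := ℓ) hv hcn
    by_cases hll : ℓ' = ℓ
    · subst hll
      by_cases hvc : v = c
      · subst hvc
        simp [upd_apply, centerCount, hcross, hc]
      · simp [upd_apply, centerCount, hc, hvc, Ne.symm hvc, h1 ℓ' hℓ' v hv]
    · simp [upd_apply, hi, hll, h1 ℓ' hℓ' v hv]
  · intro ℓ' hℓ' v hv z hz
    have hi := row_inj (a := ℓ') (c := ℓ) hv hun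
    have hi' := row_inj (a := ℓ' * E.n + v) (c := ℓ * E.n + u) hz hxD
    by_cases hll : ℓ' = ℓ
    · subst hll
      by_cases hvu : v = u ∧ z = x
      · obtain ⟨rfl, rfl⟩ := hvu
        simp [upd_apply, leafCount, hcross, hu, hx]
      · have hvu' : ¬ (u = v ∧ x = z) := fun h => hvu ⟨h.1.symm, h.2.symm⟩
        simp [upd_apply, leafCount, hu, hx, hi', hvu, hvu', h2 ℓ' hℓ' v hv z hz]
    · simp [upd_apply, hi, hi', hll, h2 ℓ' hℓ' v hv z hz]
  · intro ℓ' hℓ' v hv z hz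
    have hi := row_inj (a := ℓ') (c := ℓ) hv hcn
    have hi' := row_inj (a := ℓ' * E.n + v) (c := ℓ * E.n + c) hz hyD
    by_cases hll : ℓ' = ℓ
    · subst hll
      by_cases hvc : v = c ∧ z = y
      · obtain ⟨rfl, rfl⟩ := hvc
        simp [upd_apply, mark, hcross, hc, hy]
      · have hvc' : ¬ (c = v ∧ y = z) := fun h => hvc ⟨h.1.symm, h.2.symm⟩
        simp [upd_apply, mark, hc, hy, hi', hvc, hvc', h3 ℓ' hℓ' v hv z hz]
    · simp [upd_apply, hi, hi', hll, h3 ℓ' hℓ' v hv z hz]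
  · intro v hv z hz
    simp [upd_apply, h4 v hv z hz]

/-- An edge within a side has no effect on the tables. -/
lemma Tables.step_same (ht : Tables E L S D T s hh g m)
    (hcross : ¬ Cross (fun p => s (ℓ, p)) e) :
    Tables E L S D T s (Function.update hh ℓ (e :: hh ℓ)) g m := by
  obtain ⟨h1, h2, h3, h4⟩ := ht
  constructor
  · intro ℓ' hℓ' v hv
    rw [h1 ℓ' hℓ' v hv]
    by_cases hll : ℓ' = ℓ
    · subst hll; simp [centerCount, hcross]
    · simp [hll]
  · intro ℓ' hℓ' v hv z hz
    rw [h2 ℓ' hℓ' v hv z hz]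
    by_cases hll : ℓ' = ℓ
    · subst hll; simp [leafCount, hcross]
    · simp [hll]
  · intro ℓ' hℓ' v hv z hz
    rw [h3 ℓ' hℓ' v hv z hz]
    by_cases hll : ℓ' = ℓ
    · subst hll; simp [mark, hcross]
    · simp [hll]
  · exact h4

lemma upd_eq_self {a : Fin 8} {i v : ℕ} (h : m a i = v) : upd m a i v = m := by
  funext b j
  rw [upd_apply]
  split_ifs with hbj
  · rw [hbj.1, hbj.2, h]
  · rfl

lemma AtLevel.advance (ha : AtLevel E S D e ℓ m) : AtLevel E S D e (ℓ + 1)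
    (upd (upd (upd m 2 7 (base D S E.Δ (ℓ + 1))) 2 6 (levelDeg E.Δ (ℓ + 1))) 2 8 (ℓ + 1)) := by
  obtain ⟨h1, h2, -, -, -⟩ := ha
  constructor <;> simp [upd_apply, h1, h2]

/-- The state after the treatment of the edge `e` on level `ℓ`. -/
structure AfterLevel (E : Env) (lg L S D T : ℕ) (s : ℕ × ℕ × ℕ → ℕ) (hh : ℕ → List (ℕ × ℕ))
    (g : List (ℕ × ℕ)) (e : ℕ × ℕ) (ℓ : ℕ) (st t : State 8) : Prop where
  params : Params E lg S D T s t.mem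
  tables : Tables E L S D T s (Function.update hh ℓ (e :: hh ℓ)) g t.mem
  flag : t.mem 2 5 = st.mem 2 5
  input : t.input = st.input
  colored : Succeeds D S (palettes S E.Δ ℓ) (fun p => s (ℓ, p)) (hh ℓ) e →
    AtLevel E S D e ℓ t.mem ∧ t.mem 2 9 = 1 ∧
    t.output = st.output ++ [(e.1, e.2, base D S E.Δ ℓ +
      (palette S (palettes S E.Δ ℓ) (fun p => s (ℓ, p)) (hh ℓ) e * D +
        slot D S (palettes S E.Δ ℓ) (fun p => s (ℓ, p)) (hh ℓ) e))]
  failed : ¬ Succeeds D S (palettes S E.Δ ℓ) (fun p => s (ℓ, p)) (hh ℓ) e →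
    AtLevel E S D e (ℓ + 1) t.mem ∧ t.mem 2 9 = 0 ∧ t.output = st.output

/-- The program treats an edge between the two sides as the specification of a level says. -/
lemma tryColor_runs (hf : Fits E lg S D T) (hp : Params E lg S D T s st.mem)
    (ht : Tables E L S D T s hh g st.mem)
    (ha : AtLevel E S D e ℓ st.mem) (hℓL : ℓ < L) (hL : L ≤ 6 * lg) (he1 : e.1 < E.n) (he2 : e.2 < E.n)
    (hb : base D S E.Δ (ℓ + 1) ≤ 1024 * E.Δ) (hQD : 2 + palettes S E.Δ ℓ ≤ D)
    (hs : ∀ k, s k < D) (h9 : st.mem 2 9 = 0)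
    (hdeg : ∀ w, hdeg (hh ℓ) w ≤ levelDeg E.Δ ℓ)
    (hlc : ∀ u x, leafCount S (palettes S E.Δ ℓ) (fun p => s (ℓ, p)) (hh ℓ) u x ≤ D)
    (hcross : Cross (fun p => s (ℓ, p)) e)
    (h10 : st.mem 2 10 = center (fun p => s (ℓ, p)) e)
    (h11 : st.mem 2 11 = leaf (fun p => s (ℓ, p)) e) :
    Runs E tryColor st (AfterLevel E lg L S D T s hh g e ℓ st) := by
  have hℓ : ℓ < 6 * lg := hℓL.trans_le hL
  have hS := hf.S_pos
  have hD : 0 < D := by have := hf.D_eq; omega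
  -- the values of the variables
  obtain ⟨c, hc⟩ : ∃ c, center (fun p => s (ℓ, p)) e = c := ⟨_, rfl⟩
  obtain ⟨u, hu⟩ : ∃ u, leaf (fun p => s (ℓ, p)) e = u := ⟨_, rfl⟩
  have hcn : c < E.n := by
    rcases center_mem (q := fun p => s (ℓ, p)) e with h | h <;> omega
  have hun : u < E.n := by
    rcases leaf_mem (q := fun p => s (ℓ, p)) e with h | h <;> omega
  obtain ⟨x, hx⟩ : ∃ x, palette S (palettes S E.Δ ℓ) (fun p => s (ℓ, p)) (hh ℓ) e = x :=
    ⟨_, rfl⟩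
  obtain ⟨y, hy⟩ : ∃ y, slot D S (palettes S E.Δ ℓ) (fun p => s (ℓ, p)) (hh ℓ) e = y :=
    ⟨_, rfl⟩
  have hxQ : x < palettes S E.Δ ℓ := hx ▸ Nat.mod_lt _ (palettes_pos ℓ)
  have hyD : y < D := hy ▸ Nat.mod_lt _ hD
  have hcolor := local_color_lt (S := S) (h := hh ℓ) (e := e) (q := fun p => s (ℓ, p)) hD
    (palettes_pos (S := S) (Δ := E.Δ) ℓ)
  have hR1 := hp.table ℓ hℓ c hcn 1 (by omega)
  have hR2 := hp.table ℓ hℓ u hun (2 + x) (by omega)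
  have hC := ht.centers ℓ hℓL c hcn
  have hLv := ht.leaves ℓ hℓL u hun x (by omega)
  have hM := ht.marks ℓ hℓL c hcn y hyD
  have hi1 := hf.index hℓ hcn (show 1 < D by omega)
  have hi2 := hf.index hℓ hun (show 2 + x < D by omega)
  have hi3 := hf.index hℓ hun (show x < D by omega)
  have hi4 := hf.index hℓ hcn hyD
  have hccΔ : centerCount (fun p => s (ℓ, p)) (hh ℓ) c ≤ E.Δ :=
    (centerCount_le_hdeg c).trans ((hdeg c).trans (levelDeg_le ℓ))
  have hlcD := hlc u x
  have hsucc : Succeeds D S (palettes S E.Δ ℓ) (fun p => s (ℓ, p)) (hh ℓ) e ↔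
      st.mem 6 ((ℓ * E.n + c) * D + y) ≠ centerCount (fun p => s (ℓ, p)) (hh ℓ) c / S + 1 := by
    rw [hM, Succeeds, Taken, hc, hy]
    simp [hcross]
  have hs1 := hs (ℓ, c, 1)
  have hs2 := hs (ℓ, u, 2 + x)
  have hpal := hx
  have hsl := hy
  unfold palette at hpal
  unfold slot at hsl
  rw [hx] at hsl
  simp only [hc, hu] at hpal hsl
  rw [hx, hy] at hcolor
  rw [hc] at h10
  rw [hu] at h11
  have hbase : base D S E.Δ ℓ + palettes S E.Δ ℓ * D = base D S E.Δ (ℓ + 1) := rfl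
  have hQ : levelDeg E.Δ ℓ / S + 1 = palettes S E.Δ ℓ := rfl
  have hQ' : levelDeg E.Δ ℓ / S ≤ palettes S E.Δ ℓ := Nat.le_succ _
  generalize hcc : centerCount (fun p => s (ℓ, p)) (hh ℓ) c = cc at *
  generalize hlc' : leafCount S (palettes S E.Δ ℓ) (fun p => s (ℓ, p)) (hh ℓ) u x = lc at *
  have hccS : cc / S ≤ cc := Nat.div_le_self _ _
  have h20 := hf.scalars
  have hB := hf.words
  have hn := hf.n_le
  have hp' := hp
  have ha' := ha
  have hφ := hp.phase
  have hw := hp.width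
  have hdeg' := ha.degree
  have hbase' := ha.offset
  have hlev := ha.level
  have hfst := ha.fst
  have hsnd := ha.snd
  have hmod := Nat.mod_lt (s (ℓ, c, 1) + cc / S) (palettes_pos (S := S) (Δ := E.Δ) ℓ)
  generalize hBe : 2 ^ E.bits = B at hB
  refine Runs.seq (Runs.assign hf (v := ℓ * E.n + c) (by norm_num)
    (by simp [hlev, h10, hBe]; omega) (by simp [hlev, h10]) (by omega) ?_)
  refine Runs.seq (Runs.assign hf (v := ℓ * E.n + u) (by norm_num)
    (by simp [upd_apply, hlev, h11, hBe]; omega) (by simp [upd_apply, hlev, h11]) (by omega) ?_)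
  refine Runs.seq (Runs.assign hf (v := cc / S) (by norm_num)
    (by simp [upd_apply, hC, hφ, hBe]; omega) (by simp [upd_apply, hC, hφ]) (by omega) ?_)
  refine Runs.seq (Runs.assign hf (v := x) (by norm_num)
    (by simp [upd_apply, hR1, hw, hφ, hdeg', hBe, hQ, hpal]; omega)
    (by simp [upd_apply, hR1, hw, hφ, hdeg', hQ, hpal]) (by omega) ?_)
  refine Runs.seq (Runs.assign hf (v := y) (by norm_num)
    (by simp [upd_apply, hR2, hLv, hw, hBe, hsl]; omega)
    (by simp [upd_apply, hR2, hLv, hw, hsl]) (by omega) ?_)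
  have hp5 := ((((hp.upd_scalar (i := 16) (ℓ * E.n + c) (by norm_num)).upd_scalar
    (i := 17) (ℓ * E.n + u) (by norm_num)).upd_scalar (i := 19) (cc / S) (by norm_num)).upd_scalar
    (i := 13) x (by norm_num)).upd_scalar (i := 14) y (by norm_num)
  have ht5 := ((((ht.upd_scalar 16 (ℓ * E.n + c)).upd_scalar 17 (ℓ * E.n + u)).upd_scalar
    19 (cc / S)).upd_scalar 13 x).upd_scalar 14 y
  have ha5 := ((((ha.upd_scalar (i := 16) (ℓ * E.n + c) (by norm_num)).upd_scalar
    (i := 17) (ℓ * E.n + u) (by norm_num)).upd_scalar (i := 19) (cc / S) (by norm_num)).upd_scalar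
    (i := 13) x (by norm_num)).upd_scalar (i := 14) y (by norm_num)
  dsimp only
  generalize hm : upd (upd (upd (upd (upd st.mem 2 16 (ℓ * E.n + c)) 2 17 (ℓ * E.n + u)) 2 19
      (cc / S)) 2 13 x) 2 14 y = m at hp5 ht5 ha5 ⊢
  have m5 : m 2 5 = st.mem 2 5 := by simp [← hm, upd_apply]
  have m9 : m 2 9 = 0 := by simp [← hm, upd_apply, h9]
  have m16 : m 2 16 = ℓ * E.n + c := by simp [← hm, upd_apply]
  have m17 : m 2 17 = ℓ * E.n + u := by simp [← hm, upd_apply]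
  have m19 : m 2 19 = cc / S := by simp [← hm, upd_apply]
  have m13 : m 2 13 = x := by simp [← hm, upd_apply]
  have m14 : m 2 14 = y := by simp [← hm, upd_apply]
  have m18 := hp5.width
  have mC : m 4 (ℓ * E.n + c) = cc := by simp [← hm, upd_apply, hC]
  have mL : m 5 ((ℓ * E.n + u) * D + x) = lc := by simp [← hm, upd_apply, hLv]
  have mM : st.mem 6 ((ℓ * E.n + c) * D + y) = m 6 ((ℓ * E.n + c) * D + y) := by
    simp [← hm, upd_apply]
  clear hm
  rw [mM] at hsucc
  refine Runs.seq (Runs.store (by simp [m17, m18, m13, hBe]; omega)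
    (by simp [m17, m18, m13, mL, hBe]; omega) (by simp [m17, m18, m13]; omega)
    (by simp [m17, m18, m13, mL, hBe]; omega) ?_)
  refine Runs.seq (Runs.store (by simp [hBe]; omega)
    (by simp [upd_apply, m16, mC, hBe]; omega) (by simp [upd_apply, m16]; omega)
    (by simp [upd_apply, m16, mC, hBe]; omega) ?_)
  have hstep := ht5.step hcross hc hu hcn hun hx hy (by omega) hyD
  rw [hcc, hlc'] at hstep
  have hp7 := (hp5.upd_array (a := 5) ((ℓ * E.n + u) * D + x) (lc + 1) (by decide)).upd_array
    (a := 4) (ℓ * E.n + c) (cc + 1) (by decide)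
  have ha7 := (ha5.upd_array (a := 5) ((ℓ * E.n + u) * D + x) (lc + 1) (by decide)).upd_array
    (a := 4) (ℓ * E.n + c) (cc + 1) (by decide)
  simp only [Expr.val_load, Expr.val_add, Expr.val_mul, Expr.val_lit, m16, m17, m18, m13, mL, mC,
    upd_apply m, show (2 : Fin 8) ≠ 5 by decide, show (4 : Fin 8) ≠ 5 by decide, false_and,
    if_false]
  generalize hm' : upd (upd m 5 ((ℓ * E.n + u) * D + x) (lc + 1)) 4 (ℓ * E.n + c) (cc + 1) = m'
    at hstep hp7 ha7 ⊢
  have k5 : m' 2 5 = st.mem 2 5 := by simp [← hm', upd_apply, m5]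
  have k9 : m' 2 9 = 0 := by simp [← hm', upd_apply, m9]
  have k16 : m' 2 16 = ℓ * E.n + c := by simp [← hm', upd_apply, m16]
  have k19 : m' 2 19 = cc / S := by simp [← hm', upd_apply, m19]
  have k13 : m' 2 13 = x := by simp [← hm', upd_apply, m13]
  have k14 : m' 2 14 = y := by simp [← hm', upd_apply, m14]
  have k18 := hp7.width
  have kM : m' 6 ((ℓ * E.n + c) * D + y) = m 6 ((ℓ * E.n + c) * D + y) := by
    simp [← hm', upd_apply]
  clear hm'
  rw [← kM] at hsucc
  have hM6 : m' 6 ((ℓ * E.n + c) * D + y) ≤ cc / S + 1 := by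
    rw [kM, ← mM, hM, ← hcc]; exact mark_le _ _
  refine Runs.ite ?_ (fun hx0 => ?_) (fun hx0 => ?_)
  · simp [k16, k18, k14, k19, hBe]
    refine ⟨by omega, by omega, ?_⟩
    split_ifs <;> omega
  · simp [k16, k18, k14, k19] at hx0
    rw [upd_eq_self hx0] at hstep
    refine advance_runs hf hp7 ha7 hℓ (by omega) hb ?_
    refine ⟨?_, ?_, ?_, rfl, fun h => absurd hx0 (hsucc.1 h), fun _ => ⟨ha7.advance, ?_, rfl⟩⟩
    · exact ((hp7.upd_scalar (i := 7) _ (by norm_num)).upd_scalar (i := 6) _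
        (by norm_num)).upd_scalar (i := 8) _ (by norm_num)
    · exact ((hstep.upd_scalar _ _).upd_scalar _ _).upd_scalar _ _
    · simp [upd_apply, k5]
    · simp [upd_apply, k9]
  · simp [k16, k18, k14, k19] at hx0
    refine Runs.seq (Runs.store (by simp [k16, k18, k14, hBe]; omega)
      (by simp [k19, hBe]; omega) (by simp [k16, k18, k14]; omega)
      (by simp [k19, hBe]; omega) ?_)
    refine Runs.seq (Runs.assign hf (v := 1) (by norm_num) (by simp [hBe]; omega) (by simp)
      (by omega) ?_)
    simp only [Expr.val_load, Expr.val_add, Expr.val_mul, Expr.val_lit, k16, k18, k14, k19]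
    have hp9 := (hp7.upd_array (a := 6) ((ℓ * E.n + c) * D + y) (cc / S + 1)
      (by decide)).upd_scalar (i := 9) 1 (by norm_num)
    have ha9 := (ha7.upd_array (a := 6) ((ℓ * E.n + c) * D + y) (cc / S + 1)
      (by decide)).upd_scalar (i := 9) 1 (by norm_num)
    have ht9 := hstep.upd_scalar 9 1
    have l5 : upd (upd m' 6 ((ℓ * E.n + c) * D + y) (cc / S + 1)) 2 9 1 2 5 = st.mem 2 5 := by
      simp [upd_apply, k5]
    have l9 : upd (upd m' 6 ((ℓ * E.n + c) * D + y) (cc / S + 1)) 2 9 1 2 9 = 1 := by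
      simp [upd_apply]
    have l13 : upd (upd m' 6 ((ℓ * E.n + c) * D + y) (cc / S + 1)) 2 9 1 2 13 = x := by
      simp [upd_apply, k13]
    have l14 : upd (upd m' 6 ((ℓ * E.n + c) * D + y) (cc / S + 1)) 2 9 1 2 14 = y := by
      simp [upd_apply, k14]
    generalize upd (upd m' 6 ((ℓ * E.n + c) * D + y) (cc / S + 1)) 2 9 1 = m'' at *
    have hw := hp9.width
    have h2 := ha9.offset
    refine Runs.report (by simp [hBe]; omega) (by simp [hBe]; omega)
      (by simp [hp9.width, ha9.offset, l13, l14, hBe]; omega) ?_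
    refine ⟨hp9, ht9, l5, rfl, fun _ => ⟨ha9, l9, ?_⟩, fun h => absurd (hsucc.2 hx0) h⟩
    simp [ha9.fst, ha9.snd, hp9.width, ha9.offset, l13, l14, hx, hy]

end TryColor

/-! ### Treating an edge on a level and coloring greedily -/

section LevelBody

variable {E : Env} {lg L S D T ℓ : ℕ} {s : ℕ × ℕ × ℕ → ℕ} {m : Fin 8 → ℕ → ℕ}
  {e : ℕ × ℕ} {st : State 8} {A : State 8 → Prop} {hh : ℕ → List (ℕ × ℕ)} {g : List (ℕ × ℕ)}

/-- The program treats an edge on a level as the specification says. -/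
lemma levelBody_runs (hf : Fits E lg S D T) (hp : Params E lg S D T s st.mem)
    (ht : Tables E L S D T s hh g st.mem)
    (ha : AtLevel E S D e ℓ st.mem) (hℓL : ℓ < L) (hL : L ≤ 6 * lg) (he1 : e.1 < E.n)
    (he2 : e.2 < E.n)
    (hb : base D S E.Δ (ℓ + 1) ≤ 1024 * E.Δ) (hQD : 2 + palettes S E.Δ ℓ ≤ D)
    (hs : ∀ k, s k < D) (h9 : st.mem 2 9 = 0)
    (hdeg : ∀ w, hdeg (hh ℓ) w ≤ levelDeg E.Δ ℓ)
    (hlc : ∀ u x, leafCount S (palettes S E.Δ ℓ) (fun p => s (ℓ, p)) (hh ℓ) u x ≤ D) :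
    Runs E levelBody st (AfterLevel E lg L S D T s hh g e ℓ st) := by
  have hℓ : ℓ < 6 * lg := hℓL.trans_le hL
  have hD : 0 < D := by omega
  refine Runs.seq (orient_runs hf hp ha hℓ he1 he2 ?_)
  have hp2 := (hp.upd_scalar (i := 10) (center (fun p => s (ℓ, p)) e) (by norm_num)).upd_scalar
    (i := 11) (leaf (fun p => s (ℓ, p)) e) (by norm_num)
  have ht2 := (ht.upd_scalar 10 (center (fun p => s (ℓ, p)) e)).upd_scalar
    11 (leaf (fun p => s (ℓ, p)) e)
  have ha2 := (ha.upd_scalar (i := 10) (center (fun p => s (ℓ, p)) e) (by norm_num)).upd_scalar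
    (i := 11) (leaf (fun p => s (ℓ, p)) e) (by norm_num)
  generalize hm : upd (upd st.mem 2 10 (center (fun p => s (ℓ, p)) e)) 2 11
    (leaf (fun p => s (ℓ, p)) e) = m at hp2 ht2 ha2 ⊢
  have m5 : m 2 5 = st.mem 2 5 := by simp [← hm, upd_apply]
  have m9 : m 2 9 = 0 := by simp [← hm, upd_apply, h9]
  have m10 : m 2 10 = center (fun p => s (ℓ, p)) e := by simp [← hm, upd_apply]
  have m11 : m 2 11 = leaf (fun p => s (ℓ, p)) e := by simp [← hm, upd_apply]
  clear hm
  have hi1 := hf.index hℓ he1 hD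
  have hi2 := hf.index hℓ he2 hD
  have hs1 := hp2.table ℓ hℓ e.1 he1 0 hD
  have hs2 := hp2.table ℓ hℓ e.2 he2 0 hD
  rw [add_zero] at hs1 hs2
  have h20 := hf.scalars
  have hB := hf.words
  have hn := hf.n_le
  have hmod1 : s (ℓ, e.1, 0) % 2 < 2 := Nat.mod_lt _ two_pos
  have hmod2 : s (ℓ, e.2, 0) % 2 < 2 := Nat.mod_lt _ two_pos
  generalize hBe : 2 ^ E.bits = B at hB
  have hcross : Cross (fun p => s (ℓ, p)) e ↔ ¬ s (ℓ, e.1, 0) % 2 = s (ℓ, e.2, 0) % 2 := Iff.rfl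
  refine Runs.ite ?_ (fun hx => ?_) (fun hx => ?_)
  · simp [ha2.fst, ha2.snd, ha2.level, hp2.width, hs1, hs2, hBe]
    refine ⟨by omega, by omega, ?_⟩
    split_ifs <;> omega
  · simp [ha2.fst, ha2.snd, ha2.level, hp2.width, hs1, hs2] at hx
    refine advance_runs hf hp2 ha2 hℓ (by omega) hb ?_
    refine ⟨?_, ?_, ?_, rfl, fun h => absurd hx (hcross.1 h.1), fun _ => ⟨ha2.advance, ?_, rfl⟩⟩
    · exact ((hp2.upd_scalar (i := 7) _ (by norm_num)).upd_scalar (i := 6) _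
        (by norm_num)).upd_scalar (i := 8) _ (by norm_num)
    · exact (((ht2.step_same (hcross.not.2 (not_not.2 hx))).upd_scalar _ _).upd_scalar _
        _).upd_scalar _ _
    · simp [upd_apply, m5]
    · simp [upd_apply, m9]
  · simp [ha2.fst, ha2.snd, ha2.level, hp2.width, hs1, hs2] at hx
    refine (tryColor_runs (st := { st with mem := m }) hf hp2 ht2 ha2 hℓL hL he1 he2 hb hQD hs m9
      hdeg hlc (hcross.2 hx) m10 m11).mono fun t ht' => ?_
    exact ⟨ht'.params, ht'.tables, ht'.flag.trans m5, ht'.input, ht'.colored, ht'.failed⟩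

/-- The effect of a greedily colored edge on the tables. -/
lemma Tables.greedy_step (ht : Tables E L S D T s hh g m) (hc : greedyColor g e < 2 * T) :
    Tables E L S D T s hh (e :: g) (upd (upd m 7 (e.1 * (2 * T) + greedyColor g e) 1) 7
      (e.2 * (2 * T) + greedyColor g e) 1) := by
  obtain ⟨h1, h2, h3, h4⟩ := ht
  refine ⟨?_, ?_, ?_, fun v hv c hc' => ?_⟩
  · simpa [upd_apply]
  · simpa [upd_apply]
  · simpa [upd_apply]
  · have hi1 := row_inj (a := v) (c := e.1) hc' hc
    have hi2 := row_inj (a := v) (c := e.2) hc' hc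
    simp only [upd_apply, hi1, hi2, true_and, h4 v hv c hc', greedyUsed_cons]
    split_ifs <;> first | rfl | (exfalso; tauto)

/-- The program finds the greedy color of an edge. -/
lemma greedy_runs (hf : Fits E lg S D T) (hp : Params E lg S D T s st.mem)
    (ht : Tables E L S D T s hh g st.mem)
    (ha : AtLevel E S D e ℓ st.mem) (he1 : e.1 < E.n) (he2 : e.2 < E.n) (hT : levelDeg E.Δ ℓ ≤ T)
    (hb : base D S E.Δ ℓ + 1024 * levelDeg E.Δ ℓ ≤ 1024 * E.Δ)
    (hdeg : ∀ w, hdeg (e :: g) w ≤ levelDeg E.Δ ℓ) :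
    Runs E greedy st fun t => Params E lg S D T s t.mem ∧ Tables E L S D T s hh (e :: g) t.mem ∧
      t.mem 2 5 = st.mem 2 5 ∧ t.input = st.input ∧
      t.output = st.output ++ [(e.1, e.2, base D S E.Δ ℓ + greedyColor g e)] := by
  obtain ⟨γ, hγ⟩ : ∃ γ, greedyColor g e = γ := ⟨_, rfl⟩
  have hlt := greedyColor_lt hdeg
  have hspec := greedyColor_spec hdeg
  have hgstep := fun m (ht : Tables E L S D T s hh g m) => ht.greedy_step (e := e) (by omega)
  rw [hγ] at hlt hspec hgstep
  have hmin : ∀ c < γ, greedyUsed g e.1 c + greedyUsed g e.2 c ≠ 0 := by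
    intro c hc h0
    have := Nat.notMem_of_lt_sInf (hγ.symm ▸ hc : c < greedyColor g e)
    exact this ⟨by omega, by omega⟩
  have hle := greedyUsed_le_one g
  have hidx : ∀ c < 2 * T, ∀ v < E.n, v * (2 * T) + c < E.cells :=
    fun c hc v hv => row_lt hv hc hf.greedy
  have hidx1 := hidx γ (by omega) e.1 he1
  have hidx2 := hidx γ (by omega) e.2 he2
  have h20 := hf.scalars
  have hB := hf.words
  have hn := hf.n_le
  have hTc : 2 * T ≤ E.cells := (Nat.le_mul_of_pos_left _ (by omega)).trans hf.greedy
  have hB' := hB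
  generalize hBe : 2 ^ E.bits = B at hB'
  refine Runs.seq (Runs.assign hf (v := 0) (by norm_num) (by simp [hBe]; omega) (by simp)
    (by omega) ?_)
  -- the facts about the memory that the search for the greedy color preserves
  have hmem : ∀ c, Params E lg S D T s (upd st.mem 2 15 c) ∧
      Tables E L S D T s hh g (upd st.mem 2 15 c) ∧ AtLevel E S D e ℓ (upd st.mem 2 15 c) ∧
      upd st.mem 2 15 c 2 15 = c ∧ upd st.mem 2 15 c 2 5 = st.mem 2 5 := fun c =>
    ⟨hp.upd_scalar c (by norm_num), ht.upd_scalar 15 c, ha.upd_scalar c (by norm_num),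
      by simp [upd_apply], by simp [upd_apply]⟩
  have hval : ∀ c ≤ γ, Expr.val E (upd st.mem 2 15 c) greedyConflict =
      greedyUsed g e.1 c + greedyUsed g e.2 c := by
    intro c hc
    obtain ⟨h1, h2, h3, h4, -⟩ := hmem c
    simp [h3.fst, h3.snd, h1.threshold, h4, h2.greedy e.1 he1 c (by omega),
      h2.greedy e.2 he2 c (by omega)]
  have hsafe : ∀ c ≤ γ, Expr.Safe E (upd st.mem 2 15 c) greedyConflict := by
    intro c hc
    obtain ⟨h1, h2, h3, h4, -⟩ := hmem c
    have i1 := hidx c (by omega) e.1 he1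
    have i2 := hidx c (by omega) e.2 he2
    have u1 := hle e.1 c
    have u2 := hle e.2 c
    simp [h3.fst, h3.snd, h1.threshold, h4, h2.greedy e.1 he1 c (by omega),
      h2.greedy e.2 he2 c (by omega), hBe]
    omega
  refine Runs.seq (Runs.loop (k := γ)
    (fun k t => k ≤ γ ∧ t = { st with mem := upd st.mem 2 15 (γ - k) }) ?_ ?_ ?_
    ⟨le_rfl, by simp⟩)
  · rintro k _ ⟨hk, rfl⟩
    exact hsafe _ (Nat.sub_le _ _)
  · rintro k _ ⟨hk, rfl⟩ h0
    rw [hval _ (Nat.sub_le _ _)] at h0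
    have hk0 : γ - k = γ := by
      by_contra hne
      exact hmin _ (by omega) h0
    rw [hk0]
    obtain ⟨h1, h2, h3, h4, h5⟩ := hmem γ
    generalize upd st.mem 2 15 γ = m at *
    refine Runs.seq (Runs.store (by simp [h3.fst, h1.threshold, h4, hBe]; omega)
      (by simp [hBe]; omega) (by simp [h3.fst, h1.threshold, h4]; omega)
      (by simp [hBe]; omega) ?_)
    refine Runs.seq (Runs.store (by simp [upd_apply, h3.snd, h1.threshold, h4, hBe]; omega)
      (by simp [hBe]; omega) (by simp [upd_apply, h3.snd, h1.threshold, h4]; omega)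
      (by simp [hBe]; omega) ?_)
    have hst := hgstep m h2
    simp only [Expr.val_load, Expr.val_add, Expr.val_mul, Expr.val_lit, h3.fst, h3.snd,
      h1.threshold, h4, upd_apply m, show (2 : Fin 8) ≠ 7 by decide, show (1 : Fin 8) ≠ 7 by decide,
      false_and, if_false]
    have hp' := (h1.upd_array (a := 7) (e.1 * (2 * T) + γ) 1 (by decide)).upd_array (a := 7)
      (e.2 * (2 * T) + γ) 1 (by decide)
    have ha' := (h3.upd_array (a := 7) (e.1 * (2 * T) + γ) 1 (by decide)).upd_array (a := 7)
      (e.2 * (2 * T) + γ) 1 (by decide)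
    have h4' : (upd (upd m 7 (e.1 * (2 * T) + γ) 1) 7 (e.2 * (2 * T) + γ) 1) 2 15 = γ := by
      simp [upd_apply, h4]
    have h5' : (upd (upd m 7 (e.1 * (2 * T) + γ) 1) 7 (e.2 * (2 * T) + γ) 1) 2 5 =
        st.mem 2 5 := by
      simp [upd_apply, h5]
    generalize upd (upd m 7 (e.1 * (2 * T) + γ) 1) 7 (e.2 * (2 * T) + γ) 1 = m' at *
    refine Runs.report (by simp [hBe]; omega) (by simp [hBe]; omega)
      (by simp [ha'.offset, h4', hBe]; omega) ?_
    exact ⟨hp', hst, h5', rfl, by simp [ha'.fst, ha'.snd, ha'.offset, h4', hγ]⟩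
  · rintro k _ ⟨hk, rfl⟩ h0
    rw [hval _ (Nat.sub_le _ _)] at h0
    have hk0 : k ≠ 0 := by
      rintro rfl
      rw [Nat.sub_zero, hspec.1, hspec.2] at h0
      exact h0 rfl
    obtain ⟨h1, h2, h3, h4, -⟩ := hmem (γ - k)
    refine Runs.assign hf (v := γ - (k - 1)) (by norm_num) (by simp [h4, hBe]; omega)
      (by simp [h4]; omega) (by omega) ⟨k - 1, by omega, by omega, ?_⟩
    congr 1
    funext a j
    simp only [upd_apply]
    split_ifs <;> rfl

end LevelBody

/-! ### Treating the stream -/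

section Stream

variable {E : Env} {lg L S D T ℓ : ℕ} {s : ℕ × ℕ × ℕ → ℕ} {m : Fin 8 → ℕ → ℕ}
  {e : ℕ × ℕ} {st : State 8} {A : State 8 → Prop} {H : List (ℕ × ℕ)}

/-- The threshold `T` is such that exactly the levels below `L` are used. -/
structure Levels (E : Env) (lg L S D T : ℕ) : Prop where
  le : L ≤ 6 * lg
  active : ∀ ℓ < L, T < levelDeg E.Δ ℓ
  degree_le : levelDeg E.Δ L ≤ T
  phase_le : S ≤ T
  palettes_le : ∀ ℓ < L, 2 + palettes S E.Δ ℓ ≤ D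

lemma Levels.base_le (hf : Fits E lg S D T) (hl : Levels E lg L S D T) (hℓ : ℓ ≤ L) :
    base D S E.Δ ℓ + 1024 * levelDeg E.Δ ℓ ≤ 1024 * E.Δ :=
  base_add_le hf.D_eq fun j hj => hl.phase_le.trans (hl.active j (by omega)).le

/-- The state between the levels: the edge `e`, arriving after `H`, has reached level `ℓ`. -/
structure Reached (E : Env) (lg L S D T : ℕ) (s : ℕ × ℕ × ℕ → ℕ) (H : List (ℕ × ℕ)) (e : ℕ × ℕ)
    (ℓ : ℕ) (st t : State 8) : Prop where
  params : Params E lg S D T s t.mem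
  tables : Tables E L S D T s
    (fun j => if j < ℓ then hist D S E.Δ s j (e :: H) else hist D S E.Δ s j H)
    (hist D S E.Δ s L H) t.mem
  level : AtLevel E S D e ℓ t.mem
  done : t.mem 2 9 = 0
  flag : t.mem 2 5 = st.mem 2 5
  input : t.input = st.input
  output : t.output = st.output
  le : ℓ ≤ L
  hist_eq : hist D S E.Δ s ℓ (e :: H) = e :: hist D S E.Δ s ℓ H
  color_eq : colorFrom D S E.Δ s L 0 H e =
    colorFrom D S E.Δ s (L - ℓ) ℓ (hist D S E.Δ s ℓ H) e

/-- The state after the edge `e`, arriving after `H`, has been colored. -/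
structure Colored (E : Env) (lg L S D T : ℕ) (s : ℕ × ℕ × ℕ → ℕ) (H : List (ℕ × ℕ)) (e : ℕ × ℕ)
    (st t : State 8) : Prop where
  params : Params E lg S D T s t.mem
  tables : Tables E L S D T s (fun j => hist D S E.Δ s j (e :: H))
    (hist D S E.Δ s L (e :: H)) t.mem
  flag : t.mem 2 5 = st.mem 2 5
  input : t.input = st.input
  output : t.output = st.output ++ [(e.1, e.2, colorFrom D S E.Δ s L 0 H e)]

lemma hist_eq_of_le {j : ℕ} {h h' : List (ℕ × ℕ)} (hℓ : ℓ ≤ j)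
    (h0 : hist D S E.Δ s ℓ h = hist D S E.Δ s ℓ h') :
    hist D S E.Δ s j h = hist D S E.Δ s j h' := by
  induction j, hℓ using Nat.le_induction with
  | base => exact h0
  | succ j _ ih => rw [hist, ih, hist]

lemma Tables.congr {hh hh' : ℕ → List (ℕ × ℕ)} {g : List (ℕ × ℕ)}
    (ht : Tables E L S D T s hh g m) (h : ∀ ℓ < L, hh ℓ = hh' ℓ) :
    Tables E L S D T s hh' g m := by
  obtain ⟨h1, h2, h3, h4⟩ := ht
  constructor
  · intro ℓ hℓ; rw [← h ℓ hℓ]; exact h1 ℓ hℓ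
  · intro ℓ hℓ; rw [← h ℓ hℓ]; exact h2 ℓ hℓ
  · intro ℓ hℓ; rw [← h ℓ hℓ]; exact h3 ℓ hℓ
  · exact h4

/-- The body of the loop over the levels: the edge is colored or proceeds to the next level. -/
lemma level_step (hf : Fits E lg S D T) (hl : Levels E lg L S D T) (he1 : e.1 < E.n)
    (he2 : e.2 < E.n) (hs : ∀ k, s k < D) (hd : ∀ w, hdeg (e :: H) w ≤ E.Δ)
    (hg : AllGood D S E.Δ s L (e :: H)) {t : State 8}
    (hr : Reached E lg L S D T s H e ℓ st t) (hℓ : ℓ < L) :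
    Runs E levelBody t fun t' => Reached E lg L S D T s H e (ℓ + 1) st t' ∨
      (Colored E lg L S D T s H e st t' ∧ t'.mem 2 9 = 1) := by
  obtain ⟨hp, ht, ha, h9, h5, hin, hout, -, hhist, hcol⟩ := hr
  have hsuf : hist D S E.Δ s ℓ H <:+ hist D S E.Δ s ℓ (e :: H) :=
    hist_suffix (List.suffix_cons _ _) ℓ
  have hb := hl.base_le hf (show ℓ + 1 ≤ L from hℓ)
  refine (levelBody_runs hf hp ht ha hℓ hl.le he1 he2 (by omega) (hl.palettes_le ℓ hℓ) hs h9
    ?_ ?_).mono fun t' ht' => ?_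
  · intro w
    rw [if_neg (lt_irrefl ℓ)]
    exact (hdeg_mono hsuf.sublist w).trans (hdeg_hist_le hd (fun j hj => hg j (hj.trans hℓ)) w)
  · intro u x
    rw [if_neg (lt_irrefl ℓ)]
    exact (leafCount_mono hsuf u x).trans ((hg ℓ hℓ).1 u x)
  obtain ⟨hp', ht', h5', hin', hsucc, hfail⟩ := ht'
  rw [if_neg (lt_irrefl ℓ)] at ht' hsucc hfail
  by_cases hok : Succeeds D S (palettes S E.Δ ℓ) (fun p => s (ℓ, p)) (hist D S E.Δ s ℓ H) e
  · obtain ⟨-, h9', hout'⟩ := hsucc hok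
    have hnext : hist D S E.Δ s (ℓ + 1) (e :: H) = hist D S E.Δ s (ℓ + 1) H := by
      rw [hist, hhist, leftover, if_pos hok, hist]
    refine Or.inr ⟨⟨hp', ?_, h5'.trans h5, hin'.trans hin, ?_⟩, h9'⟩
    · rw [hist_eq_of_le hℓ hnext]
      refine ht'.congr fun j hj => ?_
      rcases lt_trichotomy j ℓ with hjℓ | rfl | hjℓ
      · rw [Function.update_of_ne hjℓ.ne, if_pos hjℓ]
      · rw [Function.update_self, hhist]
      · rw [Function.update_of_ne hjℓ.ne', if_neg (by omega), hist_eq_of_le hjℓ hnext]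
    · rw [hout', hout, hcol, show L - ℓ = L - (ℓ + 1) + 1 by omega, colorFrom, if_pos hok]
  · obtain ⟨ha', h9', hout'⟩ := hfail hok
    refine Or.inl ⟨hp', ?_, ha', h9', h5'.trans h5, hin'.trans hin, hout'.trans hout, hℓ, ?_, ?_⟩
    · refine ht'.congr fun j hj => ?_
      rcases lt_trichotomy j ℓ with hjℓ | rfl | hjℓ
      · rw [Function.update_of_ne hjℓ.ne, if_pos hjℓ, if_pos (by omega)]
      · rw [Function.update_self, if_pos (by omega), hhist]
      · rw [Function.update_of_ne hjℓ.ne', if_neg (by omega), if_neg (by omega)]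
    · rw [hist, hhist, leftover, if_neg hok, hist]
    · rw [hcol, show L - ℓ = L - (ℓ + 1) + 1 by omega, colorFrom, if_neg hok, hist]

/-- An edge passes through the levels until one of them colors it, or else is colored greedily. -/
lemma edgeBody_runs (hf : Fits E lg S D T) (hl : Levels E lg L S D T) (he1 : e.1 < E.n)
    (he2 : e.2 < E.n) (hs : ∀ k, s k < D) (hd : ∀ w, hdeg (e :: H) w ≤ E.Δ)
    (hg : AllGood D S E.Δ s L (e :: H)) (hp : Params E lg S D T s st.mem)
    (ht : Tables E L S D T s (fun j => hist D S E.Δ s j H) (hist D S E.Δ s L H) st.mem)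
    (h0 : st.mem 0 0 = e.1) (h1 : st.mem 1 0 = e.2) :
    Runs E edgeBody st (Colored E lg L S D T s H e st) := by
  have h20 := hf.scalars
  have hB := hf.words
  have hT := hf.greedy
  have hB' := hB
  generalize hBe : 2 ^ E.bits = B at hB'
  have hTc : T ≤ E.cells :=
    (show T ≤ 2 * T by omega).trans ((Nat.le_mul_of_pos_left _ (by omega)).trans hf.greedy)
  refine Runs.seq (Runs.assign hf (v := E.Δ) (by norm_num) (by simp [hBe]; omega) (by simp)
    (by omega) ?_)
  refine Runs.seq (Runs.assign hf (v := 0) (by norm_num) (by simp [hBe]; omega) (by simp)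
    (by omega) ?_)
  refine Runs.seq (Runs.assign hf (v := 0) (by norm_num) (by simp [hBe]; omega) (by simp)
    (by omega) ?_)
  refine Runs.seq (Runs.assign hf (v := 0) (by norm_num) (by simp [hBe]; omega) (by simp)
    (by omega) ?_)
  dsimp only
  have hstart : Reached E lg L S D T s H e 0 st { st with
      mem := (upd (upd (upd (upd st.mem 2 6 E.Δ) 2 7 0) 2 8 0) 2 9 0) } := by
    refine ⟨?_, ?_, ?_, by simp [upd_apply], by simp [upd_apply], rfl, rfl, Nat.zero_le _, rfl, rfl⟩
    · exact (((hp.upd_scalar (i := 6) _ (by norm_num)).upd_scalar (i := 7) _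
        (by norm_num)).upd_scalar (i := 8) _ (by norm_num)).upd_scalar (i := 9) _ (by norm_num)
    · simpa using (((ht.upd_scalar _ _).upd_scalar _ _).upd_scalar _ _).upd_scalar _ _
    · constructor <;> simp [upd_apply, h0, h1, levelDeg, base]
  refine Runs.seq (Runs.loop (k := L + 1) (fun k t =>
    (∃ ℓ, k = L - ℓ + 1 ∧ Reached E lg L S D T s H e ℓ st t) ∨
      (k = 0 ∧ Colored E lg L S D T s H e st t ∧ t.mem 2 9 = 1)) ?_ ?_ ?_
      (Or.inl ⟨0, rfl, hstart⟩))
  · rintro k t (⟨ℓ, -, hr⟩ | ⟨-, hc, h9⟩)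
    · by_cases hlt : t.mem 2 3 < t.mem 2 6 <;> simp [hBe, hr.done, hlt] <;> omega
    · by_cases hlt : t.mem 2 3 < t.mem 2 6 <;> simp [hBe, h9, hlt] <;> omega
  · rintro k t (⟨ℓ, -, hr⟩ | ⟨-, hc, h9⟩) hval
    · -- no level colors the edge
      have hval' : ¬ T < levelDeg E.Δ ℓ := by
        intro hlt
        simp [hr.done, hr.level.degree, hr.params.threshold, hlt] at hval
      have hℓ : ℓ = L := by
        by_contra hne
        exact hval' (hl.active ℓ (lt_of_le_of_ne hr.le hne))
      subst hℓ
      refine Runs.ite (by simp [hBe]; omega) (fun hx => ?_) (fun _ => ?_)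
      · simp [hr.done] at hx
      have hdeg : ∀ w, hdeg (e :: hist D S E.Δ s ℓ H) w ≤ levelDeg E.Δ ℓ := by
        intro w
        rw [← hr.hist_eq]
        exact hdeg_hist_le hd hg w
      refine (greedy_runs hf hr.params hr.tables hr.level he1 he2 hl.degree_le (hl.base_le hf le_rfl)
        hdeg).mono fun t' ht' => ?_
      obtain ⟨hp', ht', h5', hin', hout'⟩ := ht'
      refine ⟨hp', ?_, h5'.trans hr.flag, hin'.trans hr.input, ?_⟩
      · rw [hr.hist_eq]
        exact ht'.congr fun j hj => if_pos hj
      · rw [hout', hr.output, hr.color_eq, Nat.sub_self, colorFrom]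
    · refine Runs.ite (by simp [hBe]; omega) (fun hx => Runs.skip hc) (fun hx => ?_)
      simp [h9] at hx
  · rintro k t (⟨ℓ, rfl, hr⟩ | ⟨-, hc, h9⟩) hval
    · have hℓ : ℓ < L := by
        by_contra hne
        have hℓL : ℓ = L := le_antisymm hr.le (not_lt.1 hne)
        have := hl.degree_le
        subst hℓL
        simp [hr.done, hr.level.degree, hr.params.threshold] at hval
        omega
      refine (level_step hf hl he1 he2 hs hd hg hr hℓ).mono fun t' ht' => ?_
      rcases ht' with hr' | hc'
      · exact ⟨L - (ℓ + 1) + 1, by omega, Or.inl ⟨ℓ + 1, rfl, hr'⟩⟩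
      · exact ⟨0, by omega, Or.inr ⟨rfl, hc'⟩⟩
    · simp [h9] at hval

/-- If all levels have the favorable outcome for the stream `F` (in reverse order), then the main
loop reports the coloring `outputOf`. -/
lemma mainLoop_runs (hf : Fits E lg S D T) (hl : Levels E lg L S D T) (hs : ∀ k, s k < D)
    {F : List (ℕ × ℕ)} (hF : ∀ e ∈ F, e.1 < E.n ∧ e.2 < E.n) (hd : ∀ w, hdeg F w ≤ E.Δ)
    (hg : AllGood D S E.Δ s L F) (hp : Params E lg S D T s st.mem)
    (ht : Tables E L S D T s (fun _ => []) [] st.mem) (hin : st.input = F.reverse)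
    (hout : st.output = []) :
    Runs E mainLoop st fun t => t.output = outputOf D S E.Δ s L F := by
  have h20 := hf.scalars
  have hB := hf.words
  have hn := hf.n_le
  have hB' := hB
  generalize hBe : 2 ^ E.bits = B at hB'
  have hnil : ∀ j, hist D S E.Δ s j [] = [] := fun j => List.sublist_nil.1 (hist_sublist j)
  refine Runs.seq (Runs.assign hf (v := 1) (by norm_num) (by simp [hBe]; omega) (by simp)
    (by omega) ?_)
  refine Runs.loop (k := F.length + 1) (fun k t =>
    (t.mem 2 5 = 0 ∧ k = 0 ∧ t.output = outputOf D S E.Δ s L F) ∨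
    (t.mem 2 5 = 1 ∧ ∃ H, H <:+ F ∧ H.reverse ++ t.input = F.reverse ∧ k = t.input.length + 1 ∧
      Params E lg S D T s t.mem ∧
      Tables E L S D T s (fun j => hist D S E.Δ s j H) (hist D S E.Δ s L H) t.mem ∧
      t.output = outputOf D S E.Δ s L H)) ?_ ?_ ?_ (Or.inr ?_)
  · rintro k t -
    simp [hBe]
    omega
  · rintro k t (⟨-, -, h⟩ | ⟨h5, -⟩) h0
    · exact h
    · simp [h5] at h0
  · rintro k t (⟨h5, -⟩ | ⟨hflag, H, hHF, hrev, rfl, hp', ht', hout'⟩) h0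
    · simp [h5] at h0
    rcases hinp : t.input with _ | ⟨⟨u, v⟩, rest⟩
    · refine Runs.next_nil hinp (Runs.assign hf (v := 0) (by norm_num) (by simp [hBe]; omega)
        (by simp) (by omega) ⟨0, Nat.succ_pos _, Or.inl ⟨by simp [upd_apply], rfl, ?_⟩⟩)
      rw [hinp, List.append_nil, List.reverse_inj] at hrev
      rw [hout', hrev]
    · have hsuf : (u, v) :: H <:+ F := by
        rw [hinp] at hrev
        refine ⟨rest.reverse, ?_⟩
        have := congrArg List.reverse hrev
        simpa using this
      have huv := hF _ (hsuf.subset List.mem_cons_self)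
      have hmem : ∀ m, m = upd (upd t.mem 0 0 u) 1 0 v → Params E lg S D T s m ∧
          Tables E L S D T s (fun j => hist D S E.Δ s j H) (hist D S E.Δ s L H) m ∧
          m 0 0 = u ∧ m 1 0 = v := by
        rintro _ rfl
        refine ⟨(hp'.upd_array _ _ (by decide)).upd_array _ _ (by decide), ?_,
          by simp [upd_apply], by simp [upd_apply]⟩
        obtain ⟨t1, t2, t3, t4⟩ := ht'
        constructor <;> simpa [upd_apply]
      obtain ⟨q1, q2, q3, q4⟩ := hmem _ rfl
      have h5 : upd (upd t.mem 0 0 u) 1 0 v 2 5 = t.mem 2 5 := by simp [upd_apply]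
      refine Runs.next_cons hinp (by omega) (by omega) (by omega) ?_
      refine (edgeBody_runs (e := (u, v)) hf hl huv.1 huv.2 hs
        (fun w => (hdeg_mono hsuf.sublist w).trans (hd w)) (fun j hj => ?_) q1 q2 q3 q4).mono
        fun t' ht' => ?_
      · have hj' := hg j hj
        have hsj : hist D S E.Δ s j ((u, v) :: H) <:+ hist D S E.Δ s j F := hist_suffix hsuf j
        exact ⟨fun a x => (leafCount_mono hsj a x).trans (hj'.1 a x), fun w =>
          (Nat.mul_le_mul_left 8 (hdeg_mono (leftover_suffix hsj).sublist w)).trans (hj'.2 w)⟩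
      · obtain ⟨r1, r2, r3, r4, r5⟩ := ht'
        dsimp only at r3 r4 r5
        refine ⟨t'.input.length + 1, by rw [r4]; simp, Or.inr ⟨by rw [r3, h5, hflag], (u, v) :: H,
          hsuf, ?_, rfl, r1, r2, ?_⟩⟩
        · rw [r4, ← hrev, hinp]; simp
        · rw [r5, hout']; rfl
  · refine ⟨by simp [upd_apply], [], List.nil_suffix, ?_, ?_, ?_, ?_, ?_⟩
    · simpa using hin
    · simp [hin]
    · exact hp.upd_scalar _ (by norm_num)
    · simp only [hnil]
      exact ht.upd_scalar _ _
    · exact hout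

end Stream

/-! ### The parameters and the random table -/

section Setup

variable {E : Env} {K lg L S D T : ℕ} {s : ℕ × ℕ × ℕ → ℕ} {st : State 8} {A : State 8 → Prop}

/-- The state `t` differs from the initial state `st` in scalar variables only. -/
structure Fresh (st t : State 8) : Prop where
  arrays : ∀ a ≠ 2, ∀ i, t.mem a i = 0
  counter : t.mem 2 4 = 0
  input : t.input = st.input
  output : t.output = st.output

lemma Fresh.upd_scalar {t : State 8} (h : Fresh st t) {i : ℕ} (v : ℕ) (hi : i ≠ 4) :
    Fresh st { t with mem := upd t.mem 2 i v } := by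
  obtain ⟨h1, h2, h3, h4⟩ := h
  refine ⟨fun a ha j => ?_, ?_, h3, h4⟩
  · simp [upd_apply, ha, h1]
  · simp [upd_apply, hi.symm, h2]

/-- The program computes the parameters; `S` is characterized as the least number with
`Δ * (K * log n) ^ 2 ≤ S ^ 2`. -/
lemma computeParams_runs (hf : Fits E (Nat.clog 2 E.n) S D T) (hst : ∀ a i, st.mem a i = 0)
    (hn : 2 ≤ E.n) (hK : 0 < K) (hT : T = 2048 * (K * (S * Nat.clog 2 E.n)))
    (hS : E.Δ * ((K * Nat.clog 2 E.n) * (K * Nat.clog 2 E.n)) ≤ S * S)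
    (hmin : ∀ S' < S, S' * S' < E.Δ * ((K * Nat.clog 2 E.n) * (K * Nat.clog 2 E.n)))
    (hSb : S * S < 2 ^ E.bits) (hKb : K * Nat.clog 2 E.n * (K * Nat.clog 2 E.n) < 2 ^ E.bits) :
    Runs E (computeParams K) st fun t => Fresh st t ∧ t.mem 2 0 = Nat.clog 2 E.n ∧
      t.mem 2 2 = S ∧ t.mem 2 3 = T ∧ t.mem 2 18 = D := by
  have hlg : 0 < Nat.clog 2 E.n := Nat.clog_pos (by norm_num) hn
  have h20 := hf.scalars
  have hB := hf.words
  have hS0 := hf.S_pos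
  have hD := hf.D_eq
  have hTc : 4 * T ≤ 2 * E.cells := by
    have := (Nat.mul_le_mul_right (2 * T) hn).trans hf.greedy
    omega
  have hDc : D ≤ E.cells := (Nat.le_mul_of_pos_left _ (by positivity)).trans hf.table
  have hnc := hf.n_le
  have h1 : S * Nat.clog 2 E.n ≤ K * (S * Nat.clog 2 E.n) := Nat.le_mul_of_pos_left _ hK
  have h2 : Nat.clog 2 E.n ≤ S * Nat.clog 2 E.n := Nat.le_mul_of_pos_left _ hS0
  have h3 : S ≤ S * Nat.clog 2 E.n := Nat.le_mul_of_pos_right _ hlg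
  have h4 : K ≤ K * (S * Nat.clog 2 E.n) := Nat.le_mul_of_pos_right _ (by positivity)
  have h5 : K * Nat.clog 2 E.n ≤ K * (S * Nat.clog 2 E.n) := Nat.mul_le_mul_left K h2
  generalize hl : Nat.clog 2 E.n = lg at *
  generalize hX : E.Δ * ((K * lg) * (K * lg)) = X at *
  generalize hBe : 2 ^ E.bits = B at *
  have hst' : Fresh st st := ⟨fun a _ i => hst a i, hst _ _, rfl, rfl⟩
  refine Runs.seq (Runs.assign hf (v := 1) (by norm_num) (by simp [hBe]; omega) (by simp)
    (by omega) ?_)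
  refine Runs.seq (Runs.loop (k := lg) (fun k t => ∃ j, k = lg - j ∧ j ≤ lg ∧ Fresh st t ∧
    t.mem 2 0 = j ∧ t.mem 2 1 = 2 ^ j ∧ t.mem 2 2 = 0) ?_ ?_ ?_ ⟨0, by simp, by omega,
      hst'.upd_scalar _ (by norm_num), by simp [upd_apply, hst], by simp [upd_apply],
      by simp [upd_apply, hst]⟩)
  · rintro k t ⟨j, -, -, -, -, h⟩
    by_cases hlt : t.mem 2 1 < E.n <;> simp [hBe, hlt] <;> omega
  · -- the search for the phase length
    rintro k t ⟨j, -, hj, hfr, h0, hp, hS2⟩ hval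
    have hnj : E.n ≤ 2 ^ j := by
      by_contra hlt
      simp [hp, not_le.1 hlt] at hval
    have hjl : j = lg := le_antisymm hj (by rw [← hl]; exact Nat.clog_le_of_le_pow hnj)
    subst hjl
    refine Runs.seq (Runs.loop (k := S) (fun k t => ∃ i, k = S - i ∧ i ≤ S ∧ Fresh st t ∧
      t.mem 2 0 = j ∧ t.mem 2 2 = i) ?_ ?_ ?_ ⟨0, rfl, by omega, hfr, h0, hS2⟩)
    · rintro k t ⟨i, -, hi, -, h0, hi'⟩
      have := Nat.mul_le_mul hi hi
      by_cases hlt : i * i < X <;> simp [hBe, h0, hi', hX, hlt] <;> omega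
    · rintro k t ⟨i, -, hi, hfr, h0, hi'⟩ hval
      have hiS : i = S := by
        by_contra hne
        simp [h0, hi', hX, hmin i (by omega)] at hval
      subst hiS
      refine Runs.seq (Runs.assign hf (v := D) (by norm_num) (by simp [hBe, hi']; omega)
        (by simp [hi', hD]) (by omega) ?_)
      refine Runs.assign hf (v := T) (by norm_num)
        (by simp [hBe, upd_apply, hi', h0]; omega) (by simp [upd_apply, hi', h0, hT]) (by omega) ?_
      refine ⟨(hfr.upd_scalar (i := 18) D (by norm_num)).upd_scalar _ (by norm_num), ?_⟩
      simp [upd_apply, h0, hi']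
    · rintro k t ⟨i, rfl, hi, hfr, h0, hi'⟩ hval
      have hiX : i * i < X := by
        by_contra hlt
        simp [h0, hi', hX, hlt] at hval
      have hiS : i < S := by
        by_contra hne
        have := Nat.mul_le_mul (not_lt.1 hne) (not_lt.1 hne)
        omega
      refine Runs.assign hf (v := i + 1) (by norm_num) (by simp [hBe, hi']; omega)
        (by simp [hi']) (by omega) ⟨S - (i + 1), by omega, i + 1, rfl, hiS,
          hfr.upd_scalar _ (by norm_num), ?_, ?_⟩
      · simp [upd_apply, h0]
      · simp [upd_apply]
  · rintro k t ⟨j, rfl, hj, hfr, h0, hp, hS2⟩ hval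
    have hnj : 2 ^ j < E.n := by
      by_contra hlt
      simp [hp, hlt] at hval
    have hjl : j < lg := by rw [← hl]; exact (Nat.lt_clog_iff_pow_lt (by norm_num)).2 hnj
    refine Runs.seq (Runs.assign hf (v := 2 ^ (j + 1)) (by norm_num) (by simp [hBe, hp]; omega)
      (by simp [hp, pow_succ]) (by rw [pow_succ]; omega) ?_)
    refine Runs.assign hf (v := j + 1) (by norm_num) (by simp [hBe, upd_apply, h0]; omega)
      (by simp [upd_apply, h0]) (by omega) ⟨lg - (j + 1), by omega, j + 1, rfl, hjl,
        (hfr.upd_scalar (i := 1) _ (by norm_num)).upd_scalar _ (by norm_num), ?_, ?_, ?_⟩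
    all_goals simp [upd_apply, hS2]

/-- The random number that is stored in cell `i` of the table. -/
def cellOf (n D i : ℕ) : ℕ × ℕ × ℕ := (i / D / n, i / D % n, i % D)

lemma cellOf_row {n D ℓ v z : ℕ} (hv : v < n) (hz : z < D) :
    cellOf n D ((ℓ * n + v) * D + z) = (ℓ, v, z) := by
  have hD : 0 < D := by omega
  have hn : 0 < n := by omega
  have h1 : ((ℓ * n + v) * D + z) / D = ℓ * n + v := by
    rw [mul_comm, Nat.mul_add_div hD, Nat.div_eq_of_lt hz, add_zero]
  rw [cellOf, h1, mul_comm ℓ, Nat.mul_add_div hn, Nat.div_eq_of_lt hv, Nat.mul_add_mod,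
    Nat.mod_eq_of_lt hv, mul_comm _ D, Nat.mul_add_mod, Nat.mod_eq_of_lt hz, add_zero]

lemma cellOf_injective (n D : ℕ) : Function.Injective (cellOf n D) := by
  intro i j h
  rw [cellOf, cellOf, Prod.mk.injEq, Prod.mk.injEq] at h
  obtain ⟨h1, h2, h3⟩ := h
  rw [← Nat.div_add_mod i D, ← Nat.div_add_mod (i / D) n, h1, h2, h3, Nat.div_add_mod,
    Nat.div_add_mod]

/-- The state after the first `i` cells of the random table have been filled. -/
structure Filled (lg S D T : ℕ) (F : List (ℕ × ℕ)) (n i : ℕ) (s : ℕ × ℕ × ℕ → ℕ) (t : State 8) :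
    Prop where
  log : t.mem 2 0 = lg
  phase : t.mem 2 2 = S
  threshold : t.mem 2 3 = T
  width : t.mem 2 18 = D
  counter : t.mem 2 4 = i
  table : ∀ j < i, t.mem 3 j = s (cellOf n D j)
  zero : ∀ a, a ≠ 2 → a ≠ 3 → ∀ j, t.mem a j = 0
  input : t.input = F.reverse
  output : t.output = []

open Classical in
/-- The probability of success after `i` cells of the random table have been filled is at least the
average over the remaining `k` cells of the indicator of the favorable tables. -/
lemma fillTable_mainLoop {F : List (ℕ × ℕ)} (hf : Fits E lg S D T) (hl : Levels E lg L S D T)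
    (hF : ∀ e ∈ F, e.1 < E.n ∧ e.2 < E.n) (hd : ∀ w, hdeg F w ≤ E.Δ) (hn : 0 < E.n)
    (hA : ∀ s t, t.output = outputOf D S E.Δ s L F → AllGood D S E.Δ s L F → A t)
    {k i : ℕ} {t : State 8} (hk : i + k = 6 * lg * E.n * D) (hs : ∀ k, s k < D)
    (hfill : Filled lg S D T F E.n i s t) :
    ProbThenGe E fillTable mainLoop t A (avgs D ((List.range' i k).map (cellOf E.n D))
      (fun s => if AllGood D S E.Δ s L F then 1 else 0) s) := by
  have h20 := hf.scalars
  have hB := hf.words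
  have hD : 0 < D := by have := hf.D_eq; have := hf.S_pos; omega
  have hS0 := hf.S_pos
  have htab := hf.table
  have hnc := hf.n_le
  have hi : i ≤ E.cells := by omega
  have h1 : 6 * lg * E.n ≤ 6 * lg * E.n * D := Nat.le_mul_of_pos_right _ hD
  have h2 : 6 * lg ≤ 6 * lg * E.n := Nat.le_mul_of_pos_right _ hn
  induction k generalizing i s t with
  | zero =>
    have hi : i = 6 * lg * E.n * D := by omega
    subst hi
    generalize hBe : 2 ^ E.bits = B at hB
    refine ProbGe.loop_done ?_ ?_ ?_
    · simp [hfill.counter, hfill.log, hfill.width, hBe]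
      omega
    · simp [hfill.counter, hfill.log, hfill.width]
    · rw [List.range'_zero, List.map_nil, avgs_nil]
      split_ifs with hg
      · refine ((mainLoop_runs hf hl hs hF hd hg ⟨hfill.log, hfill.phase, hfill.threshold,
          hfill.width, fun ℓ hℓ v hv z hz => ?_⟩ ?_ hfill.input hfill.output).mono
          fun t' ht' => hA s t' ht' hg).probGe
        · rw [hfill.table _ (row_lt (row_lt hℓ hv le_rfl) hz le_rfl), cellOf_row hv hz]
        · constructor
          · intro ℓ hℓ v hv
            rw [hfill.zero 4 (by decide) (by decide)]; rfl
          · intro ℓ hℓ v hv x hx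
            rw [hfill.zero 5 (by decide) (by decide)]; rfl
          · intro ℓ hℓ v hv x hx
            rw [hfill.zero 6 (by decide) (by decide)]; rfl
          · intro v hv x hx
            rw [hfill.zero 7 (by decide) (by decide)]; rfl
      · exact ProbGe.of_nonpos le_rfl
  | succ k ih =>
    have hDc : D ≤ E.cells := by
      rcases Nat.eq_zero_or_pos (6 * lg * E.n) with h0 | h0
      · rw [h0] at hk; omega
      · exact (Nat.le_mul_of_pos_left _ h0).trans hf.table
    rw [List.range'_succ, List.map_cons, avgs_cons]
    generalize hBe : 2 ^ E.bits = B at hB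
    have hlt : i < 6 * lg * E.n * D := by omega
    refine ProbThenGe.loop_rand (j := i) ?_ ?_ ?_ ?_ (by omega) ?_ (D := D) ?_ hD (by omega)
      fun y hy => ?_
    · simp [hfill.counter, hfill.log, hfill.width, hBe, hlt]
      omega
    · simp [hfill.counter, hfill.log, hfill.width, hlt]
    · simp [hBe]; omega
    · simp [hfill.counter]
    · simp [hBe]; omega
    · simp [hfill.width]
    · refine Runs.assign hf (v := i + 1) (by norm_num)
        (by simp [hBe, upd_apply, hfill.counter]; omega) (by simp [upd_apply, hfill.counter])
        (by omega) ?_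
      refine ih (by omega) (fun c => ?_) ?_ (by omega)
      · rw [Function.update_apply]
        split_ifs
        · exact hy
        · exact hs c
      · obtain ⟨h1, h2, h3, h4, h5, h6, h7, h8, h9⟩ := hfill
        refine ⟨by simpa [upd_apply], by simpa [upd_apply], by simpa [upd_apply],
          by simpa [upd_apply], by simp [upd_apply], fun j hj => ?_, fun a ha2 ha3 j => ?_, h8, h9⟩
        · rcases (Nat.lt_succ_iff_lt_or_eq.1 hj) with hji | rfl
          · rw [Function.update_of_ne ((cellOf_injective E.n D).ne hji.ne)]
            simpa [upd_apply, hji.ne] using h6 j hji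
          · simp [upd_apply]
        · simpa [upd_apply, ha2, ha3] using h7 a ha2 ha3 j

open Classical in
/-- The program reports the coloring `outputOf` of a favorable random table, and so succeeds, except
with the probability bounded in `le_avgs_allGood`. -/
lemma program_probGe {F : List (ℕ × ℕ)} (hf : Fits E (Nat.clog 2 E.n) S D T)
    (hl : Levels E (Nat.clog 2 E.n) L S D T)
    (hn : 2 ≤ E.n) (hK : 0 < K) (hT : T = 2048 * (K * (S * Nat.clog 2 E.n)))
    (hS : E.Δ * ((K * Nat.clog 2 E.n) * (K * Nat.clog 2 E.n)) ≤ S * S)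
    (hmin : ∀ S' < S, S' * S' < E.Δ * ((K * Nat.clog 2 E.n) * (K * Nat.clog 2 E.n)))
    (hSb : S * S < 2 ^ E.bits) (hKb : K * Nat.clog 2 E.n * (K * Nat.clog 2 E.n) < 2 ^ E.bits)
    (hΔ : 0 < E.Δ) (hF : SimpleHist E.n F) (hd : ∀ w, hdeg F w ≤ E.Δ)
    (hA : ∀ s t, t.output = outputOf D S E.Δ s L F → AllGood D S E.Δ s L F → A t)
    (hst : ∀ a i, st.mem a i = 0) (hin : st.input = F.reverse) (hout : st.output = []) :
    ProbGe E (program K) st A (1 - ∑ ℓ ∈ Finset.range L,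
      (E.n * palettes S E.Δ ℓ + 3 * E.n) * Real.exp (-(K * Nat.clog 2 E.n : ℕ))) := by
  have hF' : ∀ e ∈ F, e.1 < E.n ∧ e.2 < E.n := fun e he => ⟨(hF.2 e he).1, (hF.2 e he).2.1⟩
  have hD : 0 < D := by have := hf.D_eq; have := hf.S_pos; omega
  refine ProbGe.seq ((computeParams_runs hf hst hn hK hT hS hmin hSb hKb).mono
    fun t ⟨hfr, h0, h2, h3, h18⟩ => ProbThenGe.seq ?_)
  have hfill := fillTable_mainLoop (s := fun _ => 0) (t := t) (i := 0) hf hl hF' hd (by omega) hA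
    (zero_add _) (fun _ => hD) ⟨h0, h2, h3, h18, hfr.counter, by simp,
      fun a h _ j => hfr.arrays a h j, hfr.input.trans hin, hfr.output.trans hout⟩
  obtain ⟨N, hN⟩ := hfill
  refine ⟨N, fun f hf₁ f' hf₂ => le_trans ?_ (hN f hf₁ f' hf₂)⟩
  refine le_avgs_allGood hf.S_pos hf.D_eq ?_ hl.palettes_le hF hd ?_ ?_ _
  · intro ℓ hℓ v hv z hz
    rw [List.mem_map]
    refine ⟨(ℓ * E.n + v) * D + z, ?_, cellOf_row hv hz⟩
    rw [List.mem_range'_1]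
    exact ⟨Nat.zero_le _, by
      rw [zero_add]
      exact row_lt (row_lt (hℓ.trans_le hl.le) hv le_rfl) hz le_rfl⟩
  · rw [Nat.cast_le]
    refine Nat.mul_self_le_mul_self_iff.1 (le_trans ?_ hS)
    exact Nat.le_mul_of_pos_left _ hΔ
  · intro ℓ hℓ
    have := (hl.active ℓ hℓ).le
    rw [hT] at this
    refine le_trans (le_of_eq ?_) (Nat.cast_le.2 this)
    push_cast
    ring

end Setup

/-! ### From the output to an edge coloring -/

section Output

variable {n D S Δ L K : ℕ} {s : ℕ × ℕ × ℕ → ℕ} {F : List (ℕ × ℕ)}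

lemma mem_outputOf {x : ℕ × ℕ × ℕ} : x ∈ outputOf D S Δ s L F ↔
    ∃ e h, e :: h <:+ F ∧ x = (e.1, e.2, colorFrom D S Δ s L 0 h e) := by
  induction F with
  | nil => simp [outputOf]
  | cons e F ih =>
    rw [outputOf, List.mem_append, ih, List.mem_singleton]
    constructor
    · rintro (⟨e', h, h1, rfl⟩ | rfl)
      · exact ⟨e', h, h1.trans (List.suffix_cons _ _), rfl⟩
      · exact ⟨e, F, List.suffix_rfl, rfl⟩
    · rintro ⟨e', h, h1, rfl⟩
      rcases List.suffix_cons_iff.1 h1 with h2 | h2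
      · rw [List.cons.injEq] at h2
        obtain ⟨rfl, rfl⟩ := h2
        exact Or.inr rfl
      · exact Or.inl ⟨e', h, h2, rfl⟩

lemma map_outputOf : (outputOf D S Δ s L F).map (fun t => s(t.1, t.2.1)) =
    (F.map fun e => s(e.1, e.2)).reverse := by
  induction F with
  | nil => rfl
  | cons e F ih => simp [outputOf, ih]

/-- If all levels have the favorable outcome, then the output describes an edge coloring. -/
lemma reportsEdgeColoring_outputOf {G : SimpleGraph (Fin n)} (hS : 0 < S) (hD : 0 < D)
    (hF : SimpleHist n F)
    (hG : ∀ e : Sym2 (Fin n), e ∈ G.edgeSet → ∃ p ∈ F,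
      s(p.1, p.2) = Sym2.map (fun v : Fin n => (v : ℕ)) e)
    (hG' : ∀ p ∈ F, ∃ e ∈ G.edgeSet, s(p.1, p.2) = Sym2.map (fun v : Fin n => (v : ℕ)) e)
    (hd : ∀ w, hdeg F w ≤ Δ) (hg : AllGood D S Δ s L F)
    (hK : base D S Δ L + 2 * levelDeg Δ L ≤ K) :
    ReportsEdgeColoring G K (outputOf D S Δ s L F) := by
  set O := outputOf D S Δ s L F with hO
  have hnd : (O.map fun t => s(t.1, t.2.1)).Nodup := by
    rw [map_outputOf]
    exact List.nodup_reverse.2 hF.1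
  have huniq : ∀ x ∈ O, ∀ y ∈ O, s(x.1, x.2.1) = s(y.1, y.2.1) → x = y := fun x hx y hy hxy =>
    List.inj_on_of_nodup_map hnd hx hy hxy
  have hcol : ∀ x ∈ O, x.2.2 < K := by
    intro x hx
    obtain ⟨e, h, hsuf, rfl⟩ := mem_outputOf.1 hx
    have := colorFrom_lt (ℓ := 0) (k := L) hD hd (by simpa using hg) hsuf
    rw [zero_add] at this
    dsimp only
    omega
  have hex : ∀ e : G.edgeSet, ∃ x ∈ O, s(x.1, x.2.1) = Sym2.map (fun v : Fin n => (v : ℕ)) e := by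
    intro e
    obtain ⟨p, hp, hpe⟩ := hG e e.2
    have : s(p.1, p.2) ∈ O.map (fun t => s(t.1, t.2.1)) := by
      rw [map_outputOf, List.mem_reverse]
      exact List.mem_map_of_mem hp
    obtain ⟨x, hx, hxp⟩ := List.mem_map.1 this
    exact ⟨x, hx, hxp.trans hpe⟩
  choose rep hrep hrepe using hex
  have hinj : Function.Injective (Sym2.map (fun v : Fin n => (v : ℕ))) :=
    Sym2.map.injective Fin.val_injective
  refine ⟨SimpleGraph.Coloring.mk (fun e => ⟨(rep e).2.2, hcol _ (hrep e)⟩) ?_, ?_, ?_⟩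
  · -- edges with a common endpoint have different colors
    intro e e' hadj hc
    rw [Fin.mk.injEq] at hc
    rw [SimpleGraph.lineGraph_adj_iff_exists] at hadj
    obtain ⟨hne, v, hv, hv'⟩ := hadj
    obtain ⟨p, h, hsuf, hp⟩ := mem_outputOf.1 (hrep e)
    obtain ⟨p', h', hsuf', hp'⟩ := mem_outputOf.1 (hrep e')
    have hpe := hrepe e
    have hpe' := hrepe e'
    rw [hp] at hpe hc
    rw [hp'] at hpe' hc
    dsimp only at hpe hpe' hc
    have hend : ∀ {p : ℕ × ℕ} {e : G.edgeSet},
        s(p.1, p.2) = Sym2.map (fun v : Fin n => (v : ℕ)) e → v ∈ (e : Sym2 (Fin n)) →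
        p.1 = (v : ℕ) ∨ p.2 = (v : ℕ) := by
      intro p e hpe hv
      have : (v : ℕ) ∈ s(p.1, p.2) := by
        rw [hpe]
        exact Sym2.mem_map.2 ⟨v, hv, rfl⟩
      rw [Sym2.mem_iff] at this
      exact this.imp Eq.symm Eq.symm
    have hg' : AllGood D S Δ s (0 + L) F := by simpa using hg
    rcases List.suffix_or_suffix_of_suffix hsuf hsuf' with h1 | h1
    · rcases List.suffix_cons_iff.1 h1 with h2 | h2
      · rw [List.cons.injEq] at h2
        exact hne (Subtype.ext (hinj (by rw [← hpe, ← hpe', h2.1])))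
      · exact colorFrom_ne hS hD hd hg' hsuf' h2 (hend hpe' hv') (hend hpe hv) hc.symm
    · rcases List.suffix_cons_iff.1 h1 with h2 | h2
      · rw [List.cons.injEq] at h2
        exact hne (Subtype.ext (hinj (by rw [← hpe, ← hpe', h2.1])))
      · exact colorFrom_ne hS hD hd hg' hsuf h2 (hend hpe hv) (hend hpe' hv') hc
  · refine List.Nodup.of_map Prod.fst ?_
    rwa [List.map_map]
  · intro x
    constructor
    · intro hx
      obtain ⟨y, hy, rfl⟩ := List.mem_map.1 hx
      obtain ⟨p, h, hsuf, hyp⟩ := mem_outputOf.1 hy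
      obtain ⟨e, he, hpe⟩ := hG' p (hsuf.subset List.mem_cons_self)
      refine ⟨⟨e, he⟩, ?_⟩
      have hyr : y = rep ⟨e, he⟩ := huniq y hy _ (hrep _) (by rw [hrepe, hyp]; exact hpe)
      rw [Prod.mk.injEq]
      exact ⟨by rw [hyp]; exact hpe, by rw [hyr]; rfl⟩
    · rintro ⟨e, rfl⟩
      exact List.mem_map.2 ⟨rep e, hrep e, by rw [hrepe]; rfl⟩

end Output

/-! ### The stream as a history -/

section History

variable {n : ℕ} {G : SimpleGraph (Fin n)} {σ : List (Fin n × Fin n)}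

/-- The edges of a stream in reverse order, with natural numbers as vertices. -/
def history (σ : List (Fin n × Fin n)) : List (ℕ × ℕ) :=
  (σ.map fun p => ((p.1 : ℕ), (p.2 : ℕ))).reverse

lemma mem_history {q : ℕ × ℕ} :
    q ∈ history σ ↔ ∃ p ∈ σ, ((p.1 : ℕ), (p.2 : ℕ)) = q := by
  rw [history, List.mem_reverse, List.mem_map]

lemma IsEdgeStream.mem_edgeSet (hσ : IsEdgeStream G σ) {p : Fin n × Fin n} (hp : p ∈ σ) :
    s(p.1, p.2) ∈ G.edgeSet :=
  (hσ.2 _).1 (List.mem_map_of_mem hp)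

lemma IsEdgeStream.simpleHist (hσ : IsEdgeStream G σ) : SimpleHist n (history σ) := by
  refine ⟨?_, fun q hq => ?_⟩
  · rw [history, List.map_reverse, List.nodup_reverse, List.map_map]
    have := hσ.1.map (Sym2.map.injective (Fin.val_injective (n := n)))
    rw [List.map_map] at this
    exact this
  · obtain ⟨p, hp, rfl⟩ := mem_history.1 hq
    exact ⟨p.1.2, p.2.2, fun h => (hσ.mem_edgeSet hp).ne (Fin.ext h)⟩

lemma IsEdgeStream.hdeg_le [DecidableRel G.Adj] (hσ : IsEdgeStream G σ) (w : ℕ) :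
    hdeg (history σ) w ≤ G.maxDegree := by
  rw [hdeg, history, List.countP_reverse, List.countP_map]
  by_cases hw : w < n
  · refine le_trans ?_ (G.degree_le_maxDegree ⟨w, hw⟩)
    rw [List.countP_eq_length_filter, ← G.card_incidenceFinset_eq_degree]
    have hnd := hσ.1.sublist ((List.filter_sublist (p := ((fun e : ℕ × ℕ =>
      decide (e.1 = w ∨ e.2 = w)) ∘ fun p : Fin n × Fin n => ((p.1 : ℕ), (p.2 : ℕ))))).map
      fun p => s(p.1, p.2))
    rw [← List.length_map (f := fun p : Fin n × Fin n => s(p.1, p.2)),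
      ← List.toFinset_card_of_nodup hnd]
    refine Finset.card_le_card fun e he => ?_
    rw [List.mem_toFinset, List.mem_map] at he
    obtain ⟨p, hp, rfl⟩ := he
    rw [List.mem_filter] at hp
    rw [SimpleGraph.mem_incidenceFinset]
    refine ⟨hσ.mem_edgeSet hp.1, ?_⟩
    have h2 := of_decide_eq_true hp.2
    rw [Sym2.mem_iff]
    exact h2.imp (fun h => Fin.ext h.symm) (fun h => Fin.ext h.symm)
  · refine le_trans (le_of_eq ?_) (Nat.zero_le _)
    rw [List.countP_eq_zero]
    intro p _
    have h1 := p.1.2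
    have h2 := p.2.2
    simp
    omega

end History

/-! ### The parameters and the failure probability -/

lemma two_mul_levelDeg_le (Δ ℓ : ℕ) : 2 * levelDeg Δ (ℓ + 6) ≤ levelDeg Δ ℓ := by
  simp only [levelDeg]
  omega

lemma two_pow_mul_levelDeg_le (Δ j : ℕ) : 2 ^ j * levelDeg Δ (6 * j) ≤ Δ := by
  induction j with
  | zero => simp [levelDeg]
  | succ j ih =>
    refine le_trans ?_ ih
    rw [pow_succ, mul_assoc]
    exact Nat.mul_le_mul_left _ (two_mul_levelDeg_le Δ (6 * j))

/-- The levels end after `6 * lg` steps at the latest, as six steps halve the degree bound. -/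
lemma exists_levels {E : Env} {lg S D T : ℕ} (hΔ : E.Δ < 2 ^ lg) (hST : S ≤ T)
    (hQ : 2 + (E.Δ / S + 1) ≤ D) : ∃ L, Levels E lg L S D T := by
  have hlast : levelDeg E.Δ (6 * lg) ≤ T := by
    have h := two_pow_mul_levelDeg_le E.Δ lg
    by_contra hlt
    have := Nat.mul_le_mul_left (2 ^ lg) (show 1 ≤ levelDeg E.Δ (6 * lg) by omega)
    omega
  have hex : ∃ L, levelDeg E.Δ L ≤ T := ⟨_, hlast⟩
  refine ⟨Nat.find hex, Nat.find_min' hex hlast, fun ℓ hℓ => not_le.1 (Nat.find_min hex hℓ),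
    Nat.find_spec hex, hST, fun ℓ _ => le_trans ?_ hQ⟩
  have := Nat.div_le_div_right (c := S) (levelDeg_le (Δ := E.Δ) ℓ)
  unfold palettes
  omega

/-- The failure probability: at most `6 * n` levels fail with probability at most
`4 * n ^ 2 * n ^ (-(c + 8))` each. -/
lemma sum_failure_le {n lg L S Δ c : ℕ} (hn : 2 ≤ n) (hΔ : Δ < n) (hlg : n ≤ 2 ^ lg)
    (hlgn : lg ≤ n) (hL : L ≤ 6 * lg) :
    ∑ ℓ ∈ Finset.range L, ((n : ℝ) * palettes S Δ ℓ + 3 * n) * Real.exp (-((c + 8) * lg : ℕ)) ≤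
      1 / (n : ℝ) ^ c := by
  have hn' : (2 : ℝ) ≤ n := by exact_mod_cast hn
  have hexp : Real.exp (-((c + 8) * lg : ℕ)) ≤ 1 / (n : ℝ) ^ (c + 8) := by
    rw [Real.exp_neg, ← one_div]
    refine one_div_le_one_div_of_le (by positivity) ?_
    have h1 : (n : ℝ) ≤ 2 ^ lg := by exact_mod_cast hlg
    have h2 : (2 : ℝ) ≤ Real.exp 1 := by have := Real.add_one_le_exp 1; linarith
    calc (n : ℝ) ^ (c + 8) ≤ (Real.exp 1 ^ lg) ^ (c + 8) := by
          gcongr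
          exact h1.trans (by gcongr)
      _ = Real.exp ((c + 8) * lg : ℕ) := by
          rw [← pow_mul, ← Real.exp_nat_mul, mul_one, mul_comm lg]
  have hterm : ∀ ℓ ∈ Finset.range L,
      ((n : ℝ) * palettes S Δ ℓ + 3 * n) * Real.exp (-((c + 8) * lg : ℕ)) ≤
        4 * n ^ 2 * (1 / (n : ℝ) ^ (c + 8)) := by
    intro ℓ _
    have hp : palettes S Δ ℓ ≤ n := by
      have h1 := Nat.div_le_self (levelDeg Δ ℓ) S
      have h2 := levelDeg_le (Δ := Δ) ℓ
      unfold palettes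
      omega
    have hp' : (palettes S Δ ℓ : ℝ) ≤ n := by exact_mod_cast hp
    refine mul_le_mul ?_ hexp (Real.exp_pos _).le (by positivity)
    nlinarith
  refine (Finset.sum_le_sum hterm).trans ?_
  rw [Finset.sum_const, Finset.card_range, nsmul_eq_mul]
  have hL' : (L : ℝ) ≤ 6 * n := by exact_mod_cast hL.trans (Nat.mul_le_mul_left 6 hlgn)
  have h32 : (32 : ℝ) ≤ n ^ 5 := by
    calc (32 : ℝ) = 2 ^ 5 := by norm_num
      _ ≤ n ^ 5 := by gcongr
  calc (L : ℝ) * (4 * n ^ 2 * (1 / (n : ℝ) ^ (c + 8)))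
      ≤ 6 * n * (4 * n ^ 2 * (1 / (n : ℝ) ^ (c + 8))) := by gcongr
    _ = 24 / n ^ 5 * (1 / (n : ℝ) ^ c) := by
        rw [pow_add]
        field_simp
        norm_num
    _ ≤ 1 * (1 / (n : ℝ) ^ c) := by
        gcongr
        rw [div_le_one (by positivity)]
        linarith
    _ = 1 / (n : ℝ) ^ c := one_mul _

lemma clog_le_self (n : ℕ) : Nat.clog 2 n ≤ n :=
  Nat.clog_le_of_le_pow Nat.lt_two_pow_self.le

lemma clog_two_le_log {n : ℕ} (hn : 2 ≤ n) : (Nat.clog 2 n : ℝ) ≤ 4 * Real.log n := by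
  have hpos : 0 < Nat.clog 2 n := Nat.clog_pos (by norm_num) hn
  have hlt : 2 ^ (Nat.clog 2 n - 1) < n := Nat.pow_pred_clog_lt_self (by norm_num) hn
  have hlog2 := Real.log_two_gt_d9
  have hn0 : (0 : ℝ) < n := by positivity
  have h1 : ((Nat.clog 2 n - 1 : ℕ) : ℝ) * Real.log 2 ≤ Real.log n := by
    rw [← Real.log_pow]
    exact Real.log_le_log (by positivity) (by exact_mod_cast hlt.le)
  have h2 : Real.log 2 ≤ Real.log n := Real.log_le_log (by norm_num) (by exact_mod_cast hn)
  rw [Nat.cast_sub (by omega)] at h1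
  push_cast at h1
  have h3 : (1 : ℝ) ≤ Nat.clog 2 n := by exact_mod_cast hpos
  nlinarith

/-- The number of cells per array: enough for the random table (and the tables of the levels, of at
most the same size), the table of the greedy colors, and the scalar variables. -/
def cellCount (K n lg S : ℕ) : ℕ :=
  6 * lg * n * (64 * S) + n * (2 * (2048 * (K * (S * lg)))) + 20

/-- The constant in the bounds for the memory and the number of colors. -/
def memoryConstant (K : ℕ) : ℕ := 128 * (2 * K * (384 + 4096 * K) + 20)

/-- The constant in the word length. -/
def wordConstant (K : ℕ) : ℕ := 2 * K ^ 2 * (384 + 4096 * K) + K ^ 4 + 1104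

lemma eight_mul_cellCount_le {K n Δ S : ℕ} (hK : 0 < K) (hn : 2 ≤ n) (hΔ : 0 < Δ) (hS : 0 < S)
    (hmin : ∀ S' < S, S' * S' < Δ * ((K * Nat.clog 2 n) * (K * Nat.clog 2 n))) :
    ((8 * cellCount K n (Nat.clog 2 n) S : ℕ) : ℝ) ≤
      memoryConstant K * (n * Real.sqrt Δ) * Real.log n ^ 2 := by
  have hlg : 0 < Nat.clog 2 n := Nat.clog_pos (by norm_num) hn
  have hlog := clog_two_le_log hn
  generalize Nat.clog 2 n = lg at *
  have hlg' : (1 : ℝ) ≤ lg := by exact_mod_cast hlg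
  have hK' : (1 : ℝ) ≤ K := by exact_mod_cast hK
  have hn' : (1 : ℝ) ≤ n := by exact_mod_cast (by omega : 1 ≤ n)
  have hq : (1 : ℝ) ≤ Real.sqrt Δ := Real.one_le_sqrt.2 (by exact_mod_cast hΔ)
  have hqq : Real.sqrt Δ * Real.sqrt Δ = Δ := Real.mul_self_sqrt (by positivity)
  set q := Real.sqrt Δ
  have hS1 : ((S - 1 : ℕ) : ℝ) ≤ K * lg * q := by
    have h := hmin (S - 1) (by omega)
    have h' : (((S - 1) * (S - 1) : ℕ) : ℝ) ≤ ((Δ * ((K * lg) * (K * lg)) : ℕ) : ℝ) := by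
      exact_mod_cast h.le
    push_cast at h'
    rw [← hqq] at h'
    refine abs_le_of_sq_le_sq' ?_ (by positivity) |>.2
    nlinarith
  have h1 : (1 : ℝ) ≤ K * lg * q :=
    one_le_mul_of_one_le_of_one_le (one_le_mul_of_one_le_of_one_le hK' hlg') hq
  have hS2 : (S : ℝ) ≤ 2 * (K * lg * q) := by
    rw [Nat.cast_sub (by omega)] at hS1
    push_cast at hS1
    linarith
  have h2 : (1 : ℝ) ≤ n * lg * lg * q :=
    one_le_mul_of_one_le_of_one_le (one_le_mul_of_one_le_of_one_le
      (one_le_mul_of_one_le_of_one_le hn' hlg') hlg') hq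
  have h3 : (lg : ℝ) ^ 2 ≤ 16 * Real.log n ^ 2 := by nlinarith
  calc ((8 * cellCount K n lg S : ℕ) : ℝ)
      = 8 * (n * lg * (384 + 4096 * K) * S + 20 * 1) := by
        unfold cellCount
        push_cast
        ring
    _ ≤ 8 * (n * lg * (384 + 4096 * K) * (2 * (K * lg * q)) + 20 * (n * lg * lg * q)) := by
        gcongr
    _ = 8 * (2 * K * (384 + 4096 * K) + 20) * (n * q) * lg ^ 2 := by ring
    _ ≤ 8 * (2 * K * (384 + 4096 * K) + 20) * (n * q) * (16 * Real.log n ^ 2) := by gcongr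
    _ = memoryConstant K * (n * q) * Real.log n ^ 2 := by
        unfold memoryConstant
        push_cast
        ring

/-- Words of the chosen length hold all numbers that occur: these are at most
`wordConstant K * n ^ 6`. -/
lemma words_le {K n Δ S lg : ℕ} (hn : 0 < n) (hΔ : Δ ≤ n) (hlg : n ≤ 2 ^ lg)
    (hlgn : lg ≤ n) (hlg0 : 0 < lg) (hK : 0 < K) (hS : S ≤ Δ * ((K * lg) * (K * lg))) :
    2 * cellCount K n lg S + 1024 * Δ + 20 < 2 ^ ((wordConstant K + 6) * lg) ∧
      S * S < 2 ^ ((wordConstant K + 6) * lg) ∧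
      K * lg * (K * lg) < 2 ^ ((wordConstant K + 6) * lg) := by
  have hbound : wordConstant K * n ^ 6 < 2 ^ ((wordConstant K + 6) * lg) := by
    calc wordConstant K * n ^ 6 < 2 ^ wordConstant K * n ^ 6 :=
          Nat.mul_lt_mul_of_pos_right Nat.lt_two_pow_self (by positivity)
      _ ≤ (2 ^ lg) ^ wordConstant K * (2 ^ lg) ^ 6 := by
          gcongr
          exact Nat.le_self_pow hlg0.ne' 2
      _ = 2 ^ ((wordConstant K + 6) * lg) := by
          rw [← pow_add, ← pow_mul, mul_comm lg]
  have hS' : S ≤ K ^ 2 * n ^ 3 := by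
    calc S ≤ Δ * ((K * lg) * (K * lg)) := hS
      _ ≤ n * ((K * n) * (K * n)) := by gcongr
      _ = K ^ 2 * n ^ 3 := by ring
  have hp1 : n ^ 1 ≤ n ^ 6 := Nat.pow_le_pow_right hn (by norm_num)
  have hp2 : n ^ 2 ≤ n ^ 6 := Nat.pow_le_pow_right hn (by norm_num)
  have hp5 : n ^ 5 ≤ n ^ 6 := Nat.pow_le_pow_right hn (by norm_num)
  have hp0 : 1 ≤ n ^ 6 := Nat.one_le_pow _ _ hn
  have hcell : cellCount K n lg S ≤ K ^ 2 * (384 + 4096 * K) * n ^ 6 + 20 := by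
    calc cellCount K n lg S = n * lg * (384 + 4096 * K) * S + 20 := by
          unfold cellCount; ring
      _ ≤ n * n * (384 + 4096 * K) * (K ^ 2 * n ^ 3) + 20 := by gcongr
      _ = K ^ 2 * (384 + 4096 * K) * n ^ 5 + 20 := by ring
      _ ≤ _ := by gcongr
  have hW : wordConstant K * n ^ 6 =
      2 * (K ^ 2 * (384 + 4096 * K) * n ^ 6) + K ^ 4 * n ^ 6 + 1104 * n ^ 6 := by
    unfold wordConstant; ring
  refine ⟨?_, ?_, ?_⟩
  · rw [pow_one] at hp1
    omega
  · have : S * S ≤ K ^ 4 * n ^ 6 := by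
      calc S * S ≤ (K ^ 2 * n ^ 3) * (K ^ 2 * n ^ 3) := by gcongr
        _ = K ^ 4 * n ^ 6 := by ring
    omega
  · have : K * lg * (K * lg) ≤ K ^ 4 * n ^ 6 := by
      calc K * lg * (K * lg) ≤ K * n * (K * n) := by gcongr
        _ = K ^ 2 * n ^ 2 := by ring
        _ ≤ K ^ 4 * n ^ 6 :=
             Nat.mul_le_mul (Nat.pow_le_pow_right hK (by norm_num)) hp2
    omega

/-- The least `S` with `X ≤ S ^ 2`, the phase length that the program finds. -/
lemma exists_phase {X : ℕ} (hX : 0 < X) :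
    ∃ S, 0 < S ∧ X ≤ S * S ∧ (∀ S' < S, S' * S' < X) ∧ S ≤ X := by
  have hex : ∃ S, X ≤ S * S := ⟨X, Nat.le_mul_self X⟩
  refine ⟨Nat.find hex, ?_, Nat.find_spec hex, fun S' hS' => not_le.1 (Nat.find_min hex hS'),
    Nat.find_min' hex (Nat.le_mul_self X)⟩
  rw [Nat.find_pos]
  omega

end WStream

open WStream in
theorem corollary2 (c : ℕ) :
    ∃ (r : ℕ) (P : WStream.Cmd r) (C κ k : ℕ),
      ∀ n Δ : ℕ, 1 ≤ Δ →
        ∃ M : ℕ,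
          ((r * M : ℕ) : ℝ) ≤ C * (n * Real.sqrt Δ) * Real.log n ^ k ∧
          ∀ (G : SimpleGraph (Fin n)) [DecidableRel G.Adj], G.maxDegree = Δ →
            ∀ σ : List (Fin n × Fin n), WStream.IsEdgeStream G σ →
              ∃ fuel : ℕ,
                1 - 1 / (n : ℝ) ^ c ≤
                  WStream.successProb P
                    { n := n, Δ := Δ, cells := M, bits := κ * Nat.clog 2 n } fuel G (C * Δ) σ := by
  refine ⟨8, program (c + 8), memoryConstant (c + 8), wordConstant (c + 8) + 6, 2,
    fun n Δ hΔ => ?_⟩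
  by_cases hn : Δ < n
  swap
  · -- there is no graph with this maximum degree
    refine ⟨0, ?_, fun G _ hG => ?_⟩
    · have := Real.log_natCast_nonneg n
      simp only [mul_zero, Nat.cast_zero]
      positivity
    · rcases Nat.eq_zero_or_pos n with rfl | hn0
      · rw [SimpleGraph.maxDegree_of_subsingleton] at hG
        omega
      · have : Nonempty (Fin n) := ⟨⟨0, hn0⟩⟩
        have := G.maxDegree_lt_card_verts
        rw [Fintype.card_fin] at this
        omega
  have hn2 : 2 ≤ n := by omega
  have hlg : 0 < Nat.clog 2 n := Nat.clog_pos (by norm_num) hn2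
  have hnlg : n ≤ 2 ^ Nat.clog 2 n := Nat.le_pow_clog (by norm_num) n
  obtain ⟨S, hS0, hSX, hmin, hSle⟩ := exists_phase
    (X := Δ * (((c + 8) * Nat.clog 2 n) * ((c + 8) * Nat.clog 2 n))) (by positivity)
  refine ⟨cellCount (c + 8) n (Nat.clog 2 n) S,
    eight_mul_cellCount_le (by omega) hn2 hΔ hS0 hmin, fun G _ hG σ hσ => ?_⟩
  obtain ⟨hw1, hw2, hw3⟩ := words_le (by omega) hn.le hnlg (clog_le_self n) hlg
    (show 0 < c + 8 by omega) hSle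
  set E : Env :=
    { n := n
      Δ := Δ
      cells := cellCount (c + 8) n (Nat.clog 2 n) S
      bits := (wordConstant (c + 8) + 6) * Nat.clog 2 n } with hE
  have hT0 : S ≤ 2048 * ((c + 8) * (S * Nat.clog 2 n)) := by
    calc S ≤ S * Nat.clog 2 n := Nat.le_mul_of_pos_right _ hlg
      _ ≤ (c + 8) * (S * Nat.clog 2 n) := Nat.le_mul_of_pos_left _ (by omega)
      _ ≤ _ := Nat.le_mul_of_pos_left _ (by norm_num)
  have hf : Fits E (Nat.clog 2 E.n) S (64 * S) (2048 * ((c + 8) * (S * Nat.clog 2 E.n))) := by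
    refine ⟨hS0, rfl, hS0.trans_le hT0, ?_, ?_, ?_, hw1⟩
    all_goals simp only [hE, cellCount]; omega
  have hQ : 2 + (Δ / S + 1) ≤ 64 * S := by
    have h1 : Δ ≤ S * S := le_trans (Nat.le_mul_of_pos_right _ (by positivity)) hSX
    have h2 : Δ / S ≤ S := Nat.div_le_of_le_mul h1
    omega
  obtain ⟨L, hl⟩ := exists_levels (E := E) (hn.trans_le hnlg) hT0 hQ
  have hd : ∀ w, hdeg (history σ) w ≤ E.Δ := fun w => (hσ.hdeg_le w).trans hG.le
  have hprob := program_probGe (K := c + 8) (F := history σ) (st := initial 8 σ)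
    (A := fun t => ReportsEdgeColoring G (memoryConstant (c + 8) * Δ) t.output)
    hf hl hn2 (by omega) rfl hSX hmin hw2 hw3 hΔ hσ.simpleHist hd ?_ (fun _ _ => rfl)
    (by rw [history, List.reverse_reverse]; rfl) rfl
  · obtain ⟨N, hN⟩ := hprob
    refine ⟨N, le_trans ?_ (hN N le_rfl)⟩
    exact sub_le_sub_left (sum_failure_le hn2 hn hnlg (clog_le_self n) hl.le) 1
  · intro s t ht hg
    rw [ht]
    refine reportsEdgeColoring_outputOf hS0 (by omega) hσ.simpleHist ?_ ?_ hd hg ?_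
    · intro e he
      obtain ⟨p, hp, rfl⟩ := List.mem_map.1 ((hσ.2 e).2 he)
      exact ⟨_, mem_history.2 ⟨p, hp, rfl⟩, rfl⟩
    · intro q hq
      obtain ⟨p, hp, rfl⟩ := mem_history.1 hq
      exact ⟨_, hσ.mem_edgeSet hp, rfl⟩
    · have h1 := hl.base_le hf le_rfl
      have h2 : 1024 * Δ ≤ memoryConstant (c + 8) * Δ :=
        Nat.mul_le_mul_right _ (by unfold memoryConstant; omega)
      change _ + _ ≤ 1024 * Δ at h1
      change base (64 * S) S Δ L + 1024 * levelDeg Δ L ≤ _ at h1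
      change base (64 * S) S Δ L + 2 * levelDeg Δ L ≤ _
      omega
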